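/- **Setting.** Let $d\ge 2$ and let $R\ge 3$ be odd. The lattice $\mathcal C=\mathcal C[d\times d\times R]$ consists of one qubit at every $u\in\mathbb Z^3$ with $1\le u_1\le 2d-1$, $0\le u_2\le 2d-2$, $1\le u_3\le R$ whose coordinates are neither all odd nor all even. Let $\mathrm{neigh}(u)$ be the set of qubits at Manhattan distance $1$ from $u$, and let $W=H^{\otimes\mathcal C}\big(\prod_{\{u,v\}}CZ_{u,v}\big)H^{\otimes\mathcal C}$, with the product over all pairs of neighbouring qubits; $W|0^{\mathcal C}\rangle$ is the cluster state. Let $q_1=(1,0,1)$ and $q_2=(1,0,R)$. Let $\mathcal B$ be the set of qubits with $u_3\in\{1,R\}$ and exactly one of $u_1,u_2$ odd, and $\mathcal A=\mathcal C\setminus\mathcal B$, $\mathcal X=\{u\in\mathcal B\setminus\{q_1,q_2\}: u_2\ge u_1+1\}$, $\mathcal Z=\{u\in\mathcal B\setminus\{q_1,q_2\}: u_2<u_1+1\}$. *Decoding graphs.* Edges are labelled by measured qubits. The decoding graph has edge set $\mathsf E=\mathcal X\cup\{u\in\mathcal A:\text{exactly one coordinate odd}\}$. An edge labelled $u$ joins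 $u\pm e_1$ if $u_1$ is odd; it joins $u\pm e_2$ if $u_1$ is even and $u_2$ odd; if $u_1,u_2$ are even it joins $u\pm e_3$ for $1<u_3<R$, and it joins $u$ to $u+e_3$ (resp. $u-e_3$) for $u_3=1$ (resp. $u_3=R$). Its internal vertices are the sites $u$ with $u_1,u_2$ even, $2\le u_1\le 2d-2$, $0\le u_2\le 2d-2$, $1\le u_3\le R$, and $u_3$ even or $u_3\in\{1,R\}$, such that $\mathrm{neigh}(u)\subset\mathsf E$. The dual decoding graph has edge set $\mathsf E^*=\mathcal Z\cup\{u\in\mathcal A:\text{exactly two coordinates odd}\}$; the edge labelled $u$ joins $u\pm e_i$, where $u_i$ is the even coordinate. Its internal vertices are the sites $u$ with all coordinates odd, $1\le u_1\le 2d-1$, $1\le u_2\le 2d-3$, $1\le u_3\le R$, such that $\mathrm{neigh}(u)\subset\mathsf E^*$. In each graph, the boundary $\partial S$ of a set $S$ of edges is the set of internal vertices incident with an odd number of edges of $S$, and a minimum matching of a set $T$ of internal vertices is a set $M$ of edges with $\partial M=T$ of smallest size. Fix, for each of the two graphs, any function $\mathsf{MinMatch}$, $\mathsf{MinMatch}^*$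 that returns a minimum matching of every set that has a matching. Let $\mathcal L_X=\{(1,u_2,u_3)\in\mathcal C: u_2 \text{ even, and either } u_3\text{ even, or } u_2\ge2\text{ and }u_3\in\{1,R\}\}$ and $\mathcal L_Z^*=\{(u_1,0,u_3)\in\mathcal C: u_1,u_3\text{ odd}\}\setminus\{q_1,q_2\}$. *Protocol.* Given a state of the qubits $\mathcal C$, measure all qubits of $\mathcal X$ in the $X$-basis and all qubits of $\mathcal A\cup\mathcal Z$ in the $Z$-basis. Let $s$ be the set of qubits with outcome $1$. With $\langle A,B\rangle=|A\cap B|\bmod 2$ compute $$\hat c_X=\langle s,\mathcal L_X\rangle\oplus\langle\mathsf{MinMatch}(\partial(s\cap\mathsf E)),\mathcal L_X\rangle,\qquad \hat c_Z=\langle s,\mathcal L^*_Z\rangle\oplus\langle\mathsf{MinMatch}^*(\partial(s\cap\mathsf E^*)),\mathcal L^*_Z\rangle,$$ apply $Z^{\hat c_X}X^{\hat c_Z}$ to $q_1$, and output the state of $q_1,q_2$. *Noise and target.* A random element $E$ of the Pauli group on $\mathcal C$ is local stochastic of strength $p$, written $E\sim\mathcal N(p)$, if $\Pr[F\subseteq\mathrm{supp}(E)]\le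 p^{|F|}$ for every $F\subseteq\mathcal C$. Let $\Phi=(|00\rangle+|11\rangle)/\sqrt2$ and $\Phi_{(\alpha,\beta)}=(I\otimes Z^\alpha X^\beta)\Phi$. States are considered up to a global phase. **Theorem.** 1. For all $d\ge2$ and odd $R\ge3$, the unitary $W$ is implemented by a circuit of depth $6$ consisting of Hadamard gates and $CZ$ gates between neighbouring qubits. 2. Let $d\ge2$, let $R\ge3$ be odd, let $0\le p\le\frac1{400}$ and $E\sim\mathcal N(p)$. Run the protocol on $EW|0^{\mathcal C}\rangle$. There is a probability distribution $\nu$ on $\{0,1\}^2$ such that, over the choice of $E$ and the measurement outcomes, the output is $\Phi_{(\alpha,\beta)}$ with probability $\nu_{(\alpha,\beta)}$ for all $\alpha,\beta$, and $$\nu_{(0,0)}\ \ge\ 1-\big[4806+200\,dR\,(10\sqrt p)^{d-2}\big]\,p .$$ 3. Let $d\ge3$, let $R\ge3$ be odd, $0<p\le\frac1{5006}$ and $R\le\frac1d\big(\frac1{10\sqrt p}\big)^{d-2}$, and let $E\sim\mathcal N(p)$. Then the output of the protocol run on $EW|0^{\mathcal C}\rangle$ is $\Phi_{(0,0)}$ with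 probability at least $1-5006p$. Likewise, with probability at least $1-5006p$, the state of $q_1,q_2$ after the measurement and before the correction is $\Phi_{(\hat c_X,\hat c_Z)}$. 4. Consequently $d=\Theta(\log R)$ suffices: there is a function $D:\mathbb N\to\mathbb N$ with $D(R)=\Theta(\log R)$ such that for every odd $R\ge3$ we have $D(R)\ge 3$ and, for every $p\in(0,\frac1{5006}]$ and every $E\sim\mathcal N(p)$, the output of the protocol on the lattice $\mathcal C[D(R)\times D(R)\times R]$ is $\Phi_{(0,0)}$ with probability at least $1-5006p$. -/

import Mathlib

open scoped BigOperators

noncomputable section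

namespace ClusterBus

/-! ### Pure states, Hadamard / controlled-Z gates and Pauli operators on finitely many qubits -/

section Qubits

variable {ι : Type} [Fintype ι] [DecidableEq ι]

/-- Bit strings indexed by `ι`. -/
abbrev Bits (ι : Type) : Type := ι → ZMod 2

/-- Vectors of the space of qubits labelled by `ι`, given by their amplitudes
in the computational basis. -/
abbrev State (ι : Type) : Type := Bits ι → ℂ

/-- Linear operators on the qubits labelled by `ι`. -/
abbrev Op (ι : Type) : Type := Module.End ℂ (State ι)

/-- The sign `(-1)^t` of a bit `t`. -/
def sgn (t : ZMod 2) : ℂ := if t = 0 then 1 else -1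

/-- The all-zero computational basis state. -/
def zeroState (ι : Type) [Fintype ι] : State ι := fun b => if b = 0 then 1 else 0

/-- The product `X^x` of Pauli-`X` operators: it flips the bits in the support of `x`. -/
def pauliX (x : Bits ι) : Op ι where
  toFun ψ := fun b => ψ (b + x)
  map_add' _ _ := rfl
  map_smul' _ _ := rfl

/-- The product `Z^z` of Pauli-`Z` operators. -/
def pauliZ (z : Bits ι) : Op ι where
  toFun ψ := fun b => sgn (∑ c, z c * b c) * ψ b
  map_add' ψ φ := by ext b; simp [mul_add]
  map_smul' a ψ := by ext b; simp; ring

/-- The Hadamard gate on the qubit `c`. -/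
def opH (c : ι) : Op ι where
  toFun ψ := fun b => (1 / (Real.sqrt 2 : ℂ)) *
    ∑ t : ZMod 2, sgn (b c * t) * ψ (Function.update b c t)
  map_add' ψ φ := by ext b; simp [mul_add, Finset.sum_add_distrib]
  map_smul' a ψ := by
    ext b
    simp only [Pi.smul_apply, smul_eq_mul, RingHom.id_apply, Finset.mul_sum]
    exact Finset.sum_congr rfl fun t _ => by ring

/-- The controlled-`Z` gate on the qubits `u` and `v`. -/
def opCZ (u v : ι) : Op ι where
  toFun ψ := fun b => sgn (b u * b v) * ψ b
  map_add' ψ φ := by ext b; simp [mul_add]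
  map_smul' a ψ := by ext b; simp; ring

theorem opH_commute (c c' : ι) : Commute (opH c) (opH c') := by
  rcases eq_or_ne c c' with rfl | h
  · exact Commute.refl _
  · refine LinearMap.ext fun ψ => funext fun b => ?_
    simp only [Module.End.mul_apply, opH, LinearMap.coe_mk, AddHom.coe_mk, Finset.mul_sum]
    rw [Finset.sum_comm]
    refine Finset.sum_congr rfl fun t _ => Finset.sum_congr rfl fun t' _ => ?_
    rw [Function.update_of_ne h, Function.update_of_ne h.symm, Function.update_comm h]
    ring

theorem opCZ_symm (u v : ι) : opCZ u v = opCZ v u := by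
  refine LinearMap.ext fun ψ => funext fun b => ?_
  simp [opCZ, mul_comm (b u)]

/-- The controlled-`Z` gate on an unordered pair of qubits. -/
def edgeCZ (e : Sym2 ι) : Op ι := Sym2.lift ⟨opCZ, opCZ_symm⟩ e

theorem edgeCZ_commute (e e' : Sym2 ι) : Commute (edgeCZ e) (edgeCZ e') := by
  induction e with | _ u v
  induction e' with | _ u' v'
  refine LinearMap.ext fun ψ => funext fun b => ?_
  simp only [edgeCZ, Sym2.lift_mk, Module.End.mul_apply, opCZ, LinearMap.coe_mk, AddHom.coe_mk]
  ring

/-- `H(S)`: a Hadamard gate on every qubit of `S`. -/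
def hadamards (S : Finset ι) : Op ι :=
  S.noncommProd opH fun c _ c' _ _ => opH_commute c c'

/-- The unitary `H(V) (∏_{u,v} CZ_{u,v}) H(V)` preparing, from the all-zero state,
the cluster state of a graph on the vertex set `V`; the product is over all edges. -/
def clusterUnitary (G : SimpleGraph ι) [DecidableRel G.Adj] : Op ι :=
  hadamards Finset.univ *
    (G.edgeFinset.noncommProd edgeCZ fun e _ e' _ _ => edgeCZ_commute e e') *
    hadamards Finset.univ

/-- The gates allowed in a circuit on a graph: Hadamard gates, and controlled-`Z` gates
between neighbouring qubits. -/
inductive Gate (G : SimpleGraph ι) : Type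
  | had (c : ι) : Gate G
  | cz (u v : ι) (h : G.Adj u v) : Gate G

/-- The qubits on which a gate acts. -/
def Gate.support {G : SimpleGraph ι} : Gate G → Finset ι
  | .had c => {c}
  | .cz u v _ => {u, v}

/-- The unitary of a gate. -/
def Gate.op {G : SimpleGraph ι} : Gate G → Op ι
  | .had c => opH c
  | .cz u v _ => opCZ u v

/-- A layer: gates which act on pairwise disjoint sets of qubits. -/
def IsLayer {G : SimpleGraph ι} (l : List (Gate G)) : Prop :=
  l.Pairwise fun g g' => Disjoint g.support g'.support

/-- The unitary of a list of layers, where the head of the list is applied first. -/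
def circuitOp {G : SimpleGraph ι} (L : List (List (Gate G))) : Op ι :=
  ((L.map fun l => (l.map Gate.op).prod).reverse).prod

/-- `U` is implemented by a circuit of `n` layers of Hadamard gates and nearest-neighbour
controlled-`Z` gates. -/
def HasCircuitOfDepth (G : SimpleGraph ι) (n : ℕ) (U : Op ι) : Prop :=
  ∃ L : List (List (Gate G)), L.length = n ∧ (∀ l ∈ L, IsLayer l) ∧ circuitOp L = U

/-- The Pauli group: the triple `(k, x, z)` is the operator `i^k X^x Z^z`. -/
abbrev Pauli (ι : Type) : Type := ZMod 4 × Bits ι × Bits ι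

/-- The operator of a Pauli group element. -/
def Pauli.op (P : Pauli ι) : Op ι :=
  (Complex.I ^ P.1.val) • (pauliX P.2.1 * pauliZ P.2.2)

/-- The qubits on which a Pauli operator acts as `X`, `Y` or `Z`. -/
def Pauli.support (P : Pauli ι) : Finset ι :=
  Finset.univ.filter fun c => P.2.1 c ≠ 0 ∨ P.2.2 c ≠ 0

open Classical in
/-- The random Pauli error with law `μ` is local stochastic of strength `p`:
`Pr[F ⊆ supp E] ≤ p ^ |F|` for every set `F` of qubits. -/
def IsLocalStochastic (p : ℝ) (μ : PMF (Pauli ι)) : Prop :=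
  ∀ F : Finset ι, (∑ E : Pauli ι, if F ⊆ E.support then (μ E).toReal else 0) ≤ p ^ F.card

/-- Two vectors agree up to a global phase. -/
def SameState (ψ φ : State ι) : Prop := ∃ a : ℂ, ‖a‖ = 1 ∧ ψ = a • φ

end Qubits

/-- The Bell state `Φ = (|00⟩ + |11⟩) / √2`. -/
def bellPhi : State (Fin 2) := fun b => if b 0 = b 1 then 1 / (Real.sqrt 2 : ℂ) else 0

/-- The Bell basis state `Φ_(α,β) = (I ⊗ Z^α X^β) Φ`. -/
def bell (α β : ZMod 2) : State (Fin 2) :=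
  pauliZ (Pi.single 1 α) (pauliX (Pi.single 1 β) bellPhi)

/-! ### Graphs with internal vertices and minimum matchings -/

section Matching

variable {V E : Type} [DecidableEq V]

/-- A finite graph with a set of internal vertices. Edges are labelled by elements of `E`;
only the labels in `edges` are edges of the graph. -/
structure IntGraph (V E : Type) where
  edges : Finset E
  ends : E → Sym2 V
  internal : Finset V

/-- The internal vertices on which an odd number of edges of `S` is incident. -/
def IntGraph.boundary (G : IntGraph V E) (S : Finset E) : Finset V :=
  G.internal.filter fun v => Odd (S.filter fun e => v ∈ G.ends e).card

/-- `M` is a matching of the set `T` of internal vertices. -/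
def IntGraph.IsMatching (G : IntGraph V E) (T : Finset V) (M : Finset E) : Prop :=
  M ⊆ G.edges ∧ G.boundary M = T

/-- `M` is a matching of `T` with the smallest possible number of edges. -/
def IntGraph.IsMinMatching (G : IntGraph V E) (T : Finset V) (M : Finset E) : Prop :=
  G.IsMatching T M ∧ ∀ M', G.IsMatching T M' → M.card ≤ M'.card

/-- `f` returns a minimum matching of every set which has a matching. -/
def IntGraph.IsMinMatchFun (G : IntGraph V E) (f : Finset V → Finset E) : Prop :=
  ∀ T, (∃ M, G.IsMatching T M) → G.IsMinMatching T (f T)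

theorem IntGraph.exists_isMinMatchFun (G : IntGraph V E) :
    ∃ f : Finset V → Finset E, G.IsMinMatchFun f := by
  have h : ∀ T, ∃ M, (∃ M, G.IsMatching T M) → G.IsMinMatching T M := by
    intro T
    by_cases hT : ∃ M, G.IsMatching T M
    · obtain ⟨M, hM, hmin⟩ := WellFounded.has_min
        (InvImage.wf (fun M : Finset E => M.card) Nat.lt_wfRel.wf) {M | G.IsMatching T M} hT
      exact ⟨M, fun _ => ⟨hM, fun M' hM' => not_lt.mp (hmin M' hM')⟩⟩
    · exact ⟨∅, fun h => absurd h hT⟩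
  choose f hf using h
  exact ⟨f, hf⟩

end Matching

/-- The parity of `|A ∩ B|`. -/
def parity {E : Type} [DecidableEq E] (A B : Finset E) : ZMod 2 := ((A ∩ B).card : ZMod 2)

/-! ### The cluster state lattice and the measurement pattern -/

/-- Points `(u₁, u₂, u₃)` of the integer lattice. -/
abbrev Site : Type := ℤ × ℤ × ℤ

/-- Manhattan distance. -/
def siteDist (u v : Site) : ℤ := |u.1 - v.1| + |u.2.1 - v.2.1| + |u.2.2 - v.2.2|

/-- The sites with `1 ≤ u₁ ≤ 2d-1`, `0 ≤ u₂ ≤ 2d-2`, `1 ≤ u₃ ≤ R`. -/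
def box (d R : ℕ) : Finset Site :=
  Finset.Icc 1 (2 * (d : ℤ) - 1) ×ˢ Finset.Icc 0 (2 * (d : ℤ) - 2) ×ˢ Finset.Icc 1 (R : ℤ)

/-- The qubits of the lattice `𝒞[d × d × R]`: the sites of the box whose coordinates are
neither all odd nor all even. -/
def qubits (d R : ℕ) : Finset Site :=
  (box d R).filter fun u =>
    ¬ (Odd u.1 ∧ Odd u.2.1 ∧ Odd u.2.2) ∧ ¬ (Even u.1 ∧ Even u.2.1 ∧ Even u.2.2)

/-- The qubits, as a type. -/
abbrev Qubit (d R : ℕ) : Type := {u : Site // u ∈ qubits d R}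

/-- The nearest neighbour qubits of a site. -/
def neigh (d R : ℕ) (u : Site) : Finset Site := (qubits d R).filter fun v => siteDist u v = 1

/-- The graph of the cluster state: qubits at distance one are adjacent. -/
def clusterGraph (d R : ℕ) : SimpleGraph (Qubit d R) where
  Adj u v := siteDist u.1 v.1 = 1
  symm := ⟨fun u v h => by simpa [siteDist, abs_sub_comm] using h⟩
  loopless := ⟨fun u h => by simp [siteDist] at h⟩

instance (d R : ℕ) : DecidableRel (clusterGraph d R).Adj :=
  fun u v => inferInstanceAs (Decidable (siteDist u.1 v.1 = 1))

/-- The first unmeasured qubit. -/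
def q₁ : Site := (1, 0, 1)

/-- The second unmeasured qubit. -/
def q₂ (R : ℕ) : Site := (1, 0, (R : ℤ))

/-- The qubits of type (even, odd) or (odd, even) in the front and back layers. -/
def setB (d R : ℕ) : Finset Site :=
  (qubits d R).filter fun u => (u.2.2 = 1 ∨ u.2.2 = (R : ℤ)) ∧
    ((Even u.1 ∧ Odd u.2.1) ∨ (Odd u.1 ∧ Even u.2.1))

/-- The other qubits, which are measured in the `Z`-basis. -/
def setA (d R : ℕ) : Finset Site := qubits d R \ setB d R

/-- The qubits measured in the `X`-basis. -/
def setX (d R : ℕ) : Finset Site :=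
  (setB d R \ {q₁, q₂ R}).filter fun u => 1 + u.1 ≤ u.2.1

/-- The qubits of the front and back layers which are measured in the `Z`-basis. -/
def setZ (d R : ℕ) : Finset Site :=
  (setB d R \ {q₁, q₂ R}).filter fun u => u.2.1 < 1 + u.1

/-! ### The two decoding graphs

The edges of both graphs are labelled by measured qubits. -/

/-- Exactly one of the three coordinates is odd. -/
def OneOdd (u : Site) : Prop :=
  (Odd u.1 ∧ Even u.2.1 ∧ Even u.2.2) ∨ (Even u.1 ∧ Odd u.2.1 ∧ Even u.2.2) ∨
    (Even u.1 ∧ Even u.2.1 ∧ Odd u.2.2)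

instance : DecidablePred OneOdd := fun u => by unfold OneOdd; infer_instance

/-- Edge labels of the decoding graph: the `X`-measured qubits, and the qubits with
exactly one odd coordinate. -/
def primalEdges (d R : ℕ) : Finset Site := setX d R ∪ (setA d R).filter OneOdd

/-- Edge labels of the dual decoding graph: the `Z`-measured qubits of the front and
back layers, and the qubits of `setA` with exactly two odd coordinates. -/
def dualEdges (d R : ℕ) : Finset Site := setZ d R ∪ (setA d R).filter fun u => ¬ OneOdd u

/-- The endpoints of an edge of the decoding graph. The label is the midpoint of the edge,
except for the edges of length one at the front and back, which are labelled by their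
endpoint in the layer `u₃ = 1` or `u₃ = R`. -/
def primalEnds (R : ℕ) (u : Site) : Sym2 Site :=
  if Odd u.1 then s((u.1 - 1, u.2.1, u.2.2), (u.1 + 1, u.2.1, u.2.2))
  else if Odd u.2.1 then s((u.1, u.2.1 - 1, u.2.2), (u.1, u.2.1 + 1, u.2.2))
  else if u.2.2 = 1 then s((u.1, u.2.1, 1), (u.1, u.2.1, 2))
  else if u.2.2 = (R : ℤ) then s((u.1, u.2.1, (R : ℤ) - 1), (u.1, u.2.1, (R : ℤ)))
  else s((u.1, u.2.1, u.2.2 - 1), (u.1, u.2.1, u.2.2 + 1))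

/-- The endpoints of an edge of the dual decoding graph; the label is the midpoint. -/
def dualEnds (u : Site) : Sym2 Site :=
  if Even u.1 then s((u.1 - 1, u.2.1, u.2.2), (u.1 + 1, u.2.1, u.2.2))
  else if Even u.2.1 then s((u.1, u.2.1 - 1, u.2.2), (u.1, u.2.1 + 1, u.2.2))
  else s((u.1, u.2.1, u.2.2 - 1), (u.1, u.2.1, u.2.2 + 1))

/-- The decoding graph. Its vertices are the sites of type (even, even, even), and those of
type (even, even) in the front and back layers. A vertex is internal if all qubits next to it
are edges of the graph; the endpoints of dangling edges (`u₁ = 0` or `u₁ = 2d`) are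
external. -/
def primalGraph (d R : ℕ) : IntGraph Site Site where
  edges := primalEdges d R
  ends := primalEnds R
  internal := (box d R).filter fun u =>
    Even u.1 ∧ Even u.2.1 ∧ (Even u.2.2 ∨ u.2.2 = 1 ∨ u.2.2 = (R : ℤ)) ∧
      neigh d R u ⊆ primalEdges d R

/-- The dual decoding graph. Its vertices are the sites of type (odd, odd, odd). A vertex is
internal if all qubits next to it are edges of the graph; the endpoints of dangling edges
(`u₂ = -1` or `u₂ = 2d-1`) are external. -/
def dualGraph (d R : ℕ) : IntGraph Site Site where
  edges := dualEdges d R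
  ends := dualEnds
  internal := (box d R).filter fun u =>
    Odd u.1 ∧ Odd u.2.1 ∧ Odd u.2.2 ∧ neigh d R u ⊆ dualEdges d R

/-- The recovery set of the decoding graph: the edges at the left boundary. -/
def recoveryX (d R : ℕ) : Finset Site :=
  (qubits d R).filter fun u => u.1 = 1 ∧ Even u.2.1 ∧
    (Even u.2.2 ∨ (2 ≤ u.2.1 ∧ (u.2.2 = 1 ∨ u.2.2 = (R : ℤ))))

/-- The recovery set of the dual decoding graph: the edges at the bottom boundary. -/
def recoveryZ (d R : ℕ) : Finset Site :=
  (qubits d R \ {q₁, q₂ R}).filter fun u => Odd u.1 ∧ u.2.1 = 0 ∧ Odd u.2.2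

/-! ### The protocol -/

/-- The measured qubits. -/
abbrev Measured (d R : ℕ) : Type := {c : Qubit d R // c.1 ≠ q₁ ∧ c.1 ≠ q₂ R}

/-- The collection `(a, x, z)` of all measurement outcomes. -/
abbrev Outcome (d R : ℕ) : Type := Measured d R → ZMod 2

/-- The bit string with value `b 0` at `q₁`, `b 1` at `q₂`, and `s` elsewhere. -/
def combine {d R : ℕ} (s : Outcome d R) (b : Bits (Fin 2)) : Bits (Qubit d R) := fun c =>
  if h₁ : c.1 = q₁ then b 0 else if h₂ : c.1 = q₂ R then b 1 else s ⟨c, h₁, h₂⟩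

/-- The cluster state of the lattice `𝒞[d × d × R]`. -/
def clusterState (d R : ℕ) : State (Qubit d R) :=
  clusterUnitary (clusterGraph d R) (zeroState (Qubit d R))

/-- The unnormalized state `(I ⊗ ⟨s| H(𝒳)) E W |0⟩` of `q₁` (index `0`) and `q₂` (index `1`). -/
def postVec {d R : ℕ} (E : Pauli (Qubit d R)) (s : Outcome d R) : State (Fin 2) := fun b =>
  hadamards (Finset.univ.filter fun c : Qubit d R => c.1 ∈ setX d R)
    (E.op (clusterState d R)) (combine s b)

/-- The probability of the outcome `s` when the cluster state is corrupted by `E`. -/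
def outcomeProb {d R : ℕ} (E : Pauli (Qubit d R)) (s : Outcome d R) : ℝ :=
  ∑ b, ‖postVec E s b‖ ^ 2

/-- The (normalized) state of `q₁`, `q₂` after the measurement with outcome `s`. -/
def postState {d R : ℕ} (E : Pauli (Qubit d R)) (s : Outcome d R) : State (Fin 2) :=
  ((1 / Real.sqrt (outcomeProb E s) : ℝ) : ℂ) • postVec E s

/-- The qubits with measurement outcome `1`. -/
def ones {d R : ℕ} (s : Outcome d R) : Finset Site :=
  (Finset.univ.filter fun c => s c = 1).image fun c => c.1.1

/-- The correction bit `ĉ_X`, computed with the matching function `f` of the decoding graph. -/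
def corrX {d R : ℕ} (f : Finset Site → Finset Site) (s : Outcome d R) : ZMod 2 :=
  parity (ones s) (recoveryX d R) +
    parity (f ((primalGraph d R).boundary (ones s ∩ primalEdges d R))) (recoveryX d R)

/-- The correction bit `ĉ_Z`, computed with the matching function `g` of the dual
decoding graph. -/
def corrZ {d R : ℕ} (g : Finset Site → Finset Site) (s : Outcome d R) : ZMod 2 :=
  parity (ones s) (recoveryZ d R) +
    parity (g ((dualGraph d R).boundary (ones s ∩ dualEdges d R))) (recoveryZ d R)

/-- The output of the protocol: `Z^{ĉ_X} X^{ĉ_Z}` is applied to `q₁`. -/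
def outputState {d R : ℕ} (f g : Finset Site → Finset Site) (E : Pauli (Qubit d R))
    (s : Outcome d R) : State (Fin 2) :=
  pauliZ (Pi.single 0 (corrX f s)) (pauliX (Pi.single 0 (corrZ g s)) (postState E s))

open Classical in
/-- The probability of an event, over the random error `E` with law `μ` and the
measurement outcomes `s` given `E`. -/
def prob {d R : ℕ} (μ : PMF (Pauli (Qubit d R)))
    (A : Pauli (Qubit d R) → Outcome d R → Prop) : ℝ :=
  ∑ E, ∑ s, if A E s then (μ E).toReal * outcomeProb E s else 0

/-- The probability that the output of the protocol is the Bell state `Φ_(α,β)`. -/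
def outputProb {d R : ℕ} (f g : Finset Site → Finset Site) (μ : PMF (Pauli (Qubit d R)))
    (α β : ZMod 2) : ℝ :=
  prob μ fun E s => SameState (outputState f g E s) (bell α β)

end ClusterBus

end

open scoped BigOperators

set_option linter.unusedSectionVars false

noncomputable section

namespace ClusterBus

section Qubits

variable {ι : Type} [Fintype ι] [DecidableEq ι]

/-! ### Conjugation of Pauli operators by the gates -/

/-! The argument combines stabilizers of the cluster state with a path-counting bound for minimum
matching.

Stabilizers. For a set `S` of pairwise non-adjacent qubits, `Z` on `S` times `X` on the mod-2
neighbourhood of `S` fixes `W|0⟩` (`pauliXZ_clusterState`). The Hadamard gates on the `X`-measured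
qubits turn some of these operators into pure `Z` operators, which force parities of the outcomes.
The cells of the lattice, and single sites of the two outer layers, give one such constraint per
internal vertex of the two decoding graphs: without noise the outcomes have empty boundary
(`parity_primal_incident`, `parity_dual_incident`). The planes `u₁ = 1` and `u₂ = 0` give operators
acting on `q₁`, `q₂` as `XX` and `ZZ`, with signs read from the outcomes on the recovery sets. Hence
the remaining pair is in a Bell state with known label (`amplitude_eq_smul_bell`).

Noise. A Pauli error moves through the measurement: it flips the outcomes by `flips E` and acts on
`q₁`, `q₂` by a Pauli, which permutes the Bell basis (`postVec_eq`, `pauliXZ_bell`). Thus `s + flips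
E` is a noiseless outcome, `s` has the same boundary as `flips E`, and the correction bits are right
unless `q₁` or `q₂` is hit or the matching differs from `flips E` by an odd number of recovery
edges.

Counting. In that last case the symmetric difference has no boundary and contains a trail from the
recovery side to a different external boundary; minimality makes at least half of its edges errors
(`exists_trail_of_failure`). The other boundary is either the opposite side, which takes at least
`d` edges, or a triangle in an outer layer. The triangles come close to the recovery side only near
`q₁` and `q₂`, so a trail of length `n < d` has at most `4n(n+1)` possible first edges,
independently of `R`. Each first edge has at most `5^(n-1)` continuations, and each trail costs `2^n
p^⌈n/2⌉`. Summation gives a constant times `p`, plus a term in `dR(10√p)^(d-2) p` for trails of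
length at least `d`; the latter is controlled once `d` is of order `log R`.

Circuit. The cluster graph is bipartite and its edges split into four matchings, so four layers of
`CZ` between two Hadamard layers suffice (`hasCircuitOfDepth_six`). -/

theorem zmod_two_cases (t : ZMod 2) : t = 0 ∨ t = 1 := by
  revert t
  decide

theorem zmod_two_add_self (t : ZMod 2) : t + t = 0 := CharTwo.add_self_eq_zero t

@[simp] theorem sgn_zero : sgn 0 = 1 := by simp [sgn]

@[simp] theorem sgn_one : sgn 1 = -1 := by simp [sgn]

theorem sgn_add (s t : ZMod 2) : sgn (s + t) = sgn s * sgn t := by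
  rcases zmod_two_cases s with rfl | rfl <;> rcases zmod_two_cases t with rfl | rfl <;>
    simp [zmod_two_add_self]

@[simp] theorem norm_sgn (s : ZMod 2) : ‖sgn s‖ = 1 := by
  rcases zmod_two_cases s with rfl | rfl <;> simp

theorem bits_add_self (x : Bits ι) : x + x = 0 := funext fun c => CharTwo.add_self_eq_zero (x c)

/-- The Pauli operator `X^x Z^z`. -/
def pauliXZ (x z : Bits ι) : Op ι := pauliX x * pauliZ z

theorem pauliXZ_apply (x z : Bits ι) (ψ : State ι) (b : Bits ι) :
    pauliXZ x z ψ b = sgn (∑ c, z c * (b c + x c)) * ψ (b + x) := rfl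

theorem opH_apply (c : ι) (ψ : State ι) (b : Bits ι) :
    opH c ψ b = (1 / (Real.sqrt 2 : ℂ)) *
      ∑ t : ZMod 2, sgn (b c * t) * ψ (Function.update b c t) := rfl

theorem sum_eq_add_sum_erase (c : ι) (f : ι → ZMod 2) :
    ∑ i, f i = f c + ∑ i ∈ Finset.univ.erase c, f i :=
  (Finset.add_sum_erase _ _ (Finset.mem_univ c)).symm

/-- A Hadamard exchanges `X` and `Z` at `c`. The sign restores the order `X` before `Z` and appears
only when both are present. -/
theorem opH_pauliXZ (c : ι) (x z : Bits ι) (ψ : State ι) :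
    opH c (pauliXZ x z ψ) = sgn (x c * z c) •
      pauliXZ (Function.update x c (z c)) (Function.update z c (x c)) (opH c ψ) := by
  ext b
  simp only [Pi.smul_apply, smul_eq_mul, pauliXZ_apply, opH_apply]
  -- Shifting the summed bit by `x c` makes both sides evaluate `ψ` at the same strings, so only
  -- signs remain to be compared.
  rw [← Equiv.sum_comp (Equiv.addRight (x c)), Finset.mul_sum, Finset.mul_sum, Finset.mul_sum,
    Finset.mul_sum]
  refine Finset.sum_congr rfl fun t _ => ?_
  have harg : Function.update (b + Function.update x c (z c)) c t =
      Function.update b c (t + x c) + x := by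
    ext i
    rcases eq_or_ne i c with rfl | h
    · simp [add_assoc, zmod_two_add_self]
    · simp [h]
  rw [harg]
  have hrest : ∑ i ∈ Finset.univ.erase c,
        Function.update z c (x c) i * (b i + Function.update x c (z c) i) =
      ∑ i ∈ Finset.univ.erase c, z i * (Function.update b c (t + x c) i + x i) := by
    refine Finset.sum_congr rfl fun i hi => ?_
    have hi' := (Finset.mem_erase.mp hi).1
    simp [hi']
  have key : sgn (b c * (t + x c)) * sgn (∑ i, z i * (Function.update b c (t + x c) i + x i)) =
      sgn (x c * z c) * sgn (∑ i, Function.update z c (x c) i *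
        (b i + Function.update x c (z c) i)) *
        sgn ((b + Function.update x c (z c)) c * t) := by
    rw [sum_eq_add_sum_erase c, sum_eq_add_sum_erase c (fun i => Function.update z c (x c) i *
        (b i + Function.update x c (z c) i)), hrest]
    generalize ∑ i ∈ Finset.univ.erase c, z i * (Function.update b c (t + x c) i + x i) = r
    simp only [← sgn_add, Function.update_self, Pi.add_apply]
    congr 1
    generalize b c = b'
    generalize x c = x'
    generalize z c = z'
    clear harg hrest
    revert b' x' z' t r
    decide
  simp only [Equiv.coe_addRight]
  linear_combination (1 / (Real.sqrt 2 : ℂ)) * ψ (Function.update b c (t + x c) + x) * key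

theorem hadamards_empty : hadamards (∅ : Finset ι) = 1 := Finset.noncommProd_empty _ _

theorem hadamards_insert {S : Finset ι} {c : ι} (h : c ∉ S) :
    hadamards (insert c S) = opH c * hadamards S :=
  Finset.noncommProd_insert_of_notMem _ _ _ _ h

theorem hadamards_pauliXZ (S : Finset ι) (x z : Bits ι) (ψ : State ι) :
    hadamards S (pauliXZ x z ψ) = sgn (∑ c ∈ S, x c * z c) •
      pauliXZ (fun c => if c ∈ S then z c else x c) (fun c => if c ∈ S then x c else z c)
        (hadamards S ψ) := by
  induction S using Finset.induction_on with
  | empty => simp [hadamards_empty]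
  | insert c S hc ih =>
    rw [hadamards_insert hc, Module.End.mul_apply, ih, map_smul, opH_pauliXZ, smul_smul,
      ← sgn_add, Finset.sum_insert hc, Module.End.mul_apply]
    simp only [hc, if_false]
    rw [add_comm]
    congr 3
    · ext i
      rcases eq_or_ne i c with rfl | h
      · simp
      · simp [h]
    · ext i
      rcases eq_or_ne i c with rfl | h
      · simp
      · simp [h]

theorem opCZ_apply (u v : ι) (ψ : State ι) (b : Bits ι) :
    opCZ u v ψ b = sgn (b u * b v) * ψ b := rfl

/-- Conjugation by `CZ` attaches a `Z` to the partner of each flipped endpoint. Two flipped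
endpoints would produce the extra sign `(-1)^(x u * x v)`, which `hx` excludes. -/
theorem opCZ_pauliXZ {u v : ι} (x z : Bits ι) (hx : x u * x v = 0)
    (ψ : State ι) :
    opCZ u v (pauliXZ x z ψ) =
      pauliXZ x (z + Pi.single u (x v) + Pi.single v (x u)) (opCZ u v ψ) := by
  ext b
  simp only [pauliXZ_apply, opCZ_apply, Pi.add_apply, add_mul, Finset.sum_add_distrib]
  rw [← mul_assoc, ← mul_assoc, ← sgn_add, ← sgn_add]
  congr 2
  simp only [Pi.single_apply, ite_mul, zero_mul, Finset.sum_ite_eq', Finset.mem_univ, if_true]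
  generalize ∑ i, z i * (b i + x i) = r
  generalize x u = xu at *
  generalize x v = xv at *
  generalize b u = bu
  generalize b v = bv
  revert r xu xv bu bv
  clear * -
  decide

/-- The bit string of the endpoints of `e` whose opposite endpoint lies in `x`. -/
def edgeShift (e : Sym2 ι) (x : Bits ι) : Bits ι := fun c => ∑ v, if e = s(c, v) then x v else 0

theorem edgeCZ_pauliXZ {e : Sym2 ι} (he : ¬ e.IsDiag) (x z : Bits ι)
    (hx : ∀ u v, e = s(u, v) → x u * x v = 0) (ψ : State ι) :
    edgeCZ e (pauliXZ x z ψ) = pauliXZ x (z + edgeShift e x) (edgeCZ e ψ) := by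
  induction e with | _ u v
  have huv : u ≠ v := by simpa using he
  have := opCZ_pauliXZ x z (hx u v rfl) ψ
  simp only [edgeCZ, Sym2.lift_mk]
  rw [this, add_assoc]
  congr 3
  ext c
  simp only [edgeShift, Pi.add_apply, Sym2.eq_iff, Pi.single_apply]
  by_cases h1 : c = u
  · subst h1
    have h2 : ∀ w, ((c = c ∧ v = w) ∨ (c = w ∧ v = c)) ↔ w = v := by
      intro w; constructor
      · rintro (⟨_, rfl⟩ | ⟨_, h⟩)
        · rfl
        · exact absurd h.symm huv
      · rintro rfl; exact Or.inl ⟨rfl, rfl⟩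
    rw [Finset.sum_congr rfl fun w _ => if_congr (h2 w) rfl rfl]
    simp [huv]
  · by_cases h3 : c = v
    · subst h3
      have h2 : ∀ w, ((u = c ∧ c = w) ∨ (u = w ∧ c = c)) ↔ w = u := by
        intro w; constructor
        · rintro (⟨h, _⟩ | ⟨h, _⟩)
          · exact absurd h huv
          · exact h.symm
        · rintro rfl; exact Or.inr ⟨rfl, rfl⟩
      rw [Finset.sum_congr rfl fun w _ => if_congr (h2 w) rfl rfl]
      simp [huv.symm]
    · have h2 : ∀ w, ¬ ((u = c ∧ v = w) ∨ (u = w ∧ v = c)) := by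
        rintro w (⟨h, _⟩ | ⟨_, h⟩)
        · exact h1 h.symm
        · exact h3 h.symm
      simp [h1, h3, h2]

/-- The sum modulo two of the neighbourhoods of the vertices of `x`. -/
def nbhd (G : SimpleGraph ι) [DecidableRel G.Adj] (x : Bits ι) : Bits ι :=
  fun c => ∑ v, if G.Adj c v then x v else 0

theorem sum_edgeShift (G : SimpleGraph ι) [DecidableRel G.Adj] (x : Bits ι) :
    ∑ e ∈ G.edgeFinset, edgeShift e x = nbhd G x := by
  ext c
  simp only [Finset.sum_apply, edgeShift, nbhd]
  rw [Finset.sum_comm]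
  refine Finset.sum_congr rfl fun v _ => ?_
  simp [SimpleGraph.mem_edgeFinset]

/-- The product of the controlled-`Z` gates on the edges in `S`. -/
def edgeProd (S : Finset (Sym2 ι)) : Op ι :=
  S.noncommProd edgeCZ fun e _ e' _ _ => edgeCZ_commute e e'

theorem edgeProd_empty : edgeProd (∅ : Finset (Sym2 ι)) = 1 := Finset.noncommProd_empty _ _

theorem edgeProd_insert {S : Finset (Sym2 ι)} {e : Sym2 ι} (h : e ∉ S) :
    edgeProd (insert e S) = edgeCZ e * edgeProd S :=
  Finset.noncommProd_insert_of_notMem _ _ _ _ h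

theorem clusterUnitary_eq (G : SimpleGraph ι) [DecidableRel G.Adj] :
    clusterUnitary G = hadamards Finset.univ * edgeProd G.edgeFinset * hadamards Finset.univ := rfl

theorem edgeProd_pauliXZ (G : SimpleGraph ι) [DecidableRel G.Adj] (x z : Bits ι)
    (hx : ∀ u v, G.Adj u v → x u * x v = 0) (ψ : State ι) (S : Finset (Sym2 ι))
    (hS : S ⊆ G.edgeFinset) :
    edgeProd S (pauliXZ x z ψ) = pauliXZ x (z + ∑ e ∈ S, edgeShift e x) (edgeProd S ψ) := by
  induction S using Finset.induction_on with
  | empty => simp [edgeProd_empty]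
  | insert e S he ih =>
    rw [edgeProd_insert he, Module.End.mul_apply,
      ih fun a ha => hS (Finset.mem_insert_of_mem ha), Module.End.mul_apply]
    have hmem := SimpleGraph.mem_edgeFinset.mp (hS (Finset.mem_insert_self e S))
    rw [edgeCZ_pauliXZ (G.not_isDiag_of_mem_edgeSet hmem), Finset.sum_insert he]
    · congr 2
      abel
    · rintro u v rfl
      exact hx u v hmem

/-- The first Hadamard layer turns `Z^x` into `X^x`, the `CZ` gates attach `Z` on the neighbourhood,
and the last layer exchanges the two parts. An independent set is disjoint from its neighbourhood,
so no sign appears. -/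
theorem clusterUnitary_pauliXZ (G : SimpleGraph ι) [DecidableRel G.Adj] (x : Bits ι)
    (hx : ∀ u v, G.Adj u v → x u * x v = 0) (ψ : State ι) :
    clusterUnitary G (pauliXZ 0 x ψ) = pauliXZ (nbhd G x) x (clusterUnitary G ψ) := by
  have h0 : ∀ c, x c * nbhd G x c = 0 := fun c => by
    rw [nbhd, Finset.mul_sum]
    refine Finset.sum_eq_zero fun v _ => ?_
    split_ifs with h
    · exact hx c v h
    · simp
  simp only [clusterUnitary_eq, Module.End.mul_apply]
  rw [hadamards_pauliXZ]
  simp only [Pi.zero_apply, zero_mul, Finset.sum_const_zero, sgn_zero, one_smul, Finset.mem_univ,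
    if_true]
  rw [edgeProd_pauliXZ G _ _ hx _ _ subset_rfl, sum_edgeShift, hadamards_pauliXZ]
  simp only [Finset.mem_univ, if_true, Pi.add_apply, zero_add, h0, Finset.sum_const_zero,
    sgn_zero, one_smul]

theorem pauliXZ_zeroState (z : Bits ι) : pauliXZ 0 z (zeroState ι) = zeroState ι := by
  ext b
  rw [pauliXZ_apply]
  by_cases h : b = 0
  · simp [h, zeroState]
  · simp [h, zeroState]

/-- The stabilizers of a cluster state. -/
theorem pauliXZ_clusterState (G : SimpleGraph ι) [DecidableRel G.Adj] (x : Bits ι)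
    (hx : ∀ u v, G.Adj u v → x u * x v = 0) :
    pauliXZ (nbhd G x) x (clusterUnitary G (zeroState ι)) = clusterUnitary G (zeroState ι) := by
  rw [← clusterUnitary_pauliXZ G x hx, pauliXZ_zeroState]

/-! ### Isometries -/

/-- The squared norm of a vector. -/
def normSq (ψ : State ι) : ℝ := ∑ b, ‖ψ b‖ ^ 2

/-- The operator preserves the norm. -/
def IsIsom (U : Op ι) : Prop := ∀ ψ, normSq (U ψ) = normSq ψ

theorem IsIsom.one : IsIsom (1 : Op ι) := fun _ => rfl

theorem IsIsom.mul {U V : Op ι} (hU : IsIsom U) (hV : IsIsom V) : IsIsom (U * V) := fun ψ => by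
  rw [Module.End.mul_apply, hU, hV]

theorem isIsom_pauliXZ (x z : Bits ι) : IsIsom (pauliXZ x z) := fun ψ => by
  simp only [normSq, pauliXZ_apply, norm_mul, norm_sgn, one_mul]
  exact Equiv.sum_comp (Equiv.addRight x) fun b => ‖ψ b‖ ^ 2

theorem isIsom_edgeCZ (e : Sym2 ι) : IsIsom (edgeCZ e) := fun ψ => by
  induction e with | _ u v
  simp [normSq, edgeCZ, opCZ_apply]

/-- Strings that differ only at `c` form pairs. On each pair the gate takes the normalized sum and
difference of two amplitudes, so the parallelogram law applies; summing over all strings counts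
every pair twice. -/
theorem isIsom_opH (c : ι) : IsIsom (opH c) := fun ψ => by
  have hpair : ∀ F : Bits ι → ℝ, ∑ b, (F b + F (b + Pi.single c 1)) = 2 * ∑ b, F b := fun F => by
    have := Equiv.sum_comp (Equiv.addRight (Pi.single c (1 : ZMod 2))) F
    simp only [Equiv.coe_addRight] at this
    rw [Finset.sum_add_distrib, this, two_mul]
  have hs : ‖(1 / (Real.sqrt 2 : ℂ))‖ ^ 2 = 1 / 2 := by
    rw [norm_div, norm_one, Complex.norm_real, Real.norm_of_nonneg (Real.sqrt_nonneg 2), div_pow,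
      Real.sq_sqrt zero_le_two, one_pow]
  have h2 : ∀ f : ZMod 2 → ℂ, ∑ t, f t = f 0 + f 1 := fun f => Fin.sum_univ_two f
  have h1 : ∀ b : Bits ι, b c = 0 →
      ‖opH c ψ b‖ ^ 2 + ‖opH c ψ (b + Pi.single c 1)‖ ^ 2 =
        ‖ψ b‖ ^ 2 + ‖ψ (b + Pi.single c 1)‖ ^ 2 := by
    intro b hb
    have e0 : Function.update b c 0 = b := by rw [← hb, Function.update_eq_self]
    have e1 : Function.update b c 1 = b + Pi.single c 1 := by
      ext i
      rcases eq_or_ne i c with rfl | h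
      · simp [hb]
      · simp [h]
    have e2 : ∀ t, Function.update (b + Pi.single c 1) c t = Function.update b c t := by
      intro t
      ext i
      rcases eq_or_ne i c with rfl | h
      · simp
      · simp [h]
    have par := parallelogram_law_with_norm ℝ (ψ b) (ψ (b + Pi.single c 1))
    simp only [opH_apply, h2, e2, e0, e1, hb, Pi.add_apply, Pi.single_eq_same, norm_mul, mul_pow,
      hs, zero_add, mul_zero, mul_one, sgn_zero, one_mul, sgn_one, neg_mul, ← sub_eq_add_neg]
    nlinarith [par]
  have hall : ∀ b : Bits ι, ‖opH c ψ b‖ ^ 2 + ‖opH c ψ (b + Pi.single c 1)‖ ^ 2 =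
        ‖ψ b‖ ^ 2 + ‖ψ (b + Pi.single c 1)‖ ^ 2 := by
    intro b
    rcases zmod_two_cases (b c) with hb | hb
    · exact h1 b hb
    · have := h1 (b + Pi.single c 1) (by simp [hb]; rfl)
      rw [add_assoc, bits_add_self, add_zero] at this
      linarith
  have := Finset.sum_congr rfl fun b (_ : b ∈ Finset.univ) => hall b
  rw [hpair fun b => ‖opH c ψ b‖ ^ 2, hpair fun b => ‖ψ b‖ ^ 2] at this
  simpa [normSq] using this

theorem isIsom_hadamards (S : Finset ι) : IsIsom (hadamards S) :=
  Finset.noncommProd_induction _ _ _ IsIsom (fun _ _ => IsIsom.mul) IsIsom.one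
    fun c _ => isIsom_opH c

theorem isIsom_clusterUnitary (G : SimpleGraph ι) [DecidableRel G.Adj] :
    IsIsom (clusterUnitary G) :=
  ((isIsom_hadamards _).mul (Finset.noncommProd_induction _ _ _ IsIsom (fun _ _ => IsIsom.mul)
    IsIsom.one fun e _ => isIsom_edgeCZ e)).mul (isIsom_hadamards _)

theorem normSq_zeroState : normSq (zeroState ι) = 1 := by
  simp [normSq, zeroState, apply_ite]

theorem Pauli.op_apply (P : Pauli ι) (ψ : State ι) :
    P.op ψ = (Complex.I ^ P.1.val) • pauliXZ P.2.1 P.2.2 ψ := rfl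

theorem isIsom_pauliOp (P : Pauli ι) : IsIsom P.op := fun ψ => by
  rw [Pauli.op_apply, ← isIsom_pauliXZ P.2.1 P.2.2 ψ]
  simp [normSq]

end Qubits

/-! ### Bell states -/

theorem bell_apply (α β : ZMod 2) (b : Bits (Fin 2)) :
    bell α β b = if b 0 = b 1 + β then sgn (α * b 1) * (1 / (Real.sqrt 2 : ℂ)) else 0 := by
  show sgn (∑ c, (Pi.single 1 α : Bits (Fin 2)) c * b c) * bellPhi (b + Pi.single 1 β) = _
  simp [bellPhi, Fin.sum_univ_two]

/-- `Φ` is fixed by `XX` and `ZZ`, so only the total `X` part and the total `Z` part matter for the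
label, no matter which qubit they act on. -/
theorem pauliXZ_bell (x z : Bits (Fin 2)) (α β : ZMod 2) :
    pauliXZ x z (bell α β) = sgn ((z 0 + z 1 + α) * x 1 + z 0 * β) •
      bell (α + z 0 + z 1) (β + x 0 + x 1) := by
  ext b
  simp only [pauliXZ_apply, Pi.smul_apply, smul_eq_mul, bell_apply, Fin.sum_univ_two, Pi.add_apply]
  generalize b 0 = b0
  generalize b 1 = b1
  generalize x 0 = x0
  generalize x 1 = x1
  generalize z 0 = z0
  generalize z 1 = z1
  have hiff : (b0 + x0 = b1 + x1 + β) ↔ (b0 = b1 + (β + x0 + x1)) := by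
    revert b0 b1 x0 x1 β
    decide
  by_cases h : b0 + x0 = b1 + x1 + β
  · rw [if_pos h, if_pos (hiff.mp h), ← mul_assoc, ← mul_assoc, ← sgn_add, ← sgn_add, h]
    congr 2
    clear h hiff
    revert α β b1 x1 z0 z1
    decide
  · rw [if_neg h, if_neg (hiff.not.mp h)]
    simp

theorem pauliZ_pauliX (x z : Bits (Fin 2)) (ψ : State (Fin 2)) :
    pauliZ z (pauliX x ψ) = sgn (∑ c, z c * x c) • pauliXZ x z ψ := by
  ext b
  show sgn (∑ c, z c * b c) * ψ (b + x) = sgn (∑ c, z c * x c) *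
    (sgn (∑ c, z c * (b c + x c)) * ψ (b + x))
  rw [← mul_assoc, ← sgn_add, ← Finset.sum_add_distrib]
  congr 2
  refine Finset.sum_congr rfl fun c _ => ?_
  generalize z c = zc
  generalize x c = xc
  generalize b c = bc
  revert zc xc bc
  decide

theorem one_div_sqrt_two_ne_zero : (1 / (Real.sqrt 2 : ℂ)) ≠ 0 := by
  simp

/-- This makes the four output events mutually exclusive. Different `β` have disjoint supports; for
equal `β`, one amplitude fixes the scalar to be `1` and a second one reads off `α`. -/
theorem bell_eq_of_smul {α β α' β' : ZMod 2} {a : ℂ}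
    (h : bell α β = a • bell α' β') : α = α' ∧ β = β' := by
  have hb : β = β' := by
    by_contra hne
    have := congrFun h ![β, 0]
    simp only [Pi.smul_apply, smul_eq_mul, bell_apply, Matrix.cons_val_zero, Matrix.cons_val_one,
      zero_add, if_true, if_neg hne, mul_zero, sgn_zero, one_mul] at this
    exact one_div_sqrt_two_ne_zero this
  subst hb
  refine ⟨?_, rfl⟩
  have h0 := congrFun h ![β, 0]
  have h1 := congrFun h ![1 + β, 1]
  simp only [Pi.smul_apply, smul_eq_mul, bell_apply, Matrix.cons_val_zero, Matrix.cons_val_one,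
      zero_add, if_true, mul_zero, mul_one, sgn_zero, one_mul] at h0 h1
  have ha1 : a = 1 := by
    have := one_div_sqrt_two_ne_zero
    field_simp at h0
    exact h0.symm
  rw [ha1, one_mul] at h1
  have h2 := mul_right_cancel₀ one_div_sqrt_two_ne_zero h1
  rcases zmod_two_cases α with rfl | rfl <;> rcases zmod_two_cases α' with rfl | rfl <;>
    simp at h2 ⊢
  · exact absurd h2.symm (by norm_num)
  · exact absurd h2 (by norm_num)

/-- The Bell basis states are determined by the signs of the stabilizers `XX` and `ZZ`. -/
theorem exists_eq_smul_bell (φ : State (Fin 2)) (α β : ZMod 2)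
    (hX : ∀ b, sgn α * φ (b + 1) = φ b) (hZ : ∀ b, sgn (β + b 0 + b 1) * φ b = φ b) :
    ∃ a : ℂ, φ = a • bell α β := by
  -- The Bell state has amplitude `1/√2` at `![β, 0]`, whatever `α` is, which dictates the scalar.
  refine ⟨φ ![β, 0] * (Real.sqrt 2 : ℂ), ?_⟩
  have hs : (Real.sqrt 2 : ℂ) * (1 / (Real.sqrt 2 : ℂ)) = 1 := by
    rw [mul_one_div, div_self]; simp
  ext b
  have hb : b = ![b 0, b 1] := by ext i; fin_cases i <;> rfl
  rw [Pi.smul_apply, smul_eq_mul, bell_apply]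
  by_cases h : b 0 = b 1 + β
  · rw [if_pos h]
    rcases zmod_two_cases (b 1) with h1 | h1
    · rw [h1, zero_add] at h
      rw [hb, h, h1]
      simp only [Matrix.cons_val_one, Matrix.cons_val_zero, mul_zero, sgn_zero, one_mul]
      rw [mul_assoc, hs, mul_one]
    · have : b + 1 = ![β, 0] := by
        ext i
        fin_cases i
        · simp only [Fin.zero_eta, Pi.add_apply, Pi.one_apply, Matrix.cons_val_zero, h, h1]
          rw [add_right_comm, zmod_two_add_self, zero_add]
        · simp only [Fin.mk_one, Pi.add_apply, Pi.one_apply, Matrix.cons_val_one, h1]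
          rfl
      rw [← hX b, this, h1, mul_one]
      linear_combination (-sgn α * φ ![β, 0]) * hs
  · rw [if_neg h, mul_zero]
    have h1 : β + b 0 + b 1 = 1 := by
      revert h
      generalize b 0 = b0
      generalize b 1 = b1
      clear hX hZ
      revert b0 b1 β
      decide
    have := hZ b
    rw [h1, sgn_one] at this
    linear_combination (-1 / 2 : ℂ) * this

/-! ### The measurement on the lattice -/

section Lattice

variable {d R : ℕ}

/-- The indicator of a set of sites. -/
def ind (S : Finset Site) : Bits (Qubit d R) := fun c => if c.1 ∈ S then 1 else 0

theorem siteDist_eq_one_iff (c u : Site) : siteDist c u = 1 ↔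
    u = (c.1 + 1, c.2.1, c.2.2) ∨ u = (c.1 - 1, c.2.1, c.2.2) ∨
    u = (c.1, c.2.1 + 1, c.2.2) ∨ u = (c.1, c.2.1 - 1, c.2.2) ∨
    u = (c.1, c.2.1, c.2.2 + 1) ∨ u = (c.1, c.2.1, c.2.2 - 1) := by
  obtain ⟨c1, c2, c3⟩ := c
  obtain ⟨u1, u2, u3⟩ := u
  simp only [siteDist, Prod.mk.injEq, Int.abs_eq_natAbs]
  omega

/-- Since `S` consists of qubits, each of the six adjacent sites may be tested against `S` alone.
Opposite neighbours are bracketed together because later cancellations happen within such pairs. -/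
theorem nbhd_ind {S : Finset Site} (hS : S ⊆ qubits d R) (c : Qubit d R) :
    nbhd (clusterGraph d R) (ind S) c =
      ((if (c.1.1 + 1, c.1.2.1, c.1.2.2) ∈ S then 1 else 0) +
        (if (c.1.1 - 1, c.1.2.1, c.1.2.2) ∈ S then 1 else 0)) +
      (((if (c.1.1, c.1.2.1 + 1, c.1.2.2) ∈ S then 1 else 0) +
        (if (c.1.1, c.1.2.1 - 1, c.1.2.2) ∈ S then 1 else 0)) +
      ((if (c.1.1, c.1.2.1, c.1.2.2 + 1) ∈ S then 1 else 0) +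
        (if (c.1.1, c.1.2.1, c.1.2.2 - 1) ∈ S then 1 else 0))) := by
  obtain ⟨⟨c1, c2, c3⟩, hc⟩ := c
  have h1 : nbhd (clusterGraph d R) (ind S) ⟨(c1, c2, c3), hc⟩ =
      ∑ u ∈ qubits d R, if siteDist (c1, c2, c3) u = 1 ∧ u ∈ S then 1 else 0 := by
    rw [Finset.sum_subtype (qubits d R) (p := fun u => u ∈ qubits d R) (fun _ => Iff.rfl)]
    refine Finset.sum_congr rfl fun v _ => ?_
    show (if siteDist (c1, c2, c3) v.1 = 1 then (if v.1 ∈ S then (1 : ZMod 2) else 0) else 0) = _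
    split_ifs <;> simp_all
  have h2 : ∑ u ∈ qubits d R, (if siteDist (c1, c2, c3) u = 1 ∧ u ∈ S then (1 : ZMod 2) else 0) =
      ∑ u ∈ {(c1 + 1, c2, c3), (c1 - 1, c2, c3), (c1, c2 + 1, c3), (c1, c2 - 1, c3),
        (c1, c2, c3 + 1), ((c1, c2, c3 - 1) : Site)}, if u ∈ S then (1 : ZMod 2) else 0 := by
    rw [← Finset.sum_filter, ← Finset.sum_filter]
    refine Finset.sum_congr ?_ fun _ _ => rfl
    ext u
    simp only [Finset.mem_filter, siteDist_eq_one_iff, Finset.mem_insert, Finset.mem_singleton]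
    exact ⟨fun h => ⟨h.2.1, h.2.2⟩, fun h => ⟨hS h.2, h.1, h.2⟩⟩
  rw [h1, h2]
  rw [Finset.sum_insert, Finset.sum_insert, Finset.sum_insert, Finset.sum_insert,
    Finset.sum_insert, Finset.sum_singleton]
  · ring
  all_goals
    simp only [Finset.mem_insert, Finset.mem_singleton, Prod.mk.injEq]
    omega

theorem pauliXZ_ind_clusterState {S T : Finset Site}
    (hS : ∀ u ∈ S, ∀ v ∈ S, siteDist u v ≠ 1)
    (hT : ∀ c, nbhd (clusterGraph d R) (ind S) c = ind T c) :
    pauliXZ (ind T) (ind S) (clusterState d R) = clusterState d R := by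
  have := pauliXZ_clusterState (clusterGraph d R) (ind S) fun u v h => by
    simp only [ind]
    split_ifs with hu hv
    · exact absurd h (hS _ hu _ hv)
    all_goals simp
  rwa [funext hT] at this

/-- The cluster state after the Hadamard gates on the `X`-measured qubits. -/
def rotatedState (d R : ℕ) : State (Qubit d R) :=
  hadamards (Finset.univ.filter fun c : Qubit d R => c.1 ∈ setX d R) (clusterState d R)

/-- The Hadamard gates turn the part of `T` on `X`-measured qubits into `Z`. Disjointness of `S`
from these qubits prevents signs and new `X` factors. If `T` lies in `setX`, a pure `Z` operator
results. -/
theorem pauliXZ_rotatedState {S T : Finset Site}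
    (hS : ∀ u ∈ S, ∀ v ∈ S, siteDist u v ≠ 1)
    (hT : ∀ c, nbhd (clusterGraph d R) (ind S) c = ind T c)
    (hSX : Disjoint S (setX d R)) :
    pauliXZ (ind (T \ setX d R)) (ind (S ∪ T ∩ setX d R)) (rotatedState d R) =
      rotatedState d R := by
  have hz : ∀ c : Qubit d R, c.1 ∈ setX d R → (ind S c : ZMod 2) = 0 := fun c hc =>
    if_neg fun h => Finset.disjoint_left.mp hSX h hc
  conv_rhs => rw [rotatedState, ← pauliXZ_ind_clusterState hS hT, hadamards_pauliXZ]
  rw [Finset.sum_eq_zero fun c hc => by rw [hz c (Finset.mem_filter.mp hc).2, mul_zero],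
    sgn_zero, one_smul]
  rw [rotatedState]
  congr 2
  · ext c
    by_cases hc : c.1 ∈ setX d R
    · simp [hz c hc, hc]
      simp [ind, hc]
    · simp [ind, hc]
  · ext c
    by_cases hc : c.1 ∈ setX d R
    · have := Finset.disjoint_right.mp hSX hc
      simp [ind, hc, this]
    · simp [ind, hc]

theorem mem_qubits {u : Site} : u ∈ qubits d R ↔
    ((1 ≤ u.1 ∧ u.1 ≤ 2 * d - 1) ∧ (0 ≤ u.2.1 ∧ u.2.1 ≤ 2 * d - 2) ∧ (1 ≤ u.2.2 ∧ u.2.2 ≤ R)) ∧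
    ¬ (u.1 % 2 = 1 ∧ u.2.1 % 2 = 1 ∧ u.2.2 % 2 = 1) ∧
    ¬ (u.1 % 2 = 0 ∧ u.2.1 % 2 = 0 ∧ u.2.2 % 2 = 0) := by
  simp only [qubits, box, Finset.mem_filter, Finset.mem_product, Finset.mem_Icc, Int.odd_iff,
    Int.even_iff]

theorem q₁_mem (hd : 2 ≤ d) (hR : 3 ≤ R) : q₁ ∈ qubits d R := by
  rw [mem_qubits]
  simp only [q₁]
  omega

theorem q₂_mem (hd : 2 ≤ d) (hR : 3 ≤ R) : q₂ R ∈ qubits d R := by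
  rw [mem_qubits]
  simp only [q₂]
  omega

theorem q₁_ne_q₂ (hR : 3 ≤ R) : q₁ ≠ q₂ R := by
  simp only [q₁, q₂, ne_eq, Prod.mk.injEq]
  omega

theorem q₁_notMem_setX : q₁ ∉ setX d R := by simp [setX]

theorem q₂_notMem_setX : q₂ R ∉ setX d R := by simp [setX]

theorem sum_qubit (hd : 2 ≤ d) (hR : 3 ≤ R) (F : Qubit d R → ZMod 2) :
    ∑ c, F c = ∑ c : Measured d R, F c.1 +
      (F ⟨q₁, q₁_mem hd hR⟩ + F ⟨q₂ R, q₂_mem hd hR⟩) := by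
  rw [← Fintype.sum_subtype_add_sum_subtype (fun c : Qubit d R => c.1 ≠ q₁ ∧ c.1 ≠ q₂ R) F]
  congr 1
  have hne : (⟨q₁, q₁_mem hd hR⟩ : Qubit d R) ≠ ⟨q₂ R, q₂_mem hd hR⟩ := fun h =>
    q₁_ne_q₂ hR (congrArg Subtype.val h)
  rw [← Finset.sum_pair hne]
  refine (Finset.sum_subtype _ (p := fun c : Qubit d R => ¬ (c.1 ≠ q₁ ∧ c.1 ≠ q₂ R)) (fun c => ?_)
    F).symm
  simp only [Finset.mem_insert, Finset.mem_singleton, Subtype.ext_iff]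
  tauto

theorem parity_ones (s : Outcome d R) (S : Finset Site) :
    parity (ones s) S = ∑ c : Measured d R, if c.1.1 ∈ S then s c else 0 := by
  have h1 : ones s ∩ S = (Finset.univ.filter fun c : Measured d R => c.1.1 ∈ S ∧ s c = 1).image
      fun c => c.1.1 := by
    ext u
    simp only [ones, Finset.mem_inter, Finset.mem_image, Finset.mem_filter, Finset.mem_univ,
      true_and]
    constructor
    · rintro ⟨⟨c, hc, rfl⟩, hu⟩
      exact ⟨c, ⟨hu, hc⟩, rfl⟩
    · rintro ⟨c, ⟨hu, hc⟩, rfl⟩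
      exact ⟨⟨c, hc, rfl⟩, hu⟩
  rw [parity, h1, Finset.card_image_of_injective _
    (fun a b h => Subtype.ext (Subtype.ext h)), Finset.card_filter]
  push_cast
  refine Finset.sum_congr rfl fun c _ => ?_
  by_cases hc : c.1.1 ∈ S
  · rcases zmod_two_cases (s c) with h | h <;> simp [hc, h]
  · simp [hc]

theorem parity_ones_add (s t : Outcome d R) (S : Finset Site) :
    parity (ones (s + t)) S = parity (ones s) S + parity (ones t) S := by
  simp only [parity_ones, ← Finset.sum_add_distrib]
  refine Finset.sum_congr rfl fun c _ => ?_
  split_ifs <;> simp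

theorem combine_q₁ (s : Outcome d R) (b : Bits (Fin 2)) (h : q₁ ∈ qubits d R) :
    combine s b ⟨q₁, h⟩ = b 0 := by simp [combine]

theorem combine_q₂ (hR : 3 ≤ R) (s : Outcome d R) (b : Bits (Fin 2)) (h : q₂ R ∈ qubits d R) :
    combine s b ⟨q₂ R, h⟩ = b 1 := by simp [combine, (q₁_ne_q₂ hR).symm]

theorem combine_measured (s : Outcome d R) (b : Bits (Fin 2)) (c : Measured d R) :
    combine s b c.1 = s c := by simp [combine, c.2.1, c.2.2]

theorem sum_ind_combine (hd : 2 ≤ d) (hR : 3 ≤ R) (S : Finset Site)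
    (s : Outcome d R) (b : Bits (Fin 2)) :
    ∑ c : Qubit d R, ind S c * combine s b c = parity (ones s) S +
      ((if q₁ ∈ S then b 0 else 0) + (if q₂ R ∈ S then b 1 else 0)) := by
  rw [sum_qubit hd hR, parity_ones, combine_q₁, combine_q₂ hR]
  simp [combine_measured, ind]

/-- The unnormalized state of `q₁`, `q₂` for the outcome `s` without errors. -/
def amplitude (s : Outcome d R) : State (Fin 2) := fun b => rotatedState d R (combine s b)

/-- The errors which flip measurement outcomes. -/
def flips (E : Pauli (Qubit d R)) : Outcome d R :=
  fun c => if c.1.1 ∈ setX d R then E.2.2 c.1 else E.2.1 c.1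

/-- The restriction of a bit string to the unmeasured qubits. -/
def restr (hd : 2 ≤ d) (hR : 3 ≤ R) (x : Bits (Qubit d R)) : Bits (Fin 2) :=
  ![x ⟨q₁, q₁_mem hd hR⟩, x ⟨q₂ R, q₂_mem hd hR⟩]

/-- Past the Hadamard gates the error has its `X` and `Z` parts exchanged on `X`-measured qubits. On
measured qubits its `X` part then shifts the outcome and its `Z` part is a phase once the outcome is
fixed; only a Pauli on `q₁`, `q₂` is left. -/
theorem postVec_eq (hd : 2 ≤ d) (hR : 3 ≤ R) (E : Pauli (Qubit d R))
    (s : Outcome d R) :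
    ∃ a : ℂ, ‖a‖ = 1 ∧ postVec E s = a • pauliXZ (restr hd hR E.2.1)
      (restr hd hR E.2.2) (amplitude (s + flips E)) := by
  set X := Finset.univ.filter fun c : Qubit d R => c.1 ∈ setX d R with hX
  set x' : Bits (Qubit d R) := fun c => if c ∈ X then E.2.2 c else E.2.1 c with hx'
  set z' : Bits (Qubit d R) := fun c => if c ∈ X then E.2.1 c else E.2.2 c with hz'
  have hx1 : x' ⟨q₁, q₁_mem hd hR⟩ = E.2.1 ⟨q₁, q₁_mem hd hR⟩ := by
    simp [x', X, q₁_notMem_setX]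
  have hx2 : x' ⟨q₂ R, q₂_mem hd hR⟩ = E.2.1 ⟨q₂ R, q₂_mem hd hR⟩ := by
    simp [x', X, q₂_notMem_setX]
  have hz1 : z' ⟨q₁, q₁_mem hd hR⟩ = E.2.2 ⟨q₁, q₁_mem hd hR⟩ := by
    simp [z', X, q₁_notMem_setX]
  have hz2 : z' ⟨q₂ R, q₂_mem hd hR⟩ = E.2.2 ⟨q₂ R, q₂_mem hd hR⟩ := by
    simp [z', X, q₂_notMem_setX]
  have hxm : ∀ c : Measured d R, x' c.1 = flips E c := fun c => by
    simp [x', X, flips]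
  have hcomb : ∀ b, combine s b + x' = combine (s + flips E) (b + restr hd hR E.2.1) := by
    intro b
    ext c
    by_cases h1 : c.1 = q₁
    · obtain ⟨c, hc⟩ := c
      obtain rfl : c = q₁ := h1
      rw [Pi.add_apply, combine_q₁, combine_q₁, hx1]
      rfl
    · by_cases h2 : c.1 = q₂ R
      · obtain ⟨c, hc⟩ := c
        obtain rfl : c = q₂ R := h2
        rw [Pi.add_apply, combine_q₂ hR, combine_q₂ hR, hx2]
        rfl
      · have := combine_measured s b ⟨c, h1, h2⟩
        simp only at this
        have h' := combine_measured (s + flips E) (b + restr hd hR E.2.1) ⟨c, h1, h2⟩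
        simp only at h'
        rw [Pi.add_apply, this, h', Pi.add_apply, ← hxm ⟨c, h1, h2⟩]
  -- Three phases: that of the Pauli element, the reordering sign from the Hadamard gates, and the
  -- `Z` part evaluated on the fixed outcome.
  refine ⟨Complex.I ^ E.1.val * sgn (∑ c ∈ X, E.2.1 c * E.2.2 c) *
    sgn (∑ c : Measured d R, z' c.1 * (s + flips E) c), by simp, ?_⟩
  ext b
  rw [postVec, Pauli.op_apply, map_smul, hadamards_pauliXZ, smul_smul, ← hX, Pi.smul_apply,
    pauliXZ_apply, Pi.smul_apply, smul_eq_mul, smul_eq_mul, pauliXZ_apply, hcomb b]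
  have hsum : ∑ c, z' c * (combine s b c + x' c) =
      ∑ c, z' c * combine (s + flips E) (b + restr hd hR E.2.1) c :=
    Finset.sum_congr rfl fun c _ => congrArg (z' c * ·) (congrFun (hcomb b) c)
  change _ * (sgn (∑ c, z' c * (combine s b c + x' c)) * _) = _
  rw [hsum, sum_qubit hd hR, combine_q₁, combine_q₂ hR, hz1, hz2, sgn_add, Fin.sum_univ_two]
  simp only [combine_measured, amplitude, rotatedState, Pi.add_apply, restr, Matrix.cons_val_zero,
    Matrix.cons_val_one]
  ring

end Lattice

/-! ### Stabilizers of the lattice -/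

section Stabilizers

variable {d R : ℕ}

theorem mem_setB {u : Site} : u ∈ setB d R ↔ u ∈ qubits d R ∧ (u.2.2 = 1 ∨ u.2.2 = R) ∧
    ((u.1 % 2 = 0 ∧ u.2.1 % 2 = 1) ∨ (u.1 % 2 = 1 ∧ u.2.1 % 2 = 0)) := by
  simp only [setB, Finset.mem_filter, Int.odd_iff, Int.even_iff]

theorem mem_setX {u : Site} : u ∈ setX d R ↔ u ∈ qubits d R ∧ (u.2.2 = 1 ∨ u.2.2 = R) ∧
    ((u.1 % 2 = 0 ∧ u.2.1 % 2 = 1) ∨ (u.1 % 2 = 1 ∧ u.2.1 % 2 = 0)) ∧ 1 + u.1 ≤ u.2.1 := by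
  have h : u ∈ qubits d R ∧ 1 + u.1 ≤ u.2.1 → u ≠ q₁ ∧ u ≠ q₂ R := by
    rintro ⟨-, h⟩
    constructor <;> rintro rfl <;> simp [q₁, q₂] at h
  simp only [setX, Finset.mem_filter, Finset.mem_sdiff, mem_setB, Finset.mem_insert,
    Finset.mem_singleton]
  tauto

theorem mem_setZ {u : Site} : u ∈ setZ d R ↔ u ∈ qubits d R ∧ (u.2.2 = 1 ∨ u.2.2 = R) ∧
    ((u.1 % 2 = 0 ∧ u.2.1 % 2 = 1) ∨ (u.1 % 2 = 1 ∧ u.2.1 % 2 = 0)) ∧ u.2.1 < 1 + u.1 ∧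
    u ≠ q₁ ∧ u ≠ q₂ R := by
  simp only [setZ, Finset.mem_filter, Finset.mem_sdiff, mem_setB, Finset.mem_insert,
    Finset.mem_singleton]
  tauto

theorem oneOdd_iff {u : Site} : OneOdd u ↔ (u.1 % 2 = 1 ∧ u.2.1 % 2 = 0 ∧ u.2.2 % 2 = 0) ∨
    (u.1 % 2 = 0 ∧ u.2.1 % 2 = 1 ∧ u.2.2 % 2 = 0) ∨
    (u.1 % 2 = 0 ∧ u.2.1 % 2 = 0 ∧ u.2.2 % 2 = 1) := by
  simp only [OneOdd, Int.odd_iff, Int.even_iff]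

theorem mem_primalEdges (hodd : Odd R) {u : Site} : u ∈ primalEdges d R ↔ u ∈ qubits d R ∧
    (((u.1 % 2 = 1 ∧ u.2.1 % 2 = 0 ∧ u.2.2 % 2 = 0) ∨
      (u.1 % 2 = 0 ∧ u.2.1 % 2 = 1 ∧ u.2.2 % 2 = 0) ∨
      (u.1 % 2 = 0 ∧ u.2.1 % 2 = 0 ∧ u.2.2 % 2 = 1)) ∨
    ((u.2.2 = 1 ∨ u.2.2 = R) ∧
      ((u.1 % 2 = 0 ∧ u.2.1 % 2 = 1) ∨ (u.1 % 2 = 1 ∧ u.2.1 % 2 = 0)) ∧ 1 + u.1 ≤ u.2.1)) := by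
  have hR : (R : ℤ) % 2 = 1 := Int.odd_iff.mp (by exact_mod_cast hodd)
  simp only [primalEdges, setA, Finset.mem_union, Finset.mem_filter, Finset.mem_sdiff, mem_setB,
    mem_setX, oneOdd_iff]
  by_cases h : u ∈ qubits d R
  · simp only [h, true_and]
    omega
  · simp [h]

theorem mem_dualEdges (hodd : Odd R) {u : Site} : u ∈ dualEdges d R ↔ u ∈ qubits d R ∧
    u ≠ q₁ ∧ u ≠ q₂ R ∧
    ((u.1 % 2 = 0 ∧ u.2.1 % 2 = 1 ∧ u.2.2 % 2 = 1) ∨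
      (u.1 % 2 = 1 ∧ u.2.1 % 2 = 0 ∧ u.2.2 % 2 = 1) ∨
      (u.1 % 2 = 1 ∧ u.2.1 % 2 = 1 ∧ u.2.2 % 2 = 0)) ∧
    ((u.2.2 = 1 ∨ u.2.2 = R) → u.2.1 < 1 + u.1) := by
  have hR : (R : ℤ) % 2 = 1 := Int.odd_iff.mp (by exact_mod_cast hodd)
  simp only [dualEdges, setA, Finset.mem_union, Finset.mem_filter, Finset.mem_sdiff, mem_setB,
    mem_setZ, oneOdd_iff]
  by_cases h : u ∈ qubits d R
  · have h' := h
    rw [mem_qubits] at h'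
    simp only [h, true_and, q₁, q₂, ne_eq, Prod.ext_iff]
    omega
  · simp [h]

theorem mem_neigh {u v : Site} : v ∈ neigh d R u ↔ v ∈ qubits d R ∧ siteDist u v = 1 := by
  simp only [neigh, Finset.mem_filter]

theorem mem_recoveryX {u : Site} : u ∈ recoveryX d R ↔ u ∈ qubits d R ∧ u.1 = 1 ∧
    u.2.1 % 2 = 0 ∧ (u.2.2 % 2 = 0 ∨ (2 ≤ u.2.1 ∧ (u.2.2 = 1 ∨ u.2.2 = (R : ℤ)))) := by
  simp only [recoveryX, Finset.mem_filter, Int.even_iff]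

theorem mem_recoveryZ {u : Site} : u ∈ recoveryZ d R ↔ (u ∈ qubits d R ∧ u ≠ q₁ ∧ u ≠ q₂ R) ∧
    u.1 % 2 = 1 ∧ u.2.1 = 0 ∧ u.2.2 % 2 = 1 := by
  simp only [recoveryZ, Finset.mem_filter, Finset.mem_sdiff, Finset.mem_insert,
    Finset.mem_singleton, Int.odd_iff, not_or, ne_eq]

theorem mem_box {u : Site} : u ∈ box d R ↔
    (1 ≤ u.1 ∧ u.1 ≤ 2 * d - 1) ∧ (0 ≤ u.2.1 ∧ u.2.1 ≤ 2 * d - 2) ∧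
      (1 ≤ u.2.2 ∧ u.2.2 ≤ R) := by
  simp only [box, Finset.mem_product, Finset.mem_Icc]

theorem siteDist_comm (u v : Site) : siteDist u v = siteDist v u := by
  simp only [siteDist, abs_sub_comm]

theorem siteDist_eq_one_iff_natAbs (u v : Site) : siteDist u v = 1 ↔
    (u.1 - v.1).natAbs + (u.2.1 - v.2.1).natAbs + (u.2.2 - v.2.2).natAbs = 1 := by
  simp only [siteDist, Int.abs_eq_natAbs]
  omega

theorem ite_add_ite_of_iff {P Q : Prop} [Decidable P] [Decidable Q] (h : P ↔ Q) :
    ((if P then 1 else 0) + if Q then 1 else 0 : ZMod 2) = 0 := by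
  simp only [h]
  split_ifs <;> rfl

theorem ite_add_ite_of_iff_not {P Q : Prop} [Decidable P] [Decidable Q] (h : P ↔ ¬ Q) :
    ((if P then 1 else 0) + if Q then 1 else 0 : ZMod 2) = 1 := by
  simp only [h]
  split_ifs <;> simp_all

/-- Each opposite pair contributes `0` or `1`; the hypothesis says that zero or exactly two pairs
contribute `1`. -/
theorem sum_six_eq_zero {P P' Q Q' S S' : Prop} [Decidable P] [Decidable P'] [Decidable Q]
    [Decidable Q'] [Decidable S] [Decidable S']
    (h : ((P ↔ P') ∧ (Q ↔ Q') ∧ (S ↔ S')) ∨ ((P ↔ ¬ P') ∧ (Q ↔ ¬ Q') ∧ (S ↔ S')) ∨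
      ((P ↔ ¬ P') ∧ (Q ↔ Q') ∧ (S ↔ ¬ S')) ∨ ((P ↔ P') ∧ (Q ↔ ¬ Q') ∧ (S ↔ ¬ S'))) :
    ((if P then 1 else 0) + (if P' then 1 else 0)) + (((if Q then 1 else 0) +
      (if Q' then 1 else 0)) + ((if S then 1 else 0) + (if S' then 1 else 0))) = (0 : ZMod 2) := by
  rcases h with ⟨h1, h2, h3⟩ | ⟨h1, h2, h3⟩ | ⟨h1, h2, h3⟩ | ⟨h1, h2, h3⟩
  · rw [ite_add_ite_of_iff h1, ite_add_ite_of_iff h2, ite_add_ite_of_iff h3]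
    rfl
  · rw [ite_add_ite_of_iff_not h1, ite_add_ite_of_iff_not h2, ite_add_ite_of_iff h3]
    rfl
  · rw [ite_add_ite_of_iff_not h1, ite_add_ite_of_iff h2, ite_add_ite_of_iff_not h3]
    rfl
  · rw [ite_add_ite_of_iff h1, ite_add_ite_of_iff_not h2, ite_add_ite_of_iff_not h3]
    rfl

/-- All sites next to an all-even or all-odd site have mixed parities, so only membership in the box
has to be checked. -/
theorem mem_neigh_iff {a b c v1 v2 v3 : ℤ} (hpar : (v1 % 2 = 0 ∧ v2 % 2 = 0 ∧ v3 % 2 = 0) ∨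
      (v1 % 2 = 1 ∧ v2 % 2 = 1 ∧ v3 % 2 = 1)) : ((a, b, c) : Site) ∈ neigh d R (v1, v2, v3) ↔
    ((1 ≤ a ∧ a ≤ 2 * d - 1) ∧ (0 ≤ b ∧ b ≤ 2 * d - 2) ∧ (1 ≤ c ∧ c ≤ R)) ∧
    (v1 - a).natAbs + (v2 - b).natAbs + (v3 - c).natAbs = 1 := by
  rw [mem_neigh, mem_qubits, siteDist_eq_one_iff_natAbs]
  dsimp only
  constructor
  · exact fun h => ⟨h.1.1, h.2⟩
  · rintro ⟨h1, h2⟩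
    exact ⟨⟨h1, by clear h1; omega, by clear h1; omega⟩, h2⟩

theorem notMem_neigh {a b c v1 v2 v3 : ℤ}
    (h : (v1 - a).natAbs + (v2 - b).natAbs + (v3 - c).natAbs ≠ 1) :
    ((a, b, c) : Site) ∉ neigh d R (v1, v2, v3) := fun h' => by
  rw [mem_neigh, siteDist_eq_one_iff_natAbs] at h'
  exact h h'.2

/-- The product of the stabilizers around a cell acts by `Z` operators only. -/
theorem nbhd_neigh {v : Site} (hv : v ∈ box d R)
    (hpar : (v.1 % 2 = 0 ∧ v.2.1 % 2 = 0 ∧ v.2.2 % 2 = 0) ∨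
      (v.1 % 2 = 1 ∧ v.2.1 % 2 = 1 ∧ v.2.2 % 2 = 1)) (c : Qubit d R) :
    nbhd (clusterGraph d R) (ind (neigh d R v)) c = 0 := by
  obtain ⟨⟨c1, c2, c3⟩, hc⟩ := c
  obtain ⟨v1, v2, v3⟩ := v
  rw [nbhd_ind (S := neigh d R (v1, v2, v3)) (Finset.filter_subset _ _)]
  rw [mem_qubits] at hc
  rw [mem_box] at hv
  simp only at hpar hc hv ⊢
  apply sum_six_eq_zero
  -- Only a qubit at distance two from `v` can share neighbours with it. By parity it then differs
  -- by one in two coordinates, so there are exactly two common neighbours, one along each of these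
  -- axes, and both lie in the box because `v` and `c` do.
  by_cases hsum : (v1 - c1).natAbs + (v2 - c2).natAbs + (v3 - c3).natAbs = 2
  · right
    have hcases : ((v1 = c1 + 1 ∨ v1 = c1 - 1) ∧ (v2 = c2 + 1 ∨ v2 = c2 - 1) ∧ v3 = c3) ∨
        ((v1 = c1 + 1 ∨ v1 = c1 - 1) ∧ v2 = c2 ∧ (v3 = c3 + 1 ∨ v3 = c3 - 1)) ∨
        (v1 = c1 ∧ (v2 = c2 + 1 ∨ v2 = c2 - 1) ∧ (v3 = c3 + 1 ∨ v3 = c3 - 1)) := by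
      have hp := hc.2
      clear hc hv
      have : ((v1 - c1) % 2 = 1 ∧ (v2 - c2) % 2 = 1 ∧ (v3 - c3) % 2 = 0) ∨
        ((v1 - c1) % 2 = 1 ∧ (v2 - c2) % 2 = 0 ∧ (v3 - c3) % 2 = 1) ∨
        ((v1 - c1) % 2 = 0 ∧ (v2 - c2) % 2 = 1 ∧ (v3 - c3) % 2 = 1) := by omega
      clear hp hpar
      rcases this with h | h | h
      · left; omega
      · right; left; omega
      · right; right; omega
    replace hc := hc.1
    clear hsum
    rcases hcases with ⟨h1, h2, h⟩ | ⟨h1, h, h2⟩ | ⟨h, h1, h2⟩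
    · refine Or.inl ⟨?_, ?_, iff_of_false (notMem_neigh ?_) (notMem_neigh ?_)⟩
      · rw [mem_neigh_iff hpar, mem_neigh_iff hpar]
        clear hpar
        rcases h1 with h1 | h1 <;> omega
      · rw [mem_neigh_iff hpar, mem_neigh_iff hpar]
        clear hpar
        rcases h2 with h2 | h2 <;> omega
      all_goals
        clear hpar hv hc
        omega
    · refine Or.inr (Or.inl ⟨?_, iff_of_false (notMem_neigh ?_) (notMem_neigh ?_), ?_⟩)
      · rw [mem_neigh_iff hpar, mem_neigh_iff hpar]
        clear hpar
        rcases h1 with h1 | h1 <;> omega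
      rotate_left 2
      · rw [mem_neigh_iff hpar, mem_neigh_iff hpar]
        clear hpar
        rcases h2 with h2 | h2 <;> omega
      all_goals
        clear hpar hv hc
        omega
    · refine Or.inr (Or.inr ⟨iff_of_false (notMem_neigh ?_) (notMem_neigh ?_), ?_, ?_⟩)
      rotate_left 2
      · rw [mem_neigh_iff hpar, mem_neigh_iff hpar]
        clear hpar
        rcases h1 with h1 | h1 <;> omega
      · rw [mem_neigh_iff hpar, mem_neigh_iff hpar]
        clear hpar
        rcases h2 with h2 | h2 <;> omega
      all_goals
        clear hpar hv hc
        omega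
  · left
    have hp := hc.2
    have h0 : (v1 - c1).natAbs + (v2 - c2).natAbs + (v3 - c3).natAbs ≠ 0 := by
      clear hc hv hsum
      omega
    clear hc hv hp hpar
    refine ⟨iff_of_false (notMem_neigh ?_) (notMem_neigh ?_),
      iff_of_false (notMem_neigh ?_) (notMem_neigh ?_),
      iff_of_false (notMem_neigh ?_) (notMem_neigh ?_)⟩ <;> omega

/-- A `Z`-type stabilizer multiplies every amplitude by a sign, so amplitudes with sign `-1` vanish.
-/
theorem amplitude_of_stabilizer (hd : 2 ≤ d) (hR : 3 ≤ R) {Z : Finset Site}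
    (h : pauliXZ 0 (ind Z) (rotatedState d R) = rotatedState d R) (s : Outcome d R)
    (b : Bits (Fin 2)) :
    sgn (parity (ones s) Z + ((if q₁ ∈ Z then b 0 else 0) + (if q₂ R ∈ Z then b 1 else 0))) *
      amplitude s b = amplitude s b := by
  have := congrFun h (combine s b)
  rw [pauliXZ_apply, add_zero] at this
  simp only [Pi.zero_apply, add_zero] at this
  rwa [sum_ind_combine hd hR] at this

theorem parity_eq_zero_of_stabilizer (hd : 2 ≤ d) (hR : 3 ≤ R) {Z : Finset Site}
    (h : pauliXZ 0 (ind Z) (rotatedState d R) = rotatedState d R) (h₁ : q₁ ∉ Z) (h₂ : q₂ R ∉ Z)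
    {s : Outcome d R} (hs : amplitude s ≠ 0) : parity (ones s) Z = 0 := by
  by_contra hne
  apply hs
  ext b
  have := amplitude_of_stabilizer hd hR h s b
  rw [if_neg h₁, if_neg h₂, (zmod_two_cases _).resolve_left hne] at this
  simp only [add_zero, sgn_one] at this
  rw [Pi.zero_apply]
  linear_combination (-1 / 2 : ℂ) * this

theorem ind_empty : (ind ∅ : Bits (Qubit d R)) = 0 := by
  ext c
  simp [ind]

theorem siteDist_ne_one_of_even {u v : Site}
    (h : (u.1 + u.2.1 + u.2.2 - (v.1 + v.2.1 + v.2.2)) % 2 = 0) : siteDist u v ≠ 1 := by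
  rw [ne_eq, siteDist_eq_one_iff]
  simp only [Prod.ext_iff]
  omega

/-- Take the stabilizers at the sites (odd, 0, odd). Their `X` parts cancel: every qubit between two
such sites is hit twice, because the ranges of `u₁` and `u₃` begin and end at odd values. What
remains is `ZZ` on `q₁`, `q₂` times `Z` on the recovery set. -/
theorem amplitude_recoveryZ (hd : 2 ≤ d) (hR : 3 ≤ R) (hodd : Odd R) (s : Outcome d R)
    (b : Bits (Fin 2)) :
    sgn (parity (ones s) (recoveryZ d R) + b 0 + b 1) * amplitude s b = amplitude s b := by
  have hR2 : (R : ℤ) % 2 = 1 := Int.odd_iff.mp (by exact_mod_cast hodd)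
  set S : Finset Site := (qubits d R).filter fun u => u.1 % 2 = 1 ∧ u.2.1 = 0 ∧ u.2.2 % 2 = 1
    with hS
  have hmem : ∀ u, u ∈ S ↔ (1 ≤ u.1 ∧ u.1 ≤ 2 * d - 1 ∧ 1 ≤ u.2.2 ∧ u.2.2 ≤ R) ∧
      u.1 % 2 = 1 ∧ u.2.1 = 0 ∧ u.2.2 % 2 = 1 := fun u => by
    rw [hS, Finset.mem_filter, mem_qubits]
    constructor
    · rintro ⟨h1, h2⟩
      exact ⟨⟨h1.1.1.1, h1.1.1.2, h1.1.2.2.1, h1.1.2.2.2⟩, h2⟩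
    · rintro ⟨h1, h2⟩
      exact ⟨⟨⟨⟨h1.1, h1.2.1⟩, by omega, h1.2.2⟩, by omega, by omega⟩, h2⟩
  have hstab := pauliXZ_rotatedState (d := d) (R := R) (S := S) (T := ∅)
    (fun u hu v hv => siteDist_ne_one_of_even (by rw [hmem] at hu hv; omega))
    (fun c => by
      obtain ⟨⟨c1, c2, c3⟩, hc⟩ := c
      rw [nbhd_ind (Finset.filter_subset _ _ : S ⊆ qubits d R), ind_empty]
      rw [mem_qubits] at hc
      simp only at hc
      refine sum_six_eq_zero (Or.inl ⟨?_, ?_, ?_⟩) <;>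
        (rw [hmem, hmem]; simp only)
      · constructor <;> (rintro ⟨⟨h1, h2, h3, h4⟩, h5, h6, h7⟩; replace hc := hc.1; omega)
      · constructor <;> (rintro ⟨⟨h1, h2, h3, h4⟩, h5, h6, h7⟩; omega)
      · constructor <;> (rintro ⟨⟨h1, h2, h3, h4⟩, h5, h6, h7⟩; replace hc := hc.1; omega))
    (Finset.disjoint_left.mpr fun u hu hX => by
      rw [hmem] at hu
      replace hX := (mem_setX.mp hX).2
      omega)
  rw [Finset.empty_sdiff, ind_empty, Finset.empty_inter, Finset.union_empty] at hstab
  have h := amplitude_of_stabilizer hd hR hstab s b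
  have hq₁ : q₁ ∈ S := by rw [hS, Finset.mem_filter]; exact ⟨q₁_mem hd hR, by simp [q₁]⟩
  have hq₂ : q₂ R ∈ S := by rw [hS, Finset.mem_filter]; exact ⟨q₂_mem hd hR, by simp [q₂, hR2]⟩
  rw [if_pos hq₁, if_pos hq₂, ← add_assoc] at h
  have hpar : parity (ones s) S = parity (ones s) (recoveryZ d R) := by
    rw [parity_ones, parity_ones]
    refine Finset.sum_congr rfl fun c _ => if_congr ?_ rfl rfl
    rw [hS, Finset.mem_filter, mem_recoveryZ]
    exact ⟨fun h => ⟨⟨h.1, c.2⟩, h.2⟩, fun h => ⟨h.1.1, h.2⟩⟩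
  rwa [hpar] at h

/-- Take the stabilizers at the sites (1, even, even). Their `X` parts cancel except on the sites
(1, even) of the two outer layers, where one of the two neighbours is missing. Of these, `q₁` and
`q₂` keep their `X`, while those with `u₂ ≥ 2` are `X`-measured and join the recovery set as `Z`
factors. -/
theorem amplitude_recoveryX (hd : 2 ≤ d) (hR : 3 ≤ R) (hodd : Odd R) (s : Outcome d R)
    (b : Bits (Fin 2)) :
    sgn (parity (ones s) (recoveryX d R)) * amplitude s (b + 1) = amplitude s b := by
  have hR2 : (R : ℤ) % 2 = 1 := Int.odd_iff.mp (by exact_mod_cast hodd)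
  set S : Finset Site := (qubits d R).filter fun u => u.1 = 1 ∧ u.2.1 % 2 = 0 ∧ u.2.2 % 2 = 0
    with hS
  have hmem : ∀ u, u ∈ S ↔ (0 ≤ u.2.1 ∧ u.2.1 ≤ 2 * d - 2 ∧ 1 ≤ u.2.2 ∧ u.2.2 ≤ R) ∧
      u.1 = 1 ∧ u.2.1 % 2 = 0 ∧ u.2.2 % 2 = 0 := fun u => by
    rw [hS, Finset.mem_filter, mem_qubits]
    constructor
    · rintro ⟨h1, h2⟩
      exact ⟨⟨h1.1.2.1.1, h1.1.2.1.2, h1.1.2.2.1, h1.1.2.2.2⟩, h2⟩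
    · rintro ⟨h1, h2⟩
      exact ⟨⟨⟨by omega, ⟨h1.1, h1.2.1⟩, h1.2.2⟩, by omega, by omega⟩, h2⟩
  set T : Finset Site := (qubits d R).filter fun u => u.1 = 1 ∧ u.2.1 % 2 = 0 ∧
    (u.2.2 = 1 ∨ u.2.2 = R) with hT
  have hmemT : ∀ u, u ∈ T ↔ u ∈ qubits d R ∧ u.1 = 1 ∧ u.2.1 % 2 = 0 ∧ (u.2.2 = 1 ∨ u.2.2 = R) :=
    fun u => by simp only [hT, Finset.mem_filter]
  have hstab := pauliXZ_rotatedState (d := d) (R := R) (S := S) (T := T)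
    (fun u hu v hv => siteDist_ne_one_of_even (by rw [hmem] at hu hv; omega))
    (fun c => by
      obtain ⟨⟨c1, c2, c3⟩, hc⟩ := c
      rw [nbhd_ind (Finset.filter_subset _ _ : S ⊆ qubits d R)]
      simp only [ind, hmemT, hc, true_and]
      rw [mem_qubits] at hc
      simp only at hc
      rw [ite_add_ite_of_iff, ite_add_ite_of_iff, zero_add, zero_add]
      rotate_left
      · rw [hmem, hmem]
        simp only
        omega
      · rw [hmem, hmem]
        simp only
        omega
      by_cases hc3 : c1 = 1 ∧ c2 % 2 = 0 ∧ (c3 = 1 ∨ c3 = R)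
      · rw [if_pos hc3]
        apply ite_add_ite_of_iff_not
        rw [hmem, hmem]
        simp only
        omega
      · rw [if_neg hc3]
        apply ite_add_ite_of_iff
        rw [hmem, hmem]
        simp only
        omega)
    (Finset.disjoint_left.mpr fun u hu hX => by
      rw [hmem] at hu
      replace hX := (mem_setX.mp hX).2
      omega)
  have hTX : T \ setX d R = {q₁, q₂ R} := by
    ext u
    obtain ⟨u1, u2, u3⟩ := u
    rw [Finset.mem_sdiff, hmemT, mem_setX, mem_qubits, Finset.mem_insert, Finset.mem_singleton,
      q₁, q₂, Prod.mk.injEq, Prod.mk.injEq, Prod.mk.injEq, Prod.mk.injEq]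
    simp only
    constructor
    · rintro ⟨⟨h1, h2, h3, h4⟩, h5⟩
      have : u2 = 0 := by
        by_contra hne
        exact h5 ⟨h1, h4, by omega, by omega⟩
      rcases h4 with h4 | h4
      · exact Or.inl ⟨h2, this, h4⟩
      · exact Or.inr ⟨h2, this, h4⟩
    · rintro (⟨rfl, rfl, rfl⟩ | ⟨rfl, rfl, rfl⟩) <;> omega
  have hST : S ∪ T ∩ setX d R = recoveryX d R := by
    ext u
    rw [Finset.mem_union, Finset.mem_inter, hS, Finset.mem_filter, hmemT, mem_setX, mem_recoveryX]
    by_cases h : u ∈ qubits d R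
    · simp only [h, true_and]
      constructor
      · rintro (⟨h1, h2, h3⟩ | ⟨⟨h1, h2, h3⟩, h4⟩)
        · exact ⟨h1, h2, Or.inl h3⟩
        · exact ⟨h1, h2, Or.inr ⟨by omega, h3⟩⟩
      · rintro ⟨h1, h2, h3 | h3⟩
        · exact Or.inl ⟨h1, h2, h3⟩
        · exact Or.inr ⟨⟨h1, h2, h3.2⟩, h3.2, by omega, by omega⟩
    · simp [h]
  rw [hTX, hST] at hstab
  have h := congrFun hstab (combine s b)
  have hcomb : combine s b + ind {q₁, q₂ R} = combine s (b + 1) := by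
    ext c
    by_cases h1 : c.1 = q₁
    · simp [combine, ind, h1]
    · by_cases h2 : c.1 = q₂ R
      · simp [combine, ind, h2, (q₁_ne_q₂ hR).symm]
      · simp [combine, ind, h1, h2]
  rw [pauliXZ_apply, hcomb] at h
  have hsum : ∑ c, ind (recoveryX d R) c * (combine s b c + ind {q₁, q₂ R} c) =
      parity (ones s) (recoveryX d R) := by
    have h2 := sum_ind_combine hd hR (recoveryX d R) s (b + 1)
    rw [← hcomb, if_neg, if_neg, add_zero, add_zero] at h2
    · exact h2
    · rw [mem_recoveryX]
      simp [q₂]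
      omega
    · rw [mem_recoveryX]
      simp [q₁]
  rwa [hsum] at h

theorem amplitude_eq_smul_bell (hd : 2 ≤ d) (hR : 3 ≤ R) (hodd : Odd R) (s : Outcome d R) :
    ∃ a : ℂ, amplitude s =
      a • bell (parity (ones s) (recoveryX d R)) (parity (ones s) (recoveryZ d R)) :=
  exists_eq_smul_bell _ _ _ (amplitude_recoveryX hd hR hodd s) (amplitude_recoveryZ hd hR hodd s)

/-- The edges incident with a vertex. -/
def IntGraph.incident {V E : Type} [DecidableEq V] (G : IntGraph V E) (v : V) : Finset E :=
  G.edges.filter fun e => v ∈ G.ends e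

theorem stabilizer_neigh {v : Site} (hv : v ∈ box d R)
    (hpar : (v.1 % 2 = 0 ∧ v.2.1 % 2 = 0 ∧ v.2.2 % 2 = 0) ∨
      (v.1 % 2 = 1 ∧ v.2.1 % 2 = 1 ∧ v.2.2 % 2 = 1)) (hX : Disjoint (neigh d R v) (setX d R)) :
    pauliXZ 0 (ind (neigh d R v)) (rotatedState d R) = rotatedState d R := by
  have hstab := pauliXZ_rotatedState (d := d) (R := R) (S := neigh d R v) (T := ∅)
    (fun u hu w hw => siteDist_ne_one_of_even (by
      rw [mem_neigh, siteDist_eq_one_iff_natAbs] at hu hw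
      replace hu := hu.2
      replace hw := hw.2
      clear hpar hv
      omega))
    (fun c => by rw [nbhd_neigh hv hpar, ind_empty]; rfl) hX
  rwa [Finset.empty_sdiff, ind_empty, Finset.empty_inter, Finset.union_empty] at hstab

/-! ### Edges at an internal vertex and the stabilizer located there -/

theorem mem_primalEnds (R : ℕ) (u v : Site) : v ∈ primalEnds R u ↔
    (u.1 % 2 = 1 ∧ (v.1 = u.1 - 1 ∨ v.1 = u.1 + 1) ∧ v.2.1 = u.2.1 ∧ v.2.2 = u.2.2) ∨
    (u.1 % 2 = 0 ∧ u.2.1 % 2 = 1 ∧ v.1 = u.1 ∧ (v.2.1 = u.2.1 - 1 ∨ v.2.1 = u.2.1 + 1) ∧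
      v.2.2 = u.2.2) ∨
    (u.1 % 2 = 0 ∧ u.2.1 % 2 = 0 ∧ v.1 = u.1 ∧ v.2.1 = u.2.1 ∧
      ((u.2.2 = 1 ∧ (v.2.2 = 1 ∨ v.2.2 = 2)) ∨
        (u.2.2 ≠ 1 ∧ u.2.2 = R ∧ (v.2.2 = R - 1 ∨ v.2.2 = R)) ∨
        (u.2.2 ≠ 1 ∧ u.2.2 ≠ R ∧ (v.2.2 = u.2.2 - 1 ∨ v.2.2 = u.2.2 + 1)))) := by
  unfold primalEnds
  simp only [Int.odd_iff]
  rcases Int.emod_two_eq_zero_or_one u.1 with h1 | h1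
  · rcases Int.emod_two_eq_zero_or_one u.2.1 with h2 | h2
    · by_cases h3 : u.2.2 = 1
      · simp [h1, h2, h3, Prod.ext_iff]
        tauto
      · by_cases h4 : u.2.2 = R
        · simp [h1, h2, h4 ▸ h3, h4, Prod.ext_iff]
          tauto
        · simp [h1, h2, h3, h4, Prod.ext_iff]
          tauto
    · simp [h1, h2, Prod.ext_iff]
      tauto
  · simp [h1, Prod.ext_iff]
    tauto

theorem mem_dualEnds (u v : Site) : v ∈ dualEnds u ↔
    (u.1 % 2 = 0 ∧ (v.1 = u.1 - 1 ∨ v.1 = u.1 + 1) ∧ v.2.1 = u.2.1 ∧ v.2.2 = u.2.2) ∨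
    (u.1 % 2 = 1 ∧ u.2.1 % 2 = 0 ∧ v.1 = u.1 ∧ (v.2.1 = u.2.1 - 1 ∨ v.2.1 = u.2.1 + 1) ∧
      v.2.2 = u.2.2) ∨
    (u.1 % 2 = 1 ∧ u.2.1 % 2 = 1 ∧ v.1 = u.1 ∧ v.2.1 = u.2.1 ∧
      (v.2.2 = u.2.2 - 1 ∨ v.2.2 = u.2.2 + 1)) := by
  unfold dualEnds
  simp only [Int.even_iff]
  rcases Int.emod_two_eq_zero_or_one u.1 with h1 | h1
  · simp [h1, Prod.ext_iff]
    tauto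
  · rcases Int.emod_two_eq_zero_or_one u.2.1 with h2 | h2
    · simp [h1, h2, Prod.ext_iff]
      tauto
    · simp [h1, h2, Prod.ext_iff]
      tauto

theorem mem_primalInternal {v : Site} : v ∈ (primalGraph d R).internal ↔ v ∈ box d R ∧
    v.1 % 2 = 0 ∧ v.2.1 % 2 = 0 ∧ (v.2.2 % 2 = 0 ∨ v.2.2 = 1 ∨ v.2.2 = R) ∧
      neigh d R v ⊆ primalEdges d R := by
  simp only [primalGraph, Finset.mem_filter, Int.even_iff]

theorem mem_dualInternal {v : Site} : v ∈ (dualGraph d R).internal ↔ v ∈ box d R ∧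
    v.1 % 2 = 1 ∧ v.2.1 % 2 = 1 ∧ v.2.2 % 2 = 1 ∧ neigh d R v ⊆ dualEdges d R := by
  simp only [dualGraph, Finset.mem_filter, Int.odd_iff]

theorem dual_incident (hodd : Odd R) {v : Site} (hv : v ∈ (dualGraph d R).internal) :
    (dualGraph d R).incident v = neigh d R v := by
  obtain ⟨hbox, h1, h2, h3, hsub⟩ := mem_dualInternal.mp hv
  ext e
  rw [IntGraph.incident, Finset.mem_filter]
  change e ∈ dualEdges d R ∧ v ∈ dualEnds e ↔ _
  rw [mem_dualEnds]
  constructor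
  · rintro ⟨he, hve⟩
    rw [mem_neigh, siteDist_eq_one_iff_natAbs]
    refine ⟨((mem_dualEdges hodd).mp he).1, ?_⟩
    omega
  · intro he
    refine ⟨hsub he, ?_⟩
    rw [mem_neigh, siteDist_eq_one_iff_natAbs] at he
    replace he := he.2
    omega

/-- The short edges fit the pattern as well: an edge between layers `1` and `2`, or `R - 1` and `R`,
is labelled in the outer layer, next to its inner endpoint. -/
theorem primal_incident_inner (hodd : Odd R) {v : Site}
    (hv : v ∈ (primalGraph d R).internal) (h3 : v.2.2 % 2 = 0) :
    (primalGraph d R).incident v = neigh d R v := by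
  have hR2 : (R : ℤ) % 2 = 1 := Int.odd_iff.mp (by exact_mod_cast hodd)
  obtain ⟨hbox, h1, h2, -, hsub⟩ := mem_primalInternal.mp hv
  rw [mem_box] at hbox
  ext e
  rw [IntGraph.incident, Finset.mem_filter]
  change e ∈ primalEdges d R ∧ v ∈ primalEnds R e ↔ _
  rw [mem_primalEnds]
  constructor
  · rintro ⟨he, hve⟩
    rw [mem_neigh, siteDist_eq_one_iff_natAbs]
    refine ⟨((mem_primalEdges hodd).mp he).1, ?_⟩
    rcases hve with h | h | h
    · omega
    · omega
    · omega
  · intro he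
    refine ⟨hsub he, ?_⟩
    rw [mem_neigh, siteDist_eq_one_iff_natAbs] at he
    replace he := he.2
    have : (e.1 % 2 = 1 ∧ v.2.1 = e.2.1 ∧ v.2.2 = e.2.2) ∨ (e.2.1 % 2 = 1 ∧ v.1 = e.1 ∧
      v.2.2 = e.2.2) ∨ (e.2.2 % 2 = 1 ∧ v.1 = e.1 ∧ v.2.1 = e.2.1) := by omega
    rcases this with h | h | h
    · left
      omega
    · right; left
      omega
    · right; right
      refine ⟨by omega, by omega, by omega, by omega, ?_⟩
      by_cases hc : e.2.2 = 1
      · left; omega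
      · right
        by_cases hc : e.2.2 = R
        · left; omega
        · right; omega

/-- Qubits next to such a vertex stay in its layer and have two odd coordinates, so they can be
edges of this graph only by being `X`-measured. -/
theorem neigh_subset_setX (hodd : Odd R) {v : Site}
    (hv : v ∈ (primalGraph d R).internal) (h3 : v.2.2 % 2 = 1) :
    neigh d R v ⊆ setX d R := fun u hu => by
  have hR2 : (R : ℤ) % 2 = 1 := Int.odd_iff.mp (by exact_mod_cast hodd)
  obtain ⟨hbox, h1, h2, -, hsub⟩ := mem_primalInternal.mp hv
  have h := (mem_primalEdges hodd).mp (hsub hu)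
  rw [mem_neigh, siteDist_eq_one_iff_natAbs] at hu
  rw [mem_setX]
  refine ⟨h.1, ?_⟩
  have hq := mem_qubits.mp h.1
  replace hq := hq.2
  replace h := h.2
  replace hu := hu.2
  rcases h with h | h
  · omega
  · exact h

/-- The extra label `v` is the short edge that leads from the outer layer into the interior. -/
theorem primal_incident_layer (hodd : Odd R) (hR : 3 ≤ R) {v : Site}
    (hv : v ∈ (primalGraph d R).internal) (h3 : v.2.2 % 2 = 1) :
    (primalGraph d R).incident v = {v} ∪ neigh d R v := by
  have hR2 : (R : ℤ) % 2 = 1 := Int.odd_iff.mp (by exact_mod_cast hodd)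
  have hX := neigh_subset_setX hodd hv h3
  obtain ⟨hbox, h1, h2, h3', hsub⟩ := mem_primalInternal.mp hv
  rw [mem_box] at hbox
  have hvq : v ∈ qubits d R := by rw [mem_qubits]; omega
  ext e
  rw [IntGraph.incident, Finset.mem_filter, Finset.mem_union, Finset.mem_singleton]
  change e ∈ primalEdges d R ∧ v ∈ primalEnds R e ↔ _
  rw [mem_primalEnds]
  constructor
  · rintro ⟨he, hve⟩
    have hq := mem_qubits.mp ((mem_primalEdges hodd).mp he).1
    have hp := ((mem_primalEdges hodd).mp he).2
    rw [mem_neigh, siteDist_eq_one_iff_natAbs]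
    by_cases hev : e = v
    · exact Or.inl hev
    · refine Or.inr ⟨((mem_primalEdges hodd).mp he).1, ?_⟩
      rw [Prod.ext_iff, Prod.ext_iff] at hev
      rcases hve with h | h | h
      · clear hp hq
        omega
      · clear hp hq
        omega
      · obtain ⟨ha, hb, hc, hd, h | h | h⟩ := h
        · omega
        · omega
        · omega
  · rintro (rfl | he)
    · exact ⟨(mem_primalEdges hodd).mpr ⟨hvq, by omega⟩, by omega⟩
    · refine ⟨hsub he, ?_⟩
      have he' := (mem_setX.mp (hX he)).2.2.1
      rw [mem_neigh, siteDist_eq_one_iff_natAbs] at he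
      replace he := he.2
      rcases he' with h | h
      · right; left; omega
      · left; omega

theorem ne_q_of {u : Site} (hu : 1 + u.1 ≤ u.2.1 ∨ u.1 % 2 = 0 ∨ u.2.1 % 2 = 1) :
    u ≠ q₁ ∧ u ≠ q₂ R := by
  constructor <;> rintro rfl <;> simp [q₁, q₂] at hu

/-- All qubits around the cell are dual edges, hence neither `X`-measured nor one of `q₁`, `q₂`; the
cell stabilizer is therefore a pure `Z` constraint on outcomes. -/
theorem parity_dual_incident (hd : 2 ≤ d) (hR : 3 ≤ R) (hodd : Odd R) {s : Outcome d R}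
    (hs : amplitude s ≠ 0) {v : Site} (hv : v ∈ (dualGraph d R).internal) :
    parity (ones s) ((dualGraph d R).incident v) = 0 := by
  obtain ⟨hbox, h1, h2, h3, hsub⟩ := mem_dualInternal.mp hv
  rw [dual_incident hodd hv]
  refine parity_eq_zero_of_stabilizer hd hR (stabilizer_neigh hbox (Or.inr ⟨h1, h2, h3⟩) ?_)
    (fun h => ((mem_dualEdges hodd).mp (hsub h)).2.1 rfl)
    (fun h => ((mem_dualEdges hodd).mp (hsub h)).2.2.1 rfl) hs
  refine Finset.disjoint_left.mpr fun u hu hX => ?_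
  have h4 := ((mem_dualEdges hodd).mp (hsub hu)).2.2.2.2
  have h5 := (mem_setX.mp hX).2
  omega

/-- Inside, the cell stabilizer is used. In an outer layer it is the single stabilizer with `Z` on
`v` and `X` on its neighbours; these neighbours are `X`-measured, so the operator becomes `Z` on all
edges at `v`. -/
theorem parity_primal_incident (hd : 2 ≤ d) (hR : 3 ≤ R) (hodd : Odd R) {s : Outcome d R}
    (hs : amplitude s ≠ 0) {v : Site} (hv : v ∈ (primalGraph d R).internal) :
    parity (ones s) ((primalGraph d R).incident v) = 0 := by
  have hR2 : (R : ℤ) % 2 = 1 := Int.odd_iff.mp (by exact_mod_cast hodd)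
  obtain ⟨hbox, h1, h2, h3, hsub⟩ := mem_primalInternal.mp hv
  rcases Int.emod_two_eq_zero_or_one v.2.2 with h3' | h3'
  · rw [primal_incident_inner hodd hv h3']
    have hpar : ∀ u ∈ neigh d R v, u.1 % 2 + u.2.1 % 2 + u.2.2 % 2 = 1 := fun u hu => by
      rw [mem_neigh, siteDist_eq_one_iff_natAbs] at hu
      replace hu := hu.2
      clear hbox h3
      omega
    refine parity_eq_zero_of_stabilizer hd hR (stabilizer_neigh hbox (Or.inl ⟨h1, h2, h3'⟩) ?_)
      (fun h => by have := hpar _ h; simp [q₁] at this)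
      (fun h => by have := hpar _ h; simp [q₂, hR2] at this) hs
    refine Finset.disjoint_left.mpr fun u hu hX => ?_
    have h4 := hpar u hu
    have h5 := (mem_setX.mp hX).2
    omega
  · have hnX := neigh_subset_setX hodd hv h3'
    have hvq : v ∈ qubits d R := by
      rw [mem_box] at hbox
      rw [mem_qubits]
      omega
    rw [primal_incident_layer hodd hR hv h3']
    have hstab := pauliXZ_rotatedState (d := d) (R := R) (S := {v}) (T := neigh d R v)
      (fun u hu w hw => siteDist_ne_one_of_even (by
        rw [Finset.mem_singleton] at hu hw
        subst hu hw
        simp))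
      (fun c => by
        simp only [nbhd, ind, Finset.mem_singleton, mem_neigh, c.2, true_and]
        rw [Finset.sum_eq_single ⟨v, hvq⟩]
        · show (if siteDist c.1 v = 1 then (if v = v then (1 : ZMod 2) else 0) else 0) =
            if siteDist v c.1 = 1 then 1 else 0
          rw [if_pos rfl, siteDist_comm]
        · intro w _ hw
          rw [if_neg fun h => hw (Subtype.ext h), ite_self]
        · simp)
      (Finset.disjoint_left.mpr fun u hu hX => by
        rw [Finset.mem_singleton] at hu
        subst hu
        have := (mem_setX.mp hX).2.2
        omega)
    rw [Finset.sdiff_eq_empty_iff_subset.mpr hnX, Finset.inter_eq_left.mpr hnX, ind_empty]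
      at hstab
    have hlast : ∀ u ∈ {v} ∪ neigh d R v, u ≠ q₁ ∧ u ≠ q₂ R := fun u hu => by
      rw [Finset.mem_union, Finset.mem_singleton] at hu
      rcases hu with rfl | hu
      · exact ne_q_of (by omega)
      · exact ne_q_of (by have := (mem_setX.mp (hnX hu)).2; omega)
    exact parity_eq_zero_of_stabilizer hd hR hstab (fun h => (hlast _ h).1 rfl)
      (fun h => (hlast _ h).2 rfl) hs

end Stabilizers

/-! ### Failure of minimum weight matching -/

section Trails

variable {V E : Type} [DecidableEq V] [DecidableEq E] (G : IntGraph V E)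

theorem parity_eq_sum (A B : Finset E) : parity A B = ∑ e ∈ A, if e ∈ B then 1 else 0 := by
  rw [parity, ← Finset.filter_mem_eq_inter, Finset.card_filter]
  push_cast
  rfl

theorem sum_symmDiff (A B : Finset E) (F : E → ZMod 2) :
    ∑ e ∈ symmDiff A B, F e = ∑ e ∈ A, F e + ∑ e ∈ B, F e := by
  have h1 := Finset.sum_inter_add_sum_sdiff A B F
  have h2 := Finset.sum_inter_add_sum_sdiff B A F
  rw [symmDiff_def, Finset.sup_eq_union, Finset.sum_union disjoint_sdiff_sdiff, ← h1, ← h2,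
    Finset.inter_comm B A]
  linear_combination (-1 : ZMod 2) * zmod_two_add_self (∑ e ∈ A ∩ B, F e)

/-- The parity of the number of edges of `S` incident with `v`. -/
def IntGraph.degParity (S : Finset E) (v : V) : ZMod 2 := ∑ e ∈ S, if v ∈ G.ends e then 1 else 0

theorem IntGraph.mem_boundary {S : Finset E} {v : V} :
    v ∈ G.boundary S ↔ v ∈ G.internal ∧ G.degParity S v = 1 := by
  rw [IntGraph.boundary, Finset.mem_filter, IntGraph.degParity, ← ZMod.natCast_eq_one_iff_odd,
    Finset.card_filter]
  push_cast
  rfl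

theorem IntGraph.degParity_eq_parity {S : Finset E} (hS : S ⊆ G.edges) (v : V) :
    G.degParity S v = parity S (G.incident v) := by
  rw [parity_eq_sum, IntGraph.degParity]
  refine Finset.sum_congr rfl fun e he => if_congr ?_ rfl rfl
  simp [IntGraph.incident, hS he]

/-- The edges of the list form a walk from the first vertex to the second one,
which is the only external vertex visited. -/
inductive IntGraph.Trail : V → List E → V → Prop
  | nil {v : V} (hv : v ∉ G.internal) : IntGraph.Trail v [] v
  | cons {v w x : V} {e : E} {es : List E} (hv : v ∈ G.internal) (he : e ∈ G.edges)
      (hends : G.ends e = s(v, w)) (ht : IntGraph.Trail w es x) : IntGraph.Trail v (e :: es) x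

variable {G}

theorem IntGraph.Trail.eq_nil {v x : V} {es : List E} (h : G.Trail v es x) (hv : v ∉ G.internal) :
    es = [] ∧ x = v := by
  cases h with
  | nil => exact ⟨rfl, rfl⟩
  | cons hv' => exact absurd hv' hv

theorem IntGraph.Trail.not_mem_internal {v x : V} {es : List E} (h : G.Trail v es x) :
    x ∉ G.internal := by
  induction h with
  | nil hv => exact hv
  | cons _ _ _ _ ih => exact ih

theorem ite_mem_sym2 {v w u : V} (h : v ≠ w) :
    (if u ∈ s(v, w) then 1 else 0 : ZMod 2) = (if u = v then 1 else 0) + if u = w then 1 else 0 := by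
  simp only [Sym2.mem_iff]
  by_cases h1 : u = v
  · subst h1
    simp [h]
  · simp [h1]

/-- Greedy walk: `v` is the only internal vertex of odd degree, so if it is internal some edge of
`Z` leaves it, and removing that edge moves the odd vertex to the other end. As `Z` shrinks, the
walk stops, necessarily at an external vertex. -/
theorem exists_trail (hloop : ∀ e ∈ G.edges, ¬ (G.ends e).IsDiag) (n : ℕ) :
    ∀ (Z : Finset E) (v : V), Z.card = n → Z ⊆ G.edges →
      (∀ u ∈ G.internal, G.degParity Z u = if u = v then 1 else 0) →
      ∃ es x, G.Trail v es x ∧ es.Nodup ∧ es.toFinset ⊆ Z ∧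
        ∀ u ∈ G.internal, G.degParity es.toFinset u = if u = v then 1 else 0 := by
  induction n with
  | zero =>
    intro Z v hn hZ hdeg
    obtain rfl := Finset.card_eq_zero.mp hn
    exact ⟨[], v, .nil fun hv => by simpa [IntGraph.degParity] using hdeg v hv, List.nodup_nil,
      by simp, by simpa using hdeg⟩
  | succ n ih =>
    intro Z v hn hZ hdeg
    by_cases hv : v ∈ G.internal
    · obtain ⟨e, heZ, hve⟩ : ∃ e ∈ Z, v ∈ G.ends e := by
        by_contra hne
        push Not at hne
        have h1 := hdeg v hv
        rw [if_pos rfl, IntGraph.degParity,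
          Finset.sum_eq_zero fun e he => if_neg (hne e he)] at h1
        exact zero_ne_one h1
      obtain ⟨w, hw⟩ := hve
      have hvw : v ≠ w := by
        rintro rfl
        exact hloop e (hZ heZ) (by rw [hw]; simp)
      have hdeg' : ∀ u ∈ G.internal, G.degParity (Z.erase e) u = if u = w then 1 else 0 := by
        intro u hu
        have h1 := hdeg u hu
        rw [IntGraph.degParity, ← Finset.add_sum_erase _ _ heZ, hw, ite_mem_sym2 hvw] at h1
        rw [IntGraph.degParity]
        linear_combination h1 - zmod_two_add_self (if u = w then 1 else 0)
      obtain ⟨es, x, ht, hnd, hsub, hes⟩ := ih (Z.erase e) w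
        (by rw [Finset.card_erase_of_mem heZ, hn]; rfl) ((Finset.erase_subset _ _).trans hZ) hdeg'
      have hees : e ∉ es := fun h => by
        have := hsub (List.mem_toFinset.mpr h)
        simp at this
      refine ⟨e :: es, x, .cons hv (hZ heZ) hw ht, List.nodup_cons.mpr ⟨hees, hnd⟩, ?_, ?_⟩
      · rw [List.toFinset_cons, Finset.insert_subset_iff]
        exact ⟨heZ, hsub.trans (Finset.erase_subset _ _)⟩
      · intro u hu
        rw [List.toFinset_cons, IntGraph.degParity, Finset.sum_insert (by simpa using hees)]
        change _ + G.degParity es.toFinset u = _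
        rw [hes u hu, hw, ite_mem_sym2 hvw]
        linear_combination zmod_two_add_self (if u = w then 1 else 0)
    · exact ⟨[], v, .nil hv, List.nodup_nil, by simp, fun u hu => by
        rw [if_neg (by rintro rfl; exact hv hu)]
        simp [IntGraph.degParity]⟩

variable {O : V → Prop} {L : Finset E}

/-- Internal vertices are not in `O` and a trail meets an external vertex only at its end, so only
the last edge can belong to `L`. -/
theorem IntGraph.Trail.sum_mem (hO : ∀ v ∈ G.internal, ¬ O v)
    (hL : ∀ e ∈ G.edges, (e ∈ L ↔ ∃ o ∈ G.ends e, O o)) [DecidablePred O] {v x : V} {es : List E}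
    (h : G.Trail v es x) (hv : ¬ O v) :
    (es.map fun e => if e ∈ L then (1 : ZMod 2) else 0).sum = if O x then 1 else 0 := by
  induction h with
  | nil => simp [hv]
  | @cons v w x e es hvi he hends ht ih =>
    have heL : e ∈ L ↔ O w := by
      rw [hL e he, hends]
      simp [hO v hvi]
    rw [List.map_cons, List.sum_cons]
    by_cases hw : O w
    · obtain ⟨rfl, rfl⟩ := ht.eq_nil fun h => hO w h hw
      simp [heL, hw]
    · rw [ih hw, if_neg (heL.not.mpr hw), zero_add]

/-- A set of edges without boundary which contains an odd number of edges of `L` contains a trail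
between external vertices which starts with an edge of `L` and ends elsewhere. -/
theorem exists_trail_of_odd (hloop : ∀ e ∈ G.edges, ¬ (G.ends e).IsDiag)
    (hO : ∀ v ∈ G.internal, ¬ O v) (hL : ∀ e ∈ G.edges, (e ∈ L ↔ ∃ o ∈ G.ends e, O o))
    (hinner : ∀ e ∈ G.edges, ∀ o w, G.ends e = s(o, w) → O o → ¬ O w) (n : ℕ) :
    ∀ Z : Finset E, Z.card = n → Z ⊆ G.edges → (∀ u ∈ G.internal, G.degParity Z u = 0) →
      parity Z L = 1 →
      ∃ l o w es x, G.ends l = s(o, w) ∧ O o ∧ G.Trail w es x ∧ ¬ O x ∧ (l :: es).Nodup ∧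
        (l :: es).toFinset ⊆ Z ∧ ∀ u ∈ G.internal, G.degParity (l :: es).toFinset u = 0 := by
  classical
  induction n using Nat.strong_induction_on with
  | _ n ih =>
  intro Z hn hZ hdeg hpar
  obtain ⟨l, hlZ, hlL⟩ : ∃ l ∈ Z, l ∈ L := by
    by_contra hne
    push Not at hne
    rw [parity_eq_sum, Finset.sum_eq_zero fun e he => if_neg (hne e he)] at hpar
    exact zero_ne_one hpar
  obtain ⟨o, ⟨w, how⟩, ho⟩ := (hL l (hZ hlZ)).mp hlL
  have hw := hinner l (hZ hlZ) o w how ho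
  have how' : o ≠ w := by rintro rfl; exact hw ho
  have hne : ∀ u ∈ G.internal, u ≠ o := by rintro u hu rfl; exact hO u hu ho
  have hl : ∀ u ∈ G.internal, (if u ∈ G.ends l then 1 else 0 : ZMod 2) = if u = w then 1 else 0 :=
    fun u hu => by rw [how, ite_mem_sym2 how', if_neg (hne u hu), zero_add]
  have hdeg' : ∀ u ∈ G.internal, G.degParity (Z.erase l) u = if u = w then 1 else 0 := by
    intro u hu
    have h1 := hdeg u hu
    rw [IntGraph.degParity, ← Finset.add_sum_erase _ _ hlZ, hl u hu] at h1
    rw [IntGraph.degParity]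
    linear_combination h1 - zmod_two_add_self (if u = w then 1 else 0)
  obtain ⟨es, x, ht, hnd, hsub, hes⟩ := exists_trail hloop _ (Z.erase l) w rfl
    ((Finset.erase_subset _ _).trans hZ) hdeg'
  have hles : l ∉ es := fun h => by
    have := hsub (List.mem_toFinset.mpr h)
    simp at this
  have hnd' : (l :: es).Nodup := List.nodup_cons.mpr ⟨hles, hnd⟩
  have hsub' : (l :: es).toFinset ⊆ Z := by
    rw [List.toFinset_cons, Finset.insert_subset_iff]
    exact ⟨hlZ, hsub.trans (Finset.erase_subset _ _)⟩
  have hdegT : ∀ u ∈ G.internal, G.degParity (l :: es).toFinset u = 0 := by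
    intro u hu
    rw [List.toFinset_cons, IntGraph.degParity, Finset.sum_insert (by simpa using hles)]
    change _ + G.degParity es.toFinset u = _
    rw [hes u hu, hl u hu, zmod_two_add_self]
  by_cases hx : O x
  -- A trail returning to `O` uses exactly two edges of `L`, its first and its last. Deleting it
  -- leaves a smaller set without boundary that is still odd on `L`.
  · have hT : parity (l :: es).toFinset L = 0 := by
      rw [parity_eq_sum, List.sum_toFinset _ hnd', List.map_cons, List.sum_cons,
        ht.sum_mem hO hL hw, if_pos hx, if_pos hlL, zmod_two_add_self]
    have hlt : (Z \ (l :: es).toFinset).card < n := by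
      rw [← hn]
      refine Finset.card_lt_card (Finset.sdiff_ssubset hsub' ⟨l, by simp⟩)
    obtain ⟨l', o', w', es', x', h1, h2, h3, h4, h5, h6, h7⟩ := ih _ hlt (Z \ (l :: es).toFinset)
      rfl (Finset.sdiff_subset.trans hZ)
      (fun u hu => by
        have h1 := hdeg u hu
        have h2 := hdegT u hu
        rw [IntGraph.degParity, ← Finset.sum_sdiff hsub'] at h1
        rw [IntGraph.degParity] at h2 ⊢
        rwa [h2, add_zero] at h1)
      (by
        rw [parity_eq_sum, ← Finset.sum_sdiff hsub'] at hpar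
        rw [parity_eq_sum] at hT ⊢
        rwa [hT, add_zero] at hpar)
    exact ⟨l', o', w', es', x', h1, h2, h3, h4, h5, h6.trans Finset.sdiff_subset, h7⟩
  · exact ⟨l, o, w, es, x, how, ho, ht, hx, hnd', hsub', hdegT⟩

/-- If decoding fails then at least half of the edges of some trail are errors. -/
theorem exists_trail_of_failure (hloop : ∀ e ∈ G.edges, ¬ (G.ends e).IsDiag)
    (hO : ∀ v ∈ G.internal, ¬ O v) (hL : ∀ e ∈ G.edges, (e ∈ L ↔ ∃ o ∈ G.ends e, O o))
    (hinner : ∀ e ∈ G.edges, ∀ o w, G.ends e = s(o, w) → O o → ¬ O w)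
    {A M : Finset E} (hA : A ⊆ G.edges) (hM : G.IsMinMatching (G.boundary A) M)
    (hfail : parity A L + parity M L ≠ 0) :
    ∃ l o w es x, l ∈ G.edges ∧ G.ends l = s(o, w) ∧ O o ∧ G.Trail w es x ∧ ¬ O x ∧
      (l :: es).Nodup ∧ (l :: es).toFinset ⊆ G.edges ∧
      (l :: es).length ≤ 2 * ((l :: es).toFinset ∩ A).card := by
  obtain ⟨⟨hMe, hMb⟩, hmin⟩ := hM
  have hZ : symmDiff A M ⊆ G.edges := fun e he => by
    rw [Finset.mem_symmDiff] at he
    rcases he with he | he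
    · exact hA he.1
    · exact hMe he.1
  have hdegAM : ∀ u ∈ G.internal, G.degParity A u = G.degParity M u := fun u hu => by
    have h1 : u ∈ G.boundary A ↔ u ∈ G.boundary M := by rw [hMb]
    rw [G.mem_boundary, G.mem_boundary] at h1
    rcases zmod_two_cases (G.degParity A u) with h | h <;>
      rcases zmod_two_cases (G.degParity M u) with h' | h' <;> simp_all
  obtain ⟨l, o, w, es, x, h1, h2, h3, h4, h5, h6, h7⟩ := exists_trail_of_odd hloop hO hL hinner _
    (symmDiff A M) rfl hZ
    (fun u hu => by
      rw [IntGraph.degParity, sum_symmDiff]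
      change G.degParity A u + G.degParity M u = 0
      rw [hdegAM u hu, zmod_two_add_self])
    (by
      rw [parity_eq_sum, sum_symmDiff, ← parity_eq_sum, ← parity_eq_sum]
      exact (zmod_two_cases _).resolve_left hfail)
  set T := (l :: es).toFinset with hT
  refine ⟨l, o, w, es, x, hZ (h6 (by simp [hT])), h1, h2, h3, h4, h5, h6.trans hZ, ?_⟩
  -- `T` has no boundary, so exchanging `M` along `T` gives another matching. Minimality yields `|M
  -- ∩ T| ≤ |T \ M|`, and `T \ M` consists of errors because `T` lies in the symmetric difference.
  have hcard := hmin (symmDiff M T) ⟨fun e he => by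
    rw [Finset.mem_symmDiff] at he
    rcases he with he | he
    · exact hMe he.1
    · exact hZ (h6 he.1), by
    rw [← hMb]
    ext u
    rw [G.mem_boundary, G.mem_boundary]
    refine and_congr_right fun hu => ?_
    have h7' := h7 u hu
    rw [IntGraph.degParity] at h7'
    rw [IntGraph.degParity, sum_symmDiff, h7', add_zero]
    rfl⟩
  rw [symmDiff_def, Finset.sup_eq_union, Finset.card_union_of_disjoint disjoint_sdiff_sdiff]
    at hcard
  have hM2 := Finset.card_inter_add_card_sdiff M T
  have hT2 := Finset.card_inter_add_card_sdiff T M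
  have hsub : T \ M ⊆ T ∩ A := fun e he => by
    rw [Finset.mem_sdiff] at he
    have := h6 he.1
    rw [Finset.mem_symmDiff] at this
    rw [Finset.mem_inter]
    tauto
  have hle := Finset.card_le_card hsub
  rw [Finset.inter_comm T M] at hT2
  have hlen : T.card = (l :: es).length := List.toFinset_card_of_nodup h5
  rw [← hT]
  omega

/-! ### Counting non-backtracking walks -/

variable (G) in
/-- The end of the edge `e` other than `v`. -/
def IntGraph.other (e : E) (v : V) : V := if h : v ∈ G.ends e then Sym2.Mem.other h else v

theorem IntGraph.ends_eq_other {e : E} {v : V} (h : v ∈ G.ends e) :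
    G.ends e = s(v, G.other e v) := by
  rw [IntGraph.other, dif_pos h, Sym2.other_spec]

variable (G) in
/-- The lists of `n` edges which continue, without going back, a walk which reached the vertex
`v` through the edge `prev`. -/
def IntGraph.continuations : E → V → ℕ → Finset (List E)
  | _, _, 0 => {[]}
  | prev, v, n + 1 => ((G.incident v).erase prev).biUnion fun e =>
      (IntGraph.continuations e (G.other e v) n).image (e :: ·)

/-- Of at most six edges at `v`, the one just used is excluded; `prev` must be incident with `v` for
this saving. -/
theorem IntGraph.card_continuations_le (hdeg : ∀ v, (G.incident v).card ≤ 6) (n : ℕ) :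
    ∀ (prev : E) (v : V), prev ∈ G.incident v → (G.continuations prev v n).card ≤ 5 ^ n := by
  induction n with
  | zero => intro prev v _; simp [IntGraph.continuations]
  | succ n ih =>
    intro prev v hprev
    rw [IntGraph.continuations]
    have h5 : ((G.incident v).erase prev).card ≤ 5 := by
      rw [Finset.card_erase_of_mem hprev]
      have := hdeg v
      omega
    calc _ ≤ ∑ e ∈ (G.incident v).erase prev,
          ((G.continuations e (G.other e v) n).image (e :: ·)).card := Finset.card_biUnion_le
      _ ≤ ∑ e ∈ (G.incident v).erase prev, 5 ^ n := by
          refine Finset.sum_le_sum fun e he => Finset.card_image_le.trans (ih e _ ?_)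
          have he' := Finset.mem_filter.mp (Finset.mem_of_mem_erase he)
          refine Finset.mem_filter.mpr ⟨he'.1, ?_⟩
          rw [IntGraph.ends_eq_other he'.2]
          simp
      _ ≤ 5 ^ (n + 1) := by
          rw [Finset.sum_const, smul_eq_mul, pow_succ']
          exact Nat.mul_le_mul_right _ h5

theorem IntGraph.Trail.mem_continuations {v x : V} {es : List E} (h : G.Trail v es x) :
    ∀ prev, (prev :: es).Nodup → es ∈ G.continuations prev v es.length := by
  induction h with
  | nil => intro prev _; simp [IntGraph.continuations]
  | @cons v w x e es hv he hends ht ih =>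
    intro prev hnd
    rw [List.length_cons, IntGraph.continuations, Finset.mem_biUnion]
    have hve : v ∈ G.ends e := by rw [hends]; simp
    have hw : G.other e v = w := by
      have := IntGraph.ends_eq_other hve
      rw [hends] at this
      exact (Sym2.congr_right.mp this).symm
    rw [List.nodup_cons] at hnd
    refine ⟨e, Finset.mem_erase.mpr ⟨?_, Finset.mem_filter.mpr ⟨he, hve⟩⟩, ?_⟩
    · rintro rfl
      exact hnd.1 (by simp)
    · rw [hw]
      exact Finset.mem_image_of_mem _ (ih e hnd.2)

/-! ### Union bounds -/

section Probability

variable {Ω : Type} [Fintype Ω] (w : Ω → ℝ)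

open Classical in
/-- The total weight of an event. -/
def weight (A : Ω → Prop) : ℝ := ∑ ω, if A ω then w ω else 0

variable {w}

theorem weight_mono (hw : ∀ ω, 0 ≤ w ω) {A B : Ω → Prop} (h : ∀ ω, A ω → B ω) :
    weight w A ≤ weight w B := by
  refine Finset.sum_le_sum fun ω _ => ?_
  by_cases hA : A ω
  · rw [if_pos hA, if_pos (h ω hA)]
  · rw [if_neg hA]
    split_ifs <;> simp [hw ω]

theorem weight_or_le (hw : ∀ ω, 0 ≤ w ω) (A B : Ω → Prop) :
    weight w (fun ω => A ω ∨ B ω) ≤ weight w A + weight w B := by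
  rw [weight, weight, weight, ← Finset.sum_add_distrib]
  refine Finset.sum_le_sum fun ω _ => ?_
  have := hw ω
  by_cases hA : A ω <;> by_cases hB : B ω <;> simp [hA, hB, this]

theorem weight_exists_le (hw : ∀ ω, 0 ≤ w ω) {ι : Type} (S : Finset ι) (A : ι → Ω → Prop) :
    weight w (fun ω => ∃ i ∈ S, A i ω) ≤ ∑ i ∈ S, weight w (A i) := by
  simp only [weight]
  rw [Finset.sum_comm]
  refine Finset.sum_le_sum fun ω _ => ?_
  have hnn : ∀ i ∈ S, (0 : ℝ) ≤ @ite ℝ (A i ω) (Classical.propDecidable _) (w ω) 0 :=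
    fun i _ => by split_ifs <;> simp [hw ω]
  split_ifs with h
  · obtain ⟨i, hi, hA⟩ := h
    refine le_trans ?_ (Finset.single_le_sum hnn hi)
    rw [if_pos hA]
  · exact Finset.sum_nonneg hnn

/-- Union bound over the subsets of `T` with at least `⌈|T|/2⌉` elements: there are at most `2^|T|`
of them, and each consists of errors with weight at most `p^⌈|T|/2⌉`. -/
theorem weight_half_le (hw : ∀ ω, 0 ≤ w ω) {p : ℝ} (hp0 : 0 ≤ p) (hp1 : p ≤ 1)
    {err : Ω → Finset E} (herr : ∀ F, weight w (fun ω => F ⊆ err ω) ≤ p ^ F.card) (T : Finset E) :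
    weight w (fun ω => T.card ≤ 2 * (T ∩ err ω).card) ≤ 2 ^ T.card * p ^ ((T.card + 1) / 2) := by
  calc _ ≤ weight w (fun ω => ∃ F ∈ T.powerset.filter fun F => (T.card + 1) / 2 ≤ F.card,
          F ⊆ err ω) := weight_mono hw fun ω h => ⟨T ∩ err ω, by
            rw [Finset.mem_filter, Finset.mem_powerset]
            exact ⟨Finset.inter_subset_left, by omega⟩, Finset.inter_subset_right⟩
    _ ≤ ∑ F ∈ T.powerset.filter fun F => (T.card + 1) / 2 ≤ F.card, p ^ ((T.card + 1) / 2) :=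
        (weight_exists_le hw _ _).trans (Finset.sum_le_sum fun F hF => (herr F).trans
          (pow_le_pow_of_le_one hp0 hp1 (Finset.mem_filter.mp hF).2))
    _ ≤ _ := by
        rw [Finset.sum_const, nsmul_eq_mul]
        refine mul_le_mul_of_nonneg_right ?_ (pow_nonneg hp0 _)
        have := (Finset.card_filter_le T.powerset fun F => (T.card + 1) / 2 ≤ F.card).trans_eq
          (Finset.card_powerset T)
        exact_mod_cast this

/-- The probability that decoding fails is at most the expected number of trails
half of whose edges are errors. -/
theorem weight_failure_le (hloop : ∀ e ∈ G.edges, ¬ (G.ends e).IsDiag)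
    (hO : ∀ v ∈ G.internal, ¬ O v) (hL : ∀ e ∈ G.edges, (e ∈ L ↔ ∃ o ∈ G.ends e, O o))
    (inner : E → V)
    (hinner : ∀ e ∈ G.edges, ∀ o w, G.ends e = s(o, w) → O o → w = inner e ∧ ¬ O w)
    (hdeg : ∀ v, (G.incident v).card ≤ 6) (S : ℕ → Finset E)
    (hS : ∀ l ∈ G.edges, ∀ o w es x, G.ends l = s(o, w) → O o → G.Trail w es x → ¬ O x →
      l ∈ S (es.length + 1))
    (hw : ∀ ω, 0 ≤ w ω) {p : ℝ} (hp0 : 0 ≤ p) (hp1 : p ≤ 1)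
    {err : Ω → Finset E} (herr : ∀ F, weight w (fun ω => F ⊆ err ω) ≤ p ^ F.card)
    (herr' : ∀ ω, err ω ⊆ G.edges) {f : Finset V → Finset E} (hf : G.IsMinMatchFun f) :
    weight w (fun ω => parity (err ω) L + parity (f (G.boundary (err ω))) L ≠ 0) ≤
      ∑ n ∈ Finset.range G.edges.card,
        ((S (n + 1)).card : ℝ) * (5 ^ n * (2 ^ (n + 1) * p ^ ((n + 2) / 2))) := by
  -- All candidate trails with `n + 1` edges: a permitted first edge, whose inner end is determined,
  -- followed by `n` non-backtracking steps.
  set paths : ℕ → Finset (List E) := fun n =>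
    ((S (n + 1)).filter fun l => l ∈ G.incident (inner l)).biUnion fun l =>
      (G.continuations l (inner l) n).image (l :: ·) with hpaths
  have hcard : ∀ n, ((paths n).card : ℝ) ≤ (S (n + 1)).card * 5 ^ n := by
    intro n
    have : (paths n).card ≤ (S (n + 1)).card * 5 ^ n := by
      refine Finset.card_biUnion_le.trans ?_
      calc _ ≤ ∑ l ∈ (S (n + 1)).filter fun l => l ∈ G.incident (inner l), 5 ^ n :=
            Finset.sum_le_sum fun l hl => Finset.card_image_le.trans
              (IntGraph.card_continuations_le hdeg n _ _ (Finset.mem_filter.mp hl).2)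
        _ ≤ _ := by
            rw [Finset.sum_const, smul_eq_mul]
            exact Nat.mul_le_mul_right _ (Finset.card_filter_le _ _)
    exact_mod_cast this
  have hpath : ∀ n, ∀ T ∈ paths n, weight w (fun ω => T.Nodup ∧ T.length = n + 1 ∧
      T.length ≤ 2 * (T.toFinset ∩ err ω).card) ≤ 2 ^ (n + 1) * p ^ ((n + 2) / 2) := by
    intro n T _
    by_cases hT : T.Nodup ∧ T.length = n + 1
    · have h1 := weight_half_le hw hp0 hp1 herr T.toFinset
      rw [List.toFinset_card_of_nodup hT.1, hT.2] at h1
      refine (weight_mono hw fun ω h => ?_).trans h1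
      rw [hT.2] at h
      exact h.2.2
    · refine (Finset.sum_nonpos fun ω _ => ?_).trans (by positivity)
      rw [if_neg fun h => hT ⟨h.1, h.2.1⟩]
  calc _ ≤ weight w (fun ω => ∃ n ∈ Finset.range G.edges.card, ∃ T ∈ paths n, T.Nodup ∧
          T.length = n + 1 ∧ T.length ≤ 2 * (T.toFinset ∩ err ω).card) := by
        refine weight_mono hw fun ω hω => ?_
        obtain ⟨l, o, v, es, x, hl, how, ho, ht, hx, hnd, hsub, hlen⟩ :=
          exists_trail_of_failure hloop hO hL (fun e he o w h h' => (hinner e he o w h h').2)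
            (herr' ω) (hf _ ⟨err ω, herr' ω, rfl⟩) hω
        obtain rfl := (hinner l hl o v how ho).1
        -- The edges of the trail are distinct, so their number is at most that of the whole graph;
        -- this makes the union finite.
        refine ⟨es.length, ?_, l :: es, ?_, hnd, rfl, hlen⟩
        · have := Finset.card_le_card hsub
          rw [List.toFinset_card_of_nodup hnd, List.length_cons] at this
          exact Finset.mem_range.mpr this
        · rw [hpaths, Finset.mem_biUnion]
          refine ⟨l, Finset.mem_filter.mpr ⟨hS l hl o _ es x how ho ht hx,
            Finset.mem_filter.mpr ⟨hl, by rw [how]; simp⟩⟩,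
            Finset.mem_image_of_mem _ (ht.mem_continuations l hnd)⟩
    _ ≤ ∑ n ∈ Finset.range G.edges.card, ∑ T ∈ paths n, weight w (fun ω => T.Nodup ∧
          T.length = n + 1 ∧ T.length ≤ 2 * (T.toFinset ∩ err ω).card) :=
        (weight_exists_le hw _ _).trans (Finset.sum_le_sum fun n _ => weight_exists_le hw _ _)
    _ ≤ _ := by
        refine Finset.sum_le_sum fun n _ => (Finset.sum_le_sum (hpath n)).trans ?_
        rw [Finset.sum_const, nsmul_eq_mul, ← mul_assoc ((S (n + 1)).card : ℝ)]
        exact mul_le_mul_of_nonneg_right (hcard n) (by positivity)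

end Probability

end Trails

/-! ### Geometry of the decoding graphs -/

section Geometry

variable {d R : ℕ}

theorem IntGraph.Trail.dist_le {G : IntGraph Site Site}
    (hG : ∀ e ∈ G.edges, ∀ v w, G.ends e = s(v, w) →
      (v.1 - w.1).natAbs + (v.2.1 - w.2.1).natAbs + (v.2.2 - w.2.2).natAbs ≤ 2)
    {v x : Site} {es : List Site} (h : G.Trail v es x) :
    (v.1 - x.1).natAbs + (v.2.1 - x.2.1).natAbs + (v.2.2 - x.2.2).natAbs ≤ 2 * es.length := by
  induction h with
  | nil => simp
  | cons hv he hends ht ih =>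
    have := hG _ he _ _ hends
    rw [List.length_cons]
    omega

theorem IntGraph.Trail.exists_mem_ends {G : IntGraph Site Site} {v x : Site} {es : List Site}
    (h : G.Trail v es x) (hv : ∃ e ∈ G.edges, v ∈ G.ends e) : ∃ e ∈ G.edges, x ∈ G.ends e := by
  induction h with
  | nil => exact hv
  | cons _ he hends _ ih => exact ih ⟨_, he, by rw [hends]; simp⟩

/-- The site is at distance less than `2 * n` from the front or the back layer. -/
def NearEnds (R n : ℕ) (u : Site) : Prop := u.2.2 ≤ 2 * n - 1 ∨ (R : ℤ) + 2 - 2 * n ≤ u.2.2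

instance (R n : ℕ) : DecidablePred (NearEnds R n) := fun u => by unfold NearEnds; infer_instance

/-- Counts pairs formed by half of an even transverse coordinate, or the floor of half of an odd
one, and a layer among the `2n - 1` nearest to either end. -/
theorem card_nearEnds_le (n : ℕ) :
    (Finset.Icc (0 : ℤ) n ×ˢ (Finset.Icc (1 : ℤ) (2 * n - 1) ∪ Finset.Icc ((R : ℤ) + 2 - 2 * n) R)).card
      ≤ 4 * n * (n + 1) := by
  rw [Finset.card_product]
  have h := Finset.card_union_le (Finset.Icc (1 : ℤ) (2 * n - 1))
    (Finset.Icc ((R : ℤ) + 2 - 2 * n) R)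
  simp only [Int.card_Icc] at h ⊢
  have h1 : (Finset.Icc (1 : ℤ) (2 * n - 1) ∪ Finset.Icc ((R : ℤ) + 2 - 2 * n) R).card ≤ 4 * n := by
    omega
  have h2 : ((n : ℤ) + 1 - 0).toNat = n + 1 := by omega
  rw [h2]
  calc _ ≤ (n + 1) * (4 * n) := Nat.mul_le_mul_left _ h1
    _ = _ := by ring

/-! #### The decoding graph -/

theorem primal_loopless : ∀ e ∈ (primalGraph d R).edges, ¬ ((primalGraph d R).ends e).IsDiag := by
  intro e _
  change ¬ (primalEnds R e).IsDiag
  unfold primalEnds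
  split_ifs <;> simp only [Sym2.mk_isDiag_iff, Prod.mk.injEq] <;> omega

theorem mem_primalGraph_edges (hodd : Odd R) {u : Site} (hu : u ∈ (primalGraph d R).edges) :
    u ∈ qubits d R ∧ (((u.1 % 2 = 1 ∧ u.2.1 % 2 = 0 ∧ u.2.2 % 2 = 0) ∨
      (u.1 % 2 = 0 ∧ u.2.1 % 2 = 1 ∧ u.2.2 % 2 = 0) ∨
      (u.1 % 2 = 0 ∧ u.2.1 % 2 = 0 ∧ u.2.2 % 2 = 1)) ∨
    ((u.2.2 = 1 ∨ u.2.2 = R) ∧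
      ((u.1 % 2 = 0 ∧ u.2.1 % 2 = 1) ∨ (u.1 % 2 = 1 ∧ u.2.1 % 2 = 0)) ∧ 1 + u.1 ≤ u.2.1)) :=
  (mem_primalEdges hodd).mp hu

theorem primal_internal_ne_zero : ∀ v ∈ (primalGraph d R).internal, ¬ v.1 = 0 := by
  intro v hv
  have := mem_box.mp (mem_primalInternal.mp hv).1
  omega

/-- Only edges in the first direction with label `u₁ = 1` reach `u₁ = 0`. If such an edge is
`X`-measured, then `1 + u₁ ≤ u₂` gives the condition `u₂ ≥ 2` of the recovery set. -/
theorem mem_recoveryX_iff_ends (hodd : Odd R) : ∀ e ∈ (primalGraph d R).edges,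
    (e ∈ recoveryX d R ↔ ∃ o ∈ (primalGraph d R).ends e, o.1 = 0) := by
  intro e he
  obtain ⟨heq, hep⟩ := mem_primalGraph_edges hodd he
  have hbox := (mem_qubits.mp heq).1.1
  rw [mem_recoveryX]
  change _ ↔ ∃ o ∈ primalEnds R e, o.1 = 0
  simp only [mem_primalEnds]
  constructor
  · rintro ⟨-, h1, -⟩
    exact ⟨(0, e.2.1, e.2.2), Or.inl ⟨by omega, Or.inl (by simp [h1]), rfl, rfl⟩, rfl⟩
  · rintro ⟨o, h | h | h, ho⟩
    · refine ⟨heq, by omega, ?_⟩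
      rcases hep with hep | hep
      · omega
      · exact ⟨by omega, Or.inr ⟨by omega, hep.1⟩⟩
    · omega
    · omega

theorem primal_inner (hodd : Odd R) : ∀ e ∈ (primalGraph d R).edges, ∀ o w : Site,
    (primalGraph d R).ends e = s(o, w) → o.1 = 0 → w = (e.1 + 1, e.2.1, e.2.2) ∧ ¬ w.1 = 0 := by
  intro e he o w how ho
  have heL := (mem_recoveryX_iff_ends hodd e he).mpr ⟨o, by rw [how]; simp, ho⟩
  have h1 := (mem_recoveryX.mp heL).2.1
  change primalEnds R e = _ at how
  rw [primalEnds, if_pos (by rw [h1]; decide), Sym2.eq_iff] at how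
  rcases how with ⟨rfl, rfl⟩ | ⟨h, rfl⟩
  · exact ⟨rfl, by simp only; omega⟩
  · exfalso
    have := congrArg Prod.fst h
    subst h
    simp only at ho
    omega

theorem primal_degree_le (hodd : Odd R) (hR : 3 ≤ R) (v : Site) :
    ((primalGraph d R).incident v).card ≤ 6 := by
  have hR2 : (R : ℤ) % 2 = 1 := Int.odd_iff.mp (by exact_mod_cast hodd)
  have hsub : ∃ a b : ℤ, (primalGraph d R).incident v ⊆ {(v.1 + 1, v.2.1, v.2.2),
      (v.1 - 1, v.2.1, v.2.2), (v.1, v.2.1 + 1, v.2.2), (v.1, v.2.1 - 1, v.2.2),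
      (v.1, v.2.1, a), (v.1, v.2.1, b)} := by
    -- A vertex of an outer layer has a single edge in the third direction, labelled by the vertex
    -- itself, so both slots may be the same.
    refine ⟨if v.2.2 = 1 ∨ v.2.2 = R then v.2.2 else v.2.2 + 1,
      if v.2.2 = 1 ∨ v.2.2 = R then v.2.2 else v.2.2 - 1, fun e he => ?_⟩
    rw [IntGraph.incident, Finset.mem_filter] at he
    obtain ⟨he, hve⟩ := he
    obtain ⟨heq, hep⟩ := mem_primalGraph_edges hodd he
    have hbox := (mem_qubits.mp heq).1.2.2
    change v ∈ primalEnds R e at hve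
    rw [mem_primalEnds] at hve
    obtain ⟨e1, e2, e3⟩ := e
    simp only [Finset.mem_insert, Finset.mem_singleton, Prod.mk.injEq] at *
    rcases hve with ⟨-, h1 | h1, h2, h3⟩ | ⟨-, -, h1, h2 | h2, h3⟩ | ⟨h1, h2, h3, h4, h5⟩
    · exact Or.inl ⟨by omega, by omega, by omega⟩
    · exact Or.inr (Or.inl ⟨by omega, by omega, by omega⟩)
    · exact Or.inr (Or.inr (Or.inl ⟨by omega, by omega, by omega⟩))
    · exact Or.inr (Or.inr (Or.inr (Or.inl ⟨by omega, by omega, by omega⟩)))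
    · have hodd3 : e3 % 2 = 1 := by omega
      clear hep
      by_cases hv : v.2.2 = 1 ∨ v.2.2 = R
      · simp only [if_pos hv]
        exact Or.inr (Or.inr (Or.inr (Or.inr (Or.inl ⟨by omega, by omega, by omega⟩))))
      · simp only [if_neg hv]
        have : e3 = v.2.2 + 1 ∨ e3 = v.2.2 - 1 := by omega
        rcases this with h | h
        · exact Or.inr (Or.inr (Or.inr (Or.inr (Or.inl ⟨by omega, by omega, h⟩))))
        · exact Or.inr (Or.inr (Or.inr (Or.inr (Or.inr ⟨by omega, by omega, h⟩))))
  obtain ⟨a, b, hsub⟩ := hsub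
  exact (Finset.card_le_card hsub).trans Finset.card_le_six

/-- In an even layer, all qubits next to a box vertex are edges. In an outer layer, `v.1 < v.2.1`
with both even leaves a gap of at least two, so every adjacent qubit still satisfies `1 + u₁ ≤ u₂`.
Only the sides and the triangles remain. -/
theorem primal_external (hodd : Odd R) (hR : 3 ≤ R) {e v : Site} (he : e ∈ (primalGraph d R).edges)
    (hve : v ∈ (primalGraph d R).ends e) (hv : v ∉ (primalGraph d R).internal) :
    v.1 = 0 ∨ v.1 = 2 * d ∨ ((v.2.2 = 1 ∨ v.2.2 = R) ∧ v.2.1 ≤ v.1) := by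
  have hR2 : (R : ℤ) % 2 = 1 := Int.odd_iff.mp (by exact_mod_cast hodd)
  obtain ⟨heq, hep⟩ := mem_primalGraph_edges hodd he
  have hbox := (mem_qubits.mp heq).1
  change v ∈ primalEnds R e at hve
  rw [mem_primalEnds] at hve
  have hpar : v.1 % 2 = 0 ∧ v.2.1 % 2 = 0 ∧ (v.2.2 % 2 = 0 ∨ v.2.2 = 1 ∨ v.2.2 = R) ∧
      (0 ≤ v.1 ∧ v.1 ≤ 2 * d) ∧ (0 ≤ v.2.1 ∧ v.2.1 ≤ 2 * d - 2) ∧ 1 ≤ v.2.2 ∧ v.2.2 ≤ R := by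
    rcases hve with h | h | ⟨h1, h2, h3, h4, h5⟩
    · clear heq he hv
      omega
    · clear heq he hv
      omega
    · have hodd3 : e.2.2 % 2 = 1 := by omega
      clear hep
      refine ⟨by omega, by omega, by omega, by omega, by omega, by omega, by omega⟩
  obtain ⟨h1, h2, h3, h4, h5, h6⟩ := hpar
  by_contra hcon
  apply hv
  clear hve hep hbox
  rw [mem_primalInternal, mem_box]
  refine ⟨⟨by omega, h5, h6⟩, h1, h2, h3, fun u hu => ?_⟩
  rw [mem_neigh, siteDist_eq_one_iff_natAbs] at hu
  have hu1 := (mem_qubits.mp hu.1).2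
  rw [mem_primalEdges hodd]
  refine ⟨hu.1, ?_⟩
  replace hu := hu.2
  rcases Int.emod_two_eq_zero_or_one v.2.2 with h7 | h7
  · left
    clear hcon hu1
    omega
  · right
    have h8 : u.2.2 = v.2.2 := by omega
    refine ⟨by omega, by omega, by omega⟩

theorem primal_ends_dist (e : Site) (_he : e ∈ (primalGraph d R).edges) (v w : Site)
    (h : (primalGraph d R).ends e = s(v, w)) :
    (v.1 - w.1).natAbs + (v.2.1 - w.2.1).natAbs + (v.2.2 - w.2.2).natAbs ≤ 2 := by
  have hv : v ∈ primalEnds R e := by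
    change primalEnds R e = _ at h
    rw [h]; simp
  have hw : w ∈ primalEnds R e := by
    change primalEnds R e = _ at h
    rw [h]; simp
  rw [mem_primalEnds] at hv hw
  rcases hv with hv | hv | hv <;> rcases hw with hw | hw | hw <;> omega

/-- The edges at which a trail of length `n` may start. -/
def primalStarts (d R n : ℕ) : Finset Site :=
  (recoveryX d R).filter fun u => d ≤ n ∨ (u.2.1 ≤ 2 * n ∧ NearEnds R n u)

/-- This is where independence of `R` comes from. Each edge moves by at most two, so reaching the
right side takes at least `d` edges. Reaching a triangle from `(2, u₂, u₃)` requires closing the gap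
`u₂ - 2` to the diagonal and the distance to an outer layer, so the start is near `q₁` or `q₂`. -/
theorem primal_mem_starts (hodd : Odd R) (hR : 3 ≤ R) : ∀ l ∈ (primalGraph d R).edges,
    ∀ (o w : Site) (es : List Site) (x : Site), (primalGraph d R).ends l = s(o, w) → o.1 = 0 →
      (primalGraph d R).Trail w es x → ¬ x.1 = 0 → l ∈ primalStarts d R (es.length + 1) := by
  intro l hl o w es x how ho ht hx
  have heL := (mem_recoveryX_iff_ends hodd l hl).mpr ⟨o, by rw [how]; simp, ho⟩
  obtain ⟨hw, -⟩ := primal_inner hodd l hl o w how ho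
  obtain ⟨e, he, hxe⟩ := ht.exists_mem_ends ⟨l, hl, by rw [how]; simp⟩
  have hext := primal_external hodd hR he hxe ht.not_mem_internal
  have hdist := ht.dist_le primal_ends_dist
  have h1 := (mem_recoveryX.mp heL).2.1
  rw [primalStarts, Finset.mem_filter]
  refine ⟨heL, ?_⟩
  rw [hw] at hdist
  simp only [NearEnds] at hdist ⊢
  push_cast
  rcases hext with h | h | ⟨h3 | h3, h⟩
  · exact absurd h hx
  · left; omega
  · right
    exact ⟨by omega, Or.inl (by omega)⟩
  · right
    exact ⟨by omega, Or.inr (by omega)⟩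

/-- On the recovery set `u₁ = 1` and `u₂` is even, so `u₂ / 2` and `u₃` determine the edge. Long
trails may start anywhere, hence `d * R`. -/
theorem card_primalStarts_le (n : ℕ) :
    (primalStarts d R n).card ≤ 4 * n * (n + 1) + if d ≤ n then d * R else 0 := by
  by_cases hdn : d ≤ n
  · rw [if_pos hdn]
    refine le_trans ?_ (Nat.le_add_left _ _)
    have : (Finset.Icc (0 : ℤ) (d - 1) ×ˢ Finset.Icc (1 : ℤ) R).card = d * R := by
      rw [Finset.card_product, Int.card_Icc, Int.card_Icc]
      congr 1 <;> omega
    rw [← this]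
    refine Finset.card_le_card_of_injOn (fun u => (u.2.1 / 2, u.2.2)) ?_ ?_
    · intro u hu
      obtain ⟨h1, h2, h3, -⟩ := mem_recoveryX.mp (Finset.mem_filter.mp hu).1
      have := (mem_qubits.mp h1).1.2
      simp only [Finset.coe_product, Finset.coe_Icc, Set.mem_prod, Set.mem_Icc]
      omega
    · intro u hu u' hu' h
      obtain ⟨-, h2, h3, -⟩ := mem_recoveryX.mp (Finset.mem_filter.mp hu).1
      obtain ⟨-, h2', h3', -⟩ := mem_recoveryX.mp (Finset.mem_filter.mp hu').1
      simp only [Prod.mk.injEq] at h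
      refine Prod.ext (by omega) (Prod.ext (by omega) h.2)
  · rw [if_neg hdn, add_zero]
    refine le_trans ?_ (card_nearEnds_le (R := R) n)
    refine Finset.card_le_card_of_injOn (fun u => (u.2.1 / 2, u.2.2)) ?_ ?_
    · intro u hu
      obtain ⟨hu, h⟩ := Finset.mem_filter.mp hu
      obtain ⟨h1, h2, h3, -⟩ := mem_recoveryX.mp hu
      have := (mem_qubits.mp h1).1.2
      obtain ⟨h4, h5⟩ := h.resolve_left hdn
      simp only [NearEnds] at h5
      simp only [Finset.coe_product, Finset.coe_union, Finset.coe_Icc, Set.mem_prod, Set.mem_union,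
        Set.mem_Icc]
      omega
    · intro u hu u' hu' h
      obtain ⟨-, h2, h3, -⟩ := mem_recoveryX.mp (Finset.mem_filter.mp hu).1
      obtain ⟨-, h2', h3', -⟩ := mem_recoveryX.mp (Finset.mem_filter.mp hu').1
      simp only [Prod.mk.injEq] at h
      refine Prod.ext (by omega) (Prod.ext (by omega) h.2)

/-! #### The dual decoding graph -/

theorem dual_loopless : ∀ e ∈ (dualGraph d R).edges, ¬ ((dualGraph d R).ends e).IsDiag := by
  intro e _
  change ¬ (dualEnds e).IsDiag
  unfold dualEnds
  split_ifs <;> simp only [Sym2.mk_isDiag_iff, Prod.mk.injEq] <;> omega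

theorem dual_internal_ne : ∀ v ∈ (dualGraph d R).internal, ¬ v.2.1 = -1 := by
  intro v hv
  have := mem_box.mp (mem_dualInternal.mp hv).1
  omega

theorem mem_recoveryZ_iff_ends (hodd : Odd R) : ∀ e ∈ (dualGraph d R).edges,
    (e ∈ recoveryZ d R ↔ ∃ o ∈ (dualGraph d R).ends e, o.2.1 = -1) := by
  intro e he
  obtain ⟨heq, hq1, hq2, hep, -⟩ := (mem_dualEdges hodd).mp he
  have hbox := (mem_qubits.mp heq).1.2.1
  rw [mem_recoveryZ]
  change _ ↔ ∃ o ∈ dualEnds e, o.2.1 = -1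
  simp only [mem_dualEnds]
  constructor
  · rintro ⟨-, h1, h2, -⟩
    exact ⟨(e.1, -1, e.2.2), Or.inr (Or.inl ⟨h1, by omega, rfl, Or.inl (by simp [h2]), rfl⟩), rfl⟩
  · rintro ⟨o, h | h | h, ho⟩
    · omega
    · exact ⟨⟨heq, hq1, hq2⟩, by omega, by omega, by omega⟩
    · omega

theorem dual_inner (hodd : Odd R) : ∀ e ∈ (dualGraph d R).edges, ∀ o w : Site,
    (dualGraph d R).ends e = s(o, w) → o.2.1 = -1 →
      w = (e.1, e.2.1 + 1, e.2.2) ∧ ¬ w.2.1 = -1 := by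
  intro e he o w how ho
  have heL := (mem_recoveryZ_iff_ends hodd e he).mpr ⟨o, by rw [how]; simp, ho⟩
  obtain ⟨-, h1, h2, -⟩ := mem_recoveryZ.mp heL
  change dualEnds e = _ at how
  rw [dualEnds, if_neg (by rw [Int.even_iff]; omega), if_pos (by rw [h2]; decide),
    Sym2.eq_iff] at how
  rcases how with ⟨rfl, rfl⟩ | ⟨h, rfl⟩
  · exact ⟨rfl, by simp only; omega⟩
  · exfalso
    simp only at ho
    omega

theorem dual_degree_le (v : Site) : ((dualGraph d R).incident v).card ≤ 6 := by
  have hsub : (dualGraph d R).incident v ⊆ {(v.1 + 1, v.2.1, v.2.2),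
      (v.1 - 1, v.2.1, v.2.2), (v.1, v.2.1 + 1, v.2.2), (v.1, v.2.1 - 1, v.2.2),
      (v.1, v.2.1, v.2.2 + 1), (v.1, v.2.1, v.2.2 - 1)} := fun e he => by
    have hve := (Finset.mem_filter.mp he).2
    change v ∈ dualEnds e at hve
    rw [mem_dualEnds] at hve
    obtain ⟨e1, e2, e3⟩ := e
    simp only [Finset.mem_insert, Finset.mem_singleton, Prod.mk.injEq] at *
    rcases hve with ⟨-, h1 | h1, h2, h3⟩ | ⟨-, -, h1, h2 | h2, h3⟩ | ⟨-, -, h1, h2, h3 | h3⟩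
    · exact Or.inl ⟨by omega, by omega, by omega⟩
    · exact Or.inr (Or.inl ⟨by omega, by omega, by omega⟩)
    · exact Or.inr (Or.inr (Or.inl ⟨by omega, by omega, by omega⟩))
    · exact Or.inr (Or.inr (Or.inr (Or.inl ⟨by omega, by omega, by omega⟩)))
    · exact Or.inr (Or.inr (Or.inr (Or.inr (Or.inl ⟨by omega, by omega, by omega⟩))))
    · exact Or.inr (Or.inr (Or.inr (Or.inr (Or.inr ⟨by omega, by omega, by omega⟩))))
  exact (Finset.card_le_card hsub).trans Finset.card_le_six

/-- The mirror image of the primal case: below the diagonal, with both coordinates odd, the gap of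
at least two keeps every adjacent qubit on the `Z`-measured side. -/
theorem dual_external (hodd : Odd R) {e v : Site} (he : e ∈ (dualGraph d R).edges)
    (hve : v ∈ (dualGraph d R).ends e) (hv : v ∉ (dualGraph d R).internal) :
    v.2.1 = -1 ∨ v.2.1 = 2 * d - 1 ∨ ((v.2.2 = 1 ∨ v.2.2 = R) ∧ v.1 ≤ v.2.1) := by
  have hR2 : (R : ℤ) % 2 = 1 := Int.odd_iff.mp (by exact_mod_cast hodd)
  obtain ⟨heq, -, -, hep, -⟩ := (mem_dualEdges hodd).mp he
  have hbox := (mem_qubits.mp heq).1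
  change v ∈ dualEnds e at hve
  rw [mem_dualEnds] at hve
  have hpar : v.1 % 2 = 1 ∧ v.2.1 % 2 = 1 ∧ v.2.2 % 2 = 1 ∧
      (1 ≤ v.1 ∧ v.1 ≤ 2 * d - 1) ∧ (-1 ≤ v.2.1 ∧ v.2.1 ≤ 2 * d - 1) ∧ 1 ≤ v.2.2 ∧ v.2.2 ≤ R := by
    clear heq he hv
    rcases hve with h | h | h
    · omega
    · omega
    · omega
  obtain ⟨h1, h2, h3, h4, h5, h6⟩ := hpar
  by_contra hcon
  apply hv
  clear hve hep hbox
  rw [mem_dualInternal, mem_box]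
  refine ⟨⟨h4, by omega, h6⟩, h1, h2, h3, fun u hu => ?_⟩
  rw [mem_neigh, siteDist_eq_one_iff_natAbs] at hu
  rw [mem_dualEdges hodd]
  obtain ⟨huq, hu⟩ := hu
  have hlt : (u.2.2 = 1 ∨ u.2.2 = R) → u.2.1 < 1 + u.1 := by
    intro h7
    have h8 : u.2.2 = v.2.2 := by omega
    omega
  refine ⟨huq, ?_, ?_, ?_, hlt⟩
  -- The only all-odd sites next to `q₁` are `(1, ±1, 1)`: one is on the bottom side, the other on
  -- the diagonal, and `hcon` excludes both.
  · rintro rfl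
    simp only [q₁] at hu
    clear hlt
    omega
  · rintro rfl
    simp only [q₂] at hu
    clear hlt
    omega
  · clear hlt hcon
    omega

theorem dual_ends_dist (e : Site) (_he : e ∈ (dualGraph d R).edges) (v w : Site)
    (h : (dualGraph d R).ends e = s(v, w)) :
    (v.1 - w.1).natAbs + (v.2.1 - w.2.1).natAbs + (v.2.2 - w.2.2).natAbs ≤ 2 := by
  have hv : v ∈ dualEnds e := by
    change dualEnds e = _ at h
    rw [h]; simp
  have hw : w ∈ dualEnds e := by
    change dualEnds e = _ at h
    rw [h]; simp
  rw [mem_dualEnds] at hv hw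
  rcases hv with hv | hv | hv <;> rcases hw with hw | hw | hw <;> omega

/-- The edges at which a trail of length `n` may start. -/
def dualStarts (d R n : ℕ) : Finset Site :=
  (recoveryZ d R).filter fun u => d ≤ n ∨ (u.1 ≤ 2 * n ∧ NearEnds R n u)

theorem dual_mem_starts (hodd : Odd R) : ∀ l ∈ (dualGraph d R).edges,
    ∀ (o w : Site) (es : List Site) (x : Site), (dualGraph d R).ends l = s(o, w) → o.2.1 = -1 →
      (dualGraph d R).Trail w es x → ¬ x.2.1 = -1 → l ∈ dualStarts d R (es.length + 1) := by
  intro l hl o w es x how ho ht hx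
  have heL := (mem_recoveryZ_iff_ends hodd l hl).mpr ⟨o, by rw [how]; simp, ho⟩
  obtain ⟨hw, -⟩ := dual_inner hodd l hl o w how ho
  obtain ⟨e, he, hxe⟩ := ht.exists_mem_ends ⟨l, hl, by rw [how]; simp⟩
  have hext := dual_external hodd he hxe ht.not_mem_internal
  have hdist := ht.dist_le dual_ends_dist
  have h1 := (mem_recoveryZ.mp heL).2.2.1
  rw [dualStarts, Finset.mem_filter]
  refine ⟨heL, ?_⟩
  rw [hw] at hdist
  simp only [NearEnds] at hdist ⊢
  push_cast
  rcases hext with h | h | ⟨h3 | h3, h⟩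
  · exact absurd h hx
  · left; omega
  · right
    exact ⟨by omega, Or.inl (by omega)⟩
  · right
    exact ⟨by omega, Or.inr (by omega)⟩

theorem card_dualStarts_le (n : ℕ) :
    (dualStarts d R n).card ≤ 4 * n * (n + 1) + if d ≤ n then d * R else 0 := by
  by_cases hdn : d ≤ n
  · rw [if_pos hdn]
    refine le_trans ?_ (Nat.le_add_left _ _)
    have : (Finset.Icc (0 : ℤ) (d - 1) ×ˢ Finset.Icc (1 : ℤ) R).card = d * R := by
      rw [Finset.card_product, Int.card_Icc, Int.card_Icc]
      congr 1 <;> omega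
    rw [← this]
    refine Finset.card_le_card_of_injOn (fun u => (u.1 / 2, u.2.2)) ?_ ?_
    · intro u hu
      obtain ⟨⟨h1, -⟩, h2, h3, -⟩ := mem_recoveryZ.mp (Finset.mem_filter.mp hu).1
      have := (mem_qubits.mp h1).1
      simp only [Finset.coe_product, Finset.coe_Icc, Set.mem_prod, Set.mem_Icc]
      omega
    · intro u hu u' hu' h
      obtain ⟨-, h2, h3, -⟩ := mem_recoveryZ.mp (Finset.mem_filter.mp hu).1
      obtain ⟨-, h2', h3', -⟩ := mem_recoveryZ.mp (Finset.mem_filter.mp hu').1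
      simp only [Prod.mk.injEq] at h
      refine Prod.ext (by omega) (Prod.ext (by omega) h.2)
  · rw [if_neg hdn, add_zero]
    refine le_trans ?_ (card_nearEnds_le (R := R) n)
    refine Finset.card_le_card_of_injOn (fun u => (u.1 / 2, u.2.2)) ?_ ?_
    · intro u hu
      obtain ⟨hu, h⟩ := Finset.mem_filter.mp hu
      obtain ⟨⟨h1, -⟩, h2, h3, -⟩ := mem_recoveryZ.mp hu
      have := (mem_qubits.mp h1).1
      obtain ⟨h4, h5⟩ := h.resolve_left hdn
      simp only [NearEnds] at h5
      simp only [Finset.coe_product, Finset.coe_union, Finset.coe_Icc, Set.mem_prod, Set.mem_union,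
        Set.mem_Icc]
      omega
    · intro u hu u' hu' h
      obtain ⟨-, h2, h3, -⟩ := mem_recoveryZ.mp (Finset.mem_filter.mp hu).1
      obtain ⟨-, h2', h3', -⟩ := mem_recoveryZ.mp (Finset.mem_filter.mp hu').1
      simp only [Prod.mk.injEq] at h
      refine Prod.ext (by omega) (Prod.ext (by omega) h.2)

end Geometry

/-! ### Numerical estimates -/

/-- Telescoping; truncated subtraction gives exponent `0` while `N + 1 ≤ d`, when the sum is still
empty. -/
theorem sum_geometric_shift (y : ℝ) (d N : ℕ) (hd : 1 ≤ d) :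
    (1 - y) * ∑ n ∈ Finset.range N, (if d ≤ n + 1 then y ^ (n + 1 - d) else 0) =
      1 - y ^ (N + 1 - d) := by
  induction N with
  | zero =>
    rw [Finset.sum_range_zero, show 0 + 1 - d = 0 by omega]
    simp
  | succ N ih =>
    rw [Finset.sum_range_succ, mul_add, ih]
    split_ifs with h
    · rw [show N + 1 + 1 - d = (N + 1 - d) + 1 by omega, pow_succ]
      ring
    · rw [show N + 1 + 1 - d = 0 by omega, show N + 1 - d = 0 by omega]
      simp

theorem mul_succ_le_pow (n : ℕ) : (n + 2) * (n + 3) ≤ 6 * 2 ^ n := by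
  induction n with
  | zero => norm_num
  | succ n ih =>
    rw [pow_succ]
    nlinarith

/-- With `x = 10√p`, a trail of `n + 1` edges with a fixed start contributes at most `x^(n+1)/5`.
Quadratically many starts are absorbed by `2^n`, and `x ≤ 3/20` makes both resulting series
geometric; the factor `x² = 100p` makes the total linear in `p`. -/
theorem sum_trails_le {d K : ℕ} (hd : 2 ≤ d) {p : ℝ} (hp0 : 0 ≤ p) (hp : p ≤ 1 / 4806) {c : ℕ → ℕ}
    (hc : ∀ n, c n ≤ 4 * n * (n + 1) + if d ≤ n then K else 0) (N : ℕ) :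
    ∑ n ∈ Finset.range N, (c (n + 1) : ℝ) * (5 ^ n * (2 ^ (n + 1) * p ^ ((n + 2) / 2))) ≤
      2402 * p + 100 * K * (10 * Real.sqrt p) ^ (d - 2) * p := by
  set x := 10 * Real.sqrt p with hx
  have hx0 : 0 ≤ x := by positivity
  have hx2 : x ^ 2 = 100 * p := by
    rw [hx, mul_pow, Real.sq_sqrt hp0]
    norm_num
  have hx1 : x ≤ 3 / 20 := by
    refine abs_le_of_sq_le_sq' ?_ (by norm_num) |>.2
    rw [hx2]
    linarith
  have hs1 : Real.sqrt p ≤ 1 := by linarith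
  -- The exponent is `⌈(n+1)/2⌉`, so rounding up only helps.
  have hpow : ∀ n, (5 : ℝ) ^ n * (2 ^ (n + 1) * p ^ ((n + 2) / 2)) ≤ 1 / 5 * x ^ (n + 1) := by
    intro n
    have h1 : p ^ ((n + 2) / 2) ≤ Real.sqrt p ^ (n + 1) := by
      conv_lhs => rw [← Real.sq_sqrt hp0]
      rw [← pow_mul]
      exact pow_le_pow_of_le_one (Real.sqrt_nonneg p) hs1 (by omega)
    calc _ ≤ (5 : ℝ) ^ n * (2 ^ (n + 1) * Real.sqrt p ^ (n + 1)) := by gcongr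
      _ = 1 / 5 * x ^ (n + 1) := by
        rw [hx, mul_pow, show (10 : ℝ) = 5 * 2 by norm_num, mul_pow, pow_succ (5 : ℝ)]
        ring
  clear_value x
  have hterm : ∀ n, (c (n + 1) : ℝ) * (5 ^ n * (2 ^ (n + 1) * p ^ ((n + 2) / 2))) ≤
      1600 * p * (3 / 10) ^ n +
        K / 5 * x ^ d * (if d ≤ n + 1 then (3 / 20 : ℝ) ^ (n + 1 - d) else 0) := by
    intro n
    have hcn := hc (n + 1)
    -- One-edge trails are separate: the estimate by `x` would give `√p`, whereas the exact cost is
    -- `8 · 2p`. For the others the constant is `(24/5) · 100 = 480 = 1600 · (3/10)`.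
    rcases n with _ | n
    · rw [if_neg (by omega)] at hcn
      rw [if_neg (by omega)]
      have : (c (0 + 1) : ℝ) ≤ 8 := by exact_mod_cast hcn
      simp only [zero_add, pow_zero, one_mul, mul_one, mul_zero, add_zero, pow_one] at this ⊢
      norm_num
      nlinarith
    · have h1 : (c (n + 1 + 1) : ℝ) ≤ 24 * 2 ^ n + if d ≤ n + 1 + 1 then (K : ℝ) else 0 := by
        have := mul_succ_le_pow n
        have h2 : c (n + 1 + 1) ≤ 24 * 2 ^ n + if d ≤ n + 1 + 1 then K else 0 := by
          refine hcn.trans (Nat.add_le_add_right ?_ _)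
          nlinarith
        exact_mod_cast h2
      calc _ ≤ (24 * 2 ^ n + if d ≤ n + 1 + 1 then (K : ℝ) else 0) *
            (1 / 5 * x ^ (n + 1 + 1)) := mul_le_mul h1 (hpow (n + 1)) (by positivity)
              (by split_ifs <;> positivity)
        _ = 24 / 5 * x ^ 2 * (2 * x) ^ n +
            (if d ≤ n + 1 + 1 then (K : ℝ) else 0) * (1 / 5 * x ^ (n + 1 + 1)) := by
            rw [mul_pow]; ring
        _ ≤ _ := by
            refine add_le_add ?_ ?_
            · rw [hx2, pow_succ (3 / 10 : ℝ)]
              have : (2 * x) ^ n ≤ (3 / 10) ^ n :=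
                pow_le_pow_left₀ (by positivity) (by linarith) n
              nlinarith
            · split_ifs with h
              · have h3 : x ^ (n + 1 + 1) = x ^ d * x ^ (n + 1 + 1 - d) := by
                  rw [← pow_add]
                  congr 1
                  omega
                have h4 : x ^ (n + 1 + 1 - d) ≤ (3 / 20) ^ (n + 1 + 1 - d) :=
                  pow_le_pow_left₀ hx0 hx1 _
                rw [h3]
                have h5 : 0 ≤ (K : ℝ) / 5 * x ^ d := by positivity
                nlinarith
              · simp
  refine (Finset.sum_le_sum fun n _ => hterm n).trans ?_
  rw [Finset.sum_add_distrib, ← Finset.mul_sum, ← Finset.mul_sum]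
  have hg1 : ∑ n ∈ Finset.range N, (3 / 10 : ℝ) ^ n ≤ 10 / 7 := by
    rw [geom_sum_eq (by norm_num)]
    have : (0 : ℝ) ≤ (3 / 10) ^ N := by positivity
    rw [div_le_iff_of_neg (by norm_num)]
    linarith
  have hg2 := sum_geometric_shift (3 / 20) d N (by omega)
  have hg3 : ∑ n ∈ Finset.range N, (if d ≤ n + 1 then (3 / 20 : ℝ) ^ (n + 1 - d) else 0) ≤ 5 := by
    have : (0 : ℝ) ≤ (3 / 20) ^ (N + 1 - d) := by positivity
    linarith
  have hxd : x ^ d = x ^ (d - 2) * (100 * p) := by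
    rw [← hx2, ← pow_add]
    congr 1
    omega
  refine add_le_add ?_ ?_
  · nlinarith
  · rw [hxd]
    have h5 : 0 ≤ (K : ℝ) * x ^ (d - 2) * p := by positivity
    calc _ ≤ (K : ℝ) / 5 * (x ^ (d - 2) * (100 * p)) * 5 := by gcongr
      _ = _ := by ring

/-! ### Failure of decoding -/

section Failure

variable {d R : ℕ}

/-- The probabilities of the errors. -/
abbrev errorWeight (μ : PMF (Pauli (Qubit d R))) : Pauli (Qubit d R) → ℝ := fun E => (μ E).toReal

theorem errorWeight_nonneg (μ : PMF (Pauli (Qubit d R))) (E : Pauli (Qubit d R)) :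
    0 ≤ errorWeight μ E := ENNReal.toReal_nonneg

theorem weight_support_le {p : ℝ} {μ : PMF (Pauli (Qubit d R))} (hμ : IsLocalStochastic p μ)
    (F : Finset (Qubit d R)) : weight (errorWeight μ) (fun E => F ⊆ E.support) ≤ p ^ F.card := by
  refine le_trans (le_of_eq ?_) (hμ F)
  refine Finset.sum_congr rfl fun E _ => ?_
  congr

theorem mem_ones {s : Outcome d R} {u : Site} : u ∈ ones s ↔ ∃ c, s c = 1 ∧ c.1.1 = u := by
  simp [ones]

/-- A flipped outcome requires a nontrivial error on that very qubit, so the flips inherit the local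
stochastic bound with the same strength. Sets containing non-qubits give an empty event. -/
theorem weight_flips_le {p : ℝ} (hp : 0 ≤ p) {μ : PMF (Pauli (Qubit d R))}
    (hμ : IsLocalStochastic p μ) (Λ F : Finset Site) :
    weight (errorWeight μ) (fun E => F ⊆ ones (flips E) ∩ Λ) ≤ p ^ F.card := by
  set F' : Finset (Qubit d R) := Finset.univ.filter fun c => c.1 ∈ F with hF'
  by_cases hF : F ⊆ qubits d R
  · have hcard : F'.card = F.card := by
      have : F'.image Subtype.val = F := by
        ext u
        simp only [hF', Finset.mem_image, Finset.mem_filter, Finset.mem_univ, true_and]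
        constructor
        · rintro ⟨c, hc, rfl⟩
          exact hc
        · exact fun hu => ⟨⟨u, hF hu⟩, hu, rfl⟩
      rw [← this, Finset.card_image_of_injective _ Subtype.val_injective]
    rw [← hcard]
    refine (weight_mono (errorWeight_nonneg μ) fun E hE => ?_).trans (weight_support_le hμ F')
    intro c hc
    have hc' := (Finset.mem_inter.mp (hE (Finset.mem_filter.mp hc).2)).1
    obtain ⟨c', h1, h2⟩ := mem_ones.mp hc'
    obtain rfl : c'.1 = c := Subtype.ext h2
    rw [Pauli.support, Finset.mem_filter]
    refine ⟨Finset.mem_univ _, ?_⟩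
    simp only [flips] at h1
    split_ifs at h1 with h
    · right; rw [h1]; exact one_ne_zero
    · left; rw [h1]; exact one_ne_zero
  · refine (Finset.sum_nonpos fun E _ => ?_).trans (pow_nonneg hp _)
    rw [if_neg]
    intro hE
    apply hF
    intro u hu
    obtain ⟨c, -, rfl⟩ := mem_ones.mp (Finset.mem_inter.mp (hE hu)).1
    exact c.1.2

theorem weight_primal_failure_le (hd : 2 ≤ d) (hR : 3 ≤ R) (hodd : Odd R) {p : ℝ} (hp0 : 0 ≤ p)
    (hp : p ≤ 1 / 4806) {μ : PMF (Pauli (Qubit d R))} (hμ : IsLocalStochastic p μ)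
    {f : Finset Site → Finset Site} (hf : (primalGraph d R).IsMinMatchFun f) :
    weight (errorWeight μ) (fun E =>
      parity (ones (flips E) ∩ primalEdges d R) (recoveryX d R) +
        parity (f ((primalGraph d R).boundary (ones (flips E) ∩ primalEdges d R)))
          (recoveryX d R) ≠ 0) ≤
      2402 * p + 100 * (d * R : ℕ) * (10 * Real.sqrt p) ^ (d - 2) * p :=
  (weight_failure_le (O := fun v : Site => v.1 = 0) primal_loopless primal_internal_ne_zero
    (mem_recoveryX_iff_ends hodd) (fun e => (e.1 + 1, e.2.1, e.2.2)) (primal_inner hodd)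
    (primal_degree_le hodd hR) (primalStarts d R) (primal_mem_starts hodd hR)
    (errorWeight_nonneg μ) hp0 (by linarith) (weight_flips_le hp0 hμ (primalEdges d R))
    (fun _ => Finset.inter_subset_right) hf).trans
  (sum_trails_le hd hp0 hp card_primalStarts_le _)

theorem weight_dual_failure_le (hd : 2 ≤ d) (hodd : Odd R) {p : ℝ} (hp0 : 0 ≤ p)
    (hp : p ≤ 1 / 4806) {μ : PMF (Pauli (Qubit d R))} (hμ : IsLocalStochastic p μ)
    {g : Finset Site → Finset Site} (hg : (dualGraph d R).IsMinMatchFun g) :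
    weight (errorWeight μ) (fun E =>
      parity (ones (flips E) ∩ dualEdges d R) (recoveryZ d R) +
        parity (g ((dualGraph d R).boundary (ones (flips E) ∩ dualEdges d R)))
          (recoveryZ d R) ≠ 0) ≤
      2402 * p + 100 * (d * R : ℕ) * (10 * Real.sqrt p) ^ (d - 2) * p :=
  (weight_failure_le (O := fun v : Site => v.2.1 = -1) dual_loopless dual_internal_ne
    (mem_recoveryZ_iff_ends hodd) (fun e => (e.1, e.2.1 + 1, e.2.2)) (dual_inner hodd)
    dual_degree_le (dualStarts d R) (dual_mem_starts hodd)
    (errorWeight_nonneg μ) hp0 (by linarith) (weight_flips_le hp0 hμ (dualEdges d R))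
    (fun _ => Finset.inter_subset_right) hg).trans
  (sum_trails_le hd hp0 hp card_dualStarts_le _)

/-- The errors for which decoding fails. -/
def Fails (hd : 2 ≤ d) (hR : 3 ≤ R) (f g : Finset Site → Finset Site) (E : Pauli (Qubit d R)) :
    Prop :=
  ({⟨q₁, q₁_mem hd hR⟩} ⊆ E.support ∨ {⟨q₂ R, q₂_mem hd hR⟩} ⊆ E.support) ∨
  parity (ones (flips E) ∩ primalEdges d R) (recoveryX d R) +
    parity (f ((primalGraph d R).boundary (ones (flips E) ∩ primalEdges d R)))
      (recoveryX d R) ≠ 0 ∨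
  parity (ones (flips E) ∩ dualEdges d R) (recoveryZ d R) +
    parity (g ((dualGraph d R).boundary (ones (flips E) ∩ dualEdges d R)))
      (recoveryZ d R) ≠ 0

/-- The constant is `4806 = 2 + 2 · 2402`: one `p` for each unmeasured qubit and `2402 p` for each
decoding graph. -/
theorem weight_fails_le (hd : 2 ≤ d) (hR : 3 ≤ R) (hodd : Odd R) {p : ℝ} (hp0 : 0 ≤ p)
    (hp : p ≤ 1 / 4806) {μ : PMF (Pauli (Qubit d R))} (hμ : IsLocalStochastic p μ)
    {f g : Finset Site → Finset Site} (hf : (primalGraph d R).IsMinMatchFun f)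
    (hg : (dualGraph d R).IsMinMatchFun g) :
    weight (errorWeight μ) (Fails hd hR f g) ≤
      (4806 + 200 * (d : ℝ) * (R : ℝ) * (10 * Real.sqrt p) ^ (d - 2)) * p := by
  have hw := errorWeight_nonneg μ
  have h1 := weight_support_le hμ {⟨q₁, q₁_mem hd hR⟩}
  have h2 := weight_support_le hμ {⟨q₂ R, q₂_mem hd hR⟩}
  have h3 := weight_primal_failure_le hd hR hodd hp0 hp hμ hf
  have h4 := weight_dual_failure_le hd hodd hp0 hp hμ hg
  rw [Finset.card_singleton, pow_one] at h1 h2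
  push_cast at h3 h4
  refine (weight_or_le hw _ _).trans ((add_le_add (weight_or_le hw _ _)
    (weight_or_le hw _ _)).trans ?_)
  linarith

end Failure

/-! ### The output of the protocol -/

section Output

variable {d R : ℕ}

theorem normSq_smul {ι : Type} [Fintype ι] [DecidableEq ι] (a : ℂ) (ψ : State ι) :
    normSq (a • ψ) = ‖a‖ ^ 2 * normSq ψ := by
  simp [normSq, mul_pow, Finset.mul_sum]

theorem normSq_bell (α β : ZMod 2) : normSq (bell α β) = 1 := by
  have h2 : ∀ f : ZMod 2 → ℝ, ∑ t, f t = f 0 + f 1 := fun f => Fin.sum_univ_two f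
  rw [bell, pauliZ_pauliX, normSq_smul, norm_sgn, one_pow, one_mul, isIsom_pauliXZ, normSq,
    ← Equiv.sum_comp (finTwoArrowEquiv (ZMod 2)).symm, Fintype.sum_prod_type]
  simp only [h2, bellPhi, finTwoArrowEquiv_symm_apply, Matrix.cons_val_zero, Matrix.cons_val_one,
    if_true, zero_ne_one, one_ne_zero, if_false, norm_zero]
  rw [norm_div, norm_one, Complex.norm_real, Real.norm_of_nonneg (Real.sqrt_nonneg 2), div_pow,
    Real.sq_sqrt zero_le_two]
  norm_num

theorem SameState.trans {ι : Type} [Fintype ι] [DecidableEq ι] {ψ φ χ : State ι}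
    (h : SameState ψ φ) (h' : SameState φ χ) : SameState ψ χ := by
  obtain ⟨a, ha, rfl⟩ := h
  obtain ⟨b, hb, rfl⟩ := h'
  exact ⟨a * b, by rw [norm_mul, ha, hb, one_mul], (smul_smul _ _ _)⟩

theorem SameState.symm {ι : Type} [Fintype ι] [DecidableEq ι] {ψ φ : State ι}
    (h : SameState ψ φ) : SameState φ ψ := by
  obtain ⟨a, ha, rfl⟩ := h
  have ha0 : a ≠ 0 := by rintro rfl; simp at ha
  exact ⟨a⁻¹, by rw [norm_inv, ha, inv_one], by rw [smul_smul, inv_mul_cancel₀ ha0, one_smul]⟩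

theorem outcomeProb_eq (E : Pauli (Qubit d R)) (s : Outcome d R) :
    outcomeProb E s = normSq (postVec E s) := rfl

theorem outcomeProb_nonneg (E : Pauli (Qubit d R)) (s : Outcome d R) : 0 ≤ outcomeProb E s :=
  Finset.sum_nonneg fun _ _ => by positivity

/-- An outcome that occurs has nonzero noiseless amplitude at `s + flips E`, so the constraints hold
there. Both the true Bell label and the shift due to errors on `q₁`, `q₂` can then be read off. -/
theorem postState_of_ne_zero (hd : 2 ≤ d) (hR : 3 ≤ R) (hodd : Odd R) (E : Pauli (Qubit d R))
    (s : Outcome d R) (h : outcomeProb E s ≠ 0) :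
    amplitude (s + flips E) ≠ 0 ∧ SameState (postState E s)
      (bell (parity (ones (s + flips E)) (recoveryX d R) + restr hd hR E.2.2 0 +
        restr hd hR E.2.2 1) (parity (ones (s + flips E)) (recoveryZ d R) + restr hd hR E.2.1 0 +
        restr hd hR E.2.1 1)) := by
  obtain ⟨a, ha, hpost⟩ := postVec_eq hd hR E s
  obtain ⟨c, hc⟩ := amplitude_eq_smul_bell hd hR hodd (s + flips E)
  have hne : amplitude (s + flips E) ≠ 0 := by
    intro h0
    apply h
    rw [outcomeProb_eq, hpost, h0, map_zero, smul_zero]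
    simp [normSq]
  refine ⟨hne, ?_⟩
  rw [hc, map_smul, pauliXZ_bell, smul_smul, smul_smul] at hpost
  clear hc
  generalize a * c * sgn _ = k at hpost
  have hprob : outcomeProb E s = ‖k‖ ^ 2 := by
    rw [outcomeProb_eq, hpost, normSq_smul, normSq_bell, mul_one]
  have hk0 : ‖k‖ ≠ 0 := by
    intro h0
    rw [hprob, h0] at h
    simp at h
  refine ⟨((1 / Real.sqrt (outcomeProb E s) : ℝ) : ℂ) * k, ?_, ?_⟩
  · rw [norm_mul, Complex.norm_real, hprob, Real.sqrt_sq (norm_nonneg _), norm_div, norm_one,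
      norm_norm, one_div, inv_mul_cancel₀ hk0]
  · rw [postState, hpost, smul_smul]

/-- On a Bell state, a correction on `q₁` acts like the same correction on `q₂`, up to sign. -/
theorem outputState_of_postState {f g : Finset Site → Finset Site} {E : Pauli (Qubit d R)}
    {s : Outcome d R} {α β : ZMod 2} (h : SameState (postState E s) (bell α β)) :
    SameState (outputState f g E s) (bell (α + corrX f s) (β + corrZ g s)) := by
  obtain ⟨a, ha, h⟩ := h
  rw [outputState, h, pauliZ_pauliX, map_smul, pauliXZ_bell]
  simp only [smul_smul, Pi.single_eq_same, ne_eq, one_ne_zero, not_false_eq_true,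
    Pi.single_eq_of_ne, add_zero]
  exact ⟨_, by simp [ha], rfl⟩

theorem parity_inter_of_subset {A B C : Finset Site} (h : B ⊆ C) :
    parity (A ∩ C) B = parity A B := by
  rw [parity, parity, Finset.inter_assoc, Finset.inter_eq_right.mpr h]

/-- Parities are additive in the outcome, so when `s + t` has no boundary, `s` and `t` have the same
one. The decoder thus sees only the error. -/
theorem boundary_ones_eq (G : IntGraph Site Site) {s t : Outcome d R}
    (h : ∀ v ∈ G.internal, parity (ones (s + t)) (G.incident v) = 0) :
    G.boundary (ones s ∩ G.edges) = G.boundary (ones t ∩ G.edges) := by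
  ext v
  rw [G.mem_boundary, G.mem_boundary]
  refine and_congr_right fun hv => ?_
  have hinc : G.incident v ⊆ G.edges := Finset.filter_subset _ _
  rw [G.degParity_eq_parity Finset.inter_subset_right,
    G.degParity_eq_parity Finset.inter_subset_right, parity_inter_of_subset hinc,
    parity_inter_of_subset hinc]
  have := h v hv
  rw [parity_ones_add] at this
  rcases zmod_two_cases (parity (ones s) (G.incident v)) with h1 | h1 <;>
    rcases zmod_two_cases (parity (ones t) (G.incident v)) with h2 | h2 <;> simp_all

theorem recoveryX_subset (hodd : Odd R) : recoveryX d R ⊆ primalEdges d R := fun u hu => by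
  obtain ⟨h1, h2, h3, h4⟩ := mem_recoveryX.mp hu
  rw [mem_primalEdges hodd]
  refine ⟨h1, ?_⟩
  rcases h4 with h4 | h4
  · left; omega
  · right; omega

theorem recoveryZ_subset (hodd : Odd R) : recoveryZ d R ⊆ dualEdges d R := fun u hu => by
  obtain ⟨⟨h1, h2, h3⟩, h4, h5, h6⟩ := mem_recoveryZ.mp hu
  rw [mem_dualEdges hodd]
  have := (mem_qubits.mp h1).1.1
  exact ⟨h1, h2, h3, by omega, by omega⟩

theorem eq_of_add_eq_zero {a b : ZMod 2} (h : a + b = 0) : a = b := by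
  revert a b
  decide

/-- Successful decoding means the matching has the parity of `flips E` on each recovery set. Adding
the parity of `s` gives that of `s + flips E`, which is the actual Bell label. -/
theorem postState_of_not_fails (hd : 2 ≤ d) (hR : 3 ≤ R) (hodd : Odd R)
    {f g : Finset Site → Finset Site} {E : Pauli (Qubit d R)} (hE : ¬ Fails hd hR f g E)
    {s : Outcome d R} (h : outcomeProb E s ≠ 0) :
    SameState (postState E s) (bell (corrX f s) (corrZ g s)) := by
  obtain ⟨hne, hpost⟩ := postState_of_ne_zero hd hR hodd E s h
  simp only [Fails, not_or, not_not] at hE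
  obtain ⟨⟨h1, h2⟩, h3, h4⟩ := hE
  rw [Finset.singleton_subset_iff, Pauli.support, Finset.mem_filter] at h1 h2
  simp only [Finset.mem_univ, true_and, not_or, not_not] at h1 h2
  have hX : corrX f s = parity (ones (s + flips E)) (recoveryX d R) := by
    have hb := boundary_ones_eq (primalGraph d R) (s := s) (t := flips E)
      fun v hv => parity_primal_incident hd hR hodd hne hv
    rw [corrX, show primalEdges d R = (primalGraph d R).edges from rfl, hb, parity_ones_add,
      ← parity_inter_of_subset (A := ones (flips E)) (recoveryX_subset hodd)]
    exact congrArg _ (eq_of_add_eq_zero h3).symm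
  have hZ : corrZ g s = parity (ones (s + flips E)) (recoveryZ d R) := by
    have hb := boundary_ones_eq (dualGraph d R) (s := s) (t := flips E)
      fun v hv => parity_dual_incident hd hR hodd hne hv
    rw [corrZ, show dualEdges d R = (dualGraph d R).edges from rfl, hb, parity_ones_add,
      ← parity_inter_of_subset (A := ones (flips E)) (recoveryZ_subset hodd)]
    exact congrArg _ (eq_of_add_eq_zero h4).symm
  rw [hX, hZ]
  simpa [restr, h1, h2] using hpost

/-! ### Total probability and the output distribution -/

theorem combine_bijective (hd : 2 ≤ d) (hR : 3 ≤ R) :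
    Function.Bijective fun sb : Outcome d R × Bits (Fin 2) => combine sb.1 sb.2 := by
  constructor
  · rintro ⟨s, b⟩ ⟨s', b'⟩ h
    simp only at h
    refine Prod.ext (funext fun c => ?_) (funext fun i => ?_)
    · have := congrFun h c.1
      rwa [combine_measured, combine_measured] at this
    · fin_cases i
      · have := congrFun h ⟨q₁, q₁_mem hd hR⟩
        rwa [combine_q₁, combine_q₁] at this
      · have := congrFun h ⟨q₂ R, q₂_mem hd hR⟩
        rwa [combine_q₂ hR, combine_q₂ hR] at this
  · intro y
    refine ⟨(fun c => y c.1, restr hd hR y), funext fun c => ?_⟩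
    simp only [combine, restr]
    split_ifs with h1 h2
    · exact congrArg y (Subtype.ext h1.symm)
    · exact congrArg y (Subtype.ext h2.symm)
    · rfl

theorem sum_outcomeProb (hd : 2 ≤ d) (hR : 3 ≤ R) (E : Pauli (Qubit d R)) :
    ∑ s, outcomeProb E s = 1 := by
  have h1 : normSq (hadamards (Finset.univ.filter fun c : Qubit d R => c.1 ∈ setX d R)
      (E.op (clusterState d R))) = 1 := by
    rw [isIsom_hadamards, isIsom_pauliOp, clusterState, isIsom_clusterUnitary, normSq_zeroState]
  rw [← h1, normSq, ← (combine_bijective hd hR).sum_comp, Fintype.sum_prod_type]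
  rfl

theorem sum_errorWeight (μ : PMF (Pauli (Qubit d R))) : ∑ E, errorWeight μ E = 1 := by
  rw [← ENNReal.toReal_sum fun E _ => μ.apply_ne_top E, ← tsum_fintype (L := .unconditional _),
    μ.tsum_coe, ENNReal.toReal_one]

/-- Outcomes of probability zero contribute nothing, so `A` is needed only where the normalized
state is meaningful. -/
theorem one_sub_weight_le_prob (hd : 2 ≤ d) (hR : 3 ≤ R) (μ : PMF (Pauli (Qubit d R)))
    (F : Pauli (Qubit d R) → Prop) (A : Pauli (Qubit d R) → Outcome d R → Prop)
    (h : ∀ E, ¬ F E → ∀ s, outcomeProb E s ≠ 0 → A E s) :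
    1 - weight (errorWeight μ) F ≤ prob μ A := by
  rw [← sum_errorWeight μ, weight, ← Finset.sum_sub_distrib, prob]
  refine Finset.sum_le_sum fun E _ => ?_
  split_ifs with hF
  · rw [sub_self]
    exact Finset.sum_nonneg fun s _ => by
      split_ifs
      · exact mul_nonneg (errorWeight_nonneg μ E) (outcomeProb_nonneg E s)
      · exact le_rfl
  · rw [sub_zero, ← mul_one (errorWeight μ E), ← sum_outcomeProb hd hR E, Finset.mul_sum]
    refine Finset.sum_le_sum fun s _ => ?_
    by_cases hs : outcomeProb E s = 0
    · simp [hs]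
    · rw [if_pos (h E hF s hs)]

theorem prob_nonneg (μ : PMF (Pauli (Qubit d R))) (A : Pauli (Qubit d R) → Outcome d R → Prop) :
    0 ≤ prob μ A :=
  Finset.sum_nonneg fun E _ => Finset.sum_nonneg fun s _ => by
    split_ifs
    · exact mul_nonneg (errorWeight_nonneg μ E) (outcomeProb_nonneg E s)
    · exact le_rfl

/-- For every error and every outcome that occurs, exactly one Bell label matches the output:
existence holds even when decoding fails, and uniqueness is `bell_eq_of_smul`. -/
theorem sum_outputProb (hd : 2 ≤ d) (hR : 3 ≤ R) (hodd : Odd R) (f g : Finset Site → Finset Site)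
    (μ : PMF (Pauli (Qubit d R))) :
    ∑ ab : ZMod 2 × ZMod 2, outputProb f g μ ab.1 ab.2 = 1 := by
  simp only [outputProb, prob]
  rw [Finset.sum_comm, ← sum_errorWeight μ]
  refine Finset.sum_congr rfl fun E _ => ?_
  rw [Finset.sum_comm, ← mul_one (errorWeight μ E), ← sum_outcomeProb hd hR E, Finset.mul_sum]
  refine Finset.sum_congr rfl fun s _ => ?_
  by_cases hs : outcomeProb E s = 0
  · simp [hs]
  · obtain ⟨-, hpost⟩ := postState_of_ne_zero hd hR hodd E s hs
    have hout := outputState_of_postState (f := f) (g := g) hpost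
    rw [Finset.sum_eq_single (_, _)]
    · exact if_pos hout
    · rintro ⟨α, β⟩ - hne
      refine if_neg fun h => hne ?_
      obtain ⟨a, ha, h⟩ := hout.symm.trans h
      obtain ⟨h1, h2⟩ := bell_eq_of_smul h
      exact Prod.ext h1.symm h2.symm
    · simp

theorem outputProb_zero_zero_ge (hd : 2 ≤ d) (hR : 3 ≤ R) (hodd : Odd R) {p : ℝ} (hp0 : 0 ≤ p)
    (hp : p ≤ 1 / 4806) {μ : PMF (Pauli (Qubit d R))} (hμ : IsLocalStochastic p μ)
    {f g : Finset Site → Finset Site} (hf : (primalGraph d R).IsMinMatchFun f)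
    (hg : (dualGraph d R).IsMinMatchFun g) :
    outputProb f g μ 0 0 ≥
      1 - (4806 + 200 * (d : ℝ) * (R : ℝ) * (10 * Real.sqrt p) ^ (d - 2)) * p := by
  have h1 := weight_fails_le hd hR hodd hp0 hp hμ hf hg
  have h2 := one_sub_weight_le_prob hd hR μ (Fails hd hR f g)
    (fun E s => SameState (outputState f g E s) (bell 0 0)) fun E hE s hs => by
      have := outputState_of_postState (f := f) (g := g)
        (postState_of_not_fails hd hR hodd hE hs)
      rwa [zmod_two_add_self, zmod_two_add_self] at this
  rw [outputProb]
  linarith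

theorem prob_postState_ge (hd : 2 ≤ d) (hR : 3 ≤ R) (hodd : Odd R) {p : ℝ} (hp0 : 0 ≤ p)
    (hp : p ≤ 1 / 4806) {μ : PMF (Pauli (Qubit d R))} (hμ : IsLocalStochastic p μ)
    {f g : Finset Site → Finset Site} (hf : (primalGraph d R).IsMinMatchFun f)
    (hg : (dualGraph d R).IsMinMatchFun g) :
    prob μ (fun E s => SameState (postState E s) (bell (corrX f s) (corrZ g s))) ≥
      1 - (4806 + 200 * (d : ℝ) * (R : ℝ) * (10 * Real.sqrt p) ^ (d - 2)) * p := by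
  have h1 := weight_fails_le hd hR hodd hp0 hp hμ hf hg
  have h2 := one_sub_weight_le_prob hd hR μ (Fails hd hR f g)
    (fun E s => SameState (postState E s) (bell (corrX f s) (corrZ g s)))
    fun E hE s hs => postState_of_not_fails hd hR hodd hE hs
  linarith

theorem exists_outputDistribution (hd : 2 ≤ d) (hR : 3 ≤ R) (hodd : Odd R)
    {f g : Finset Site → Finset Site} (hf : (primalGraph d R).IsMinMatchFun f)
    (hg : (dualGraph d R).IsMinMatchFun g) {p : ℝ} (hp0 : 0 ≤ p)
    {μ : PMF (Pauli (Qubit d R))} (hμ : IsLocalStochastic p μ) :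
    ∃ ν : PMF (ZMod 2 × ZMod 2), (∀ α β, outputProb f g μ α β = (ν (α, β)).toReal) ∧
      (ν (0, 0)).toReal ≥
        1 - (4806 + 200 * (d : ℝ) * (R : ℝ) * (10 * Real.sqrt p) ^ (d - 2)) * p := by
  have hnn : ∀ α β, 0 ≤ outputProb f g μ α β := fun α β => prob_nonneg μ _
  refine ⟨PMF.ofFintype (fun ab => ENNReal.ofReal (outputProb f g μ ab.1 ab.2)) ?_, ?_, ?_⟩
  · rw [← ENNReal.ofReal_sum_of_nonneg fun ab _ => hnn _ _, sum_outputProb hd hR hodd,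
      ENNReal.ofReal_one]
  · intro α β
    rw [PMF.ofFintype_apply, ENNReal.toReal_ofReal (hnn _ _)]
  · rw [PMF.ofFintype_apply, ENNReal.toReal_ofReal (hnn _ _)]
    -- Beyond `1 / 4806` the lower bound is negative and nothing has to be decoded.
    rcases le_or_gt p (1 / 4806) with hp | hp
    · exact outputProb_zero_zero_ge hd hR hodd hp0 hp hμ hf hg
    · have h1 : 0 ≤ 200 * (d : ℝ) * (R : ℝ) * (10 * Real.sqrt p) ^ (d - 2) * p := by positivity
      have h2 := hnn 0 0
      simp only at h2 ⊢
      nlinarith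

/-! ### Consequences for the choice of `d` -/

/-- The assumption on `R` says `dR(10√p)^(d-2) ≤ 1`, so the bracket is at most `4806 + 200`. -/
theorem error_bound_le {d R : ℕ} (hd : 3 ≤ d) {p : ℝ} (hp0 : 0 < p)
    (hR : (R : ℝ) ≤ 1 / (d : ℝ) * (1 / (10 * Real.sqrt p)) ^ (d - 2)) :
    1 - (4806 + 200 * (d : ℝ) * (R : ℝ) * (10 * Real.sqrt p) ^ (d - 2)) * p ≥ 1 - 5006 * p := by
  have hs : 0 < (10 * Real.sqrt p) ^ (d - 2) := by positivity
  have hd0 : (0 : ℝ) < d := by exact_mod_cast (by omega : 0 < d)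
  rw [one_div_pow, div_mul_div_comm, one_mul, le_div_iff₀ (by positivity)] at hR
  have : (d : ℝ) * R * (10 * Real.sqrt p) ^ (d - 2) ≤ 1 := by linarith
  nlinarith

theorem isTheta_natLog :
    Asymptotics.IsTheta Filter.atTop (fun R : ℕ => ((Nat.log 2 R + 5 : ℕ) : ℝ))
      (fun R : ℕ => Real.log R) := by
  have hlog2 := Real.log_two_gt_d9
  have hlog2' := Real.log_two_lt_d9
  constructor
  · refine Asymptotics.IsBigO.of_bound 10 ?_
    filter_upwards [Filter.eventually_ge_atTop 3] with R hR
    have hR0 : (0 : ℝ) < R := by exact_mod_cast (by omega : 0 < R)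
    have h1 : ((2 ^ Nat.log 2 R : ℕ) : ℝ) ≤ R := by exact_mod_cast Nat.pow_log_le_self 2 (by omega)
    have h2 := Real.log_le_log (by positivity) h1
    push_cast at h2
    rw [Real.log_pow] at h2
    have h3 : (1 : ℝ) ≤ Real.log R := by
      rw [Real.le_log_iff_exp_le hR0]
      have : (3 : ℝ) ≤ R := by exact_mod_cast hR
      linarith [Real.exp_one_lt_d9]
    rw [Real.norm_of_nonneg (by positivity), Real.norm_of_nonneg (by linarith)]
    push_cast
    have h4 : (0 : ℝ) ≤ Nat.log 2 R := by positivity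
    nlinarith
  · refine Asymptotics.IsBigO.of_bound 1 ?_
    filter_upwards [Filter.eventually_ge_atTop 1] with R hR
    have hR0 : (1 : ℝ) ≤ R := by exact_mod_cast hR
    have h1 : (R : ℝ) ≤ ((2 ^ (Nat.log 2 R + 1) : ℕ) : ℝ) := by
      exact_mod_cast (Nat.lt_pow_succ_log_self (by norm_num) R).le
    have h2 := Real.log_le_log (by linarith) h1
    push_cast at h2
    rw [Real.log_pow] at h2
    rw [Real.norm_of_nonneg (Real.log_nonneg hR0), Real.norm_of_nonneg (by positivity)]
    push_cast at h2 ⊢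
    have h4 : (0 : ℝ) ≤ Nat.log 2 R := by positivity
    nlinarith

/-- The bound on `p` makes `1/(10√p)` at least `4`, so with `k = Nat.log 2 R` and `d = k + 5` it
suffices that `R d ≤ 4^(k+3)`. This follows from `R ≤ 2^(k+1)` and `k + 5 ≤ 2^(k+3)`, for a `d` that
does not depend on `p`. -/
theorem le_of_natLog {R : ℕ} {p : ℝ} (hp0 : 0 < p) (hp : p ≤ 1 / 5006) :
    (R : ℝ) ≤ 1 / ((Nat.log 2 R + 5 : ℕ) : ℝ) *
      (1 / (10 * Real.sqrt p)) ^ (Nat.log 2 R + 5 - 2) := by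
  set k := Nat.log 2 R with hk
  have hs : 0 < 10 * Real.sqrt p := by positivity
  have h7 : (4 : ℝ) ≤ 1 / (10 * Real.sqrt p) := by
    rw [le_div_iff₀ hs]
    have : Real.sqrt p ≤ 1 / 40 := by
      rw [Real.sqrt_le_left (by norm_num)]
      norm_num
      linarith
    linarith
  have h1 : R * (k + 5) ≤ 4 ^ (k + 3) := by
    have h2 : R ≤ 2 ^ (k + 1) := (Nat.lt_pow_succ_log_self (by norm_num) R).le
    have h3 : k + 5 ≤ 2 ^ (k + 3) := by
      have := Nat.lt_two_pow_self (n := k)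
      rw [pow_add]
      omega
    calc R * (k + 5) ≤ 2 ^ (k + 1) * 2 ^ (k + 3) := Nat.mul_le_mul h2 h3
      _ = 4 ^ (k + 2) := by
        rw [← pow_add, show (4 : ℕ) = 2 ^ 2 by norm_num, ← pow_mul]
        congr 1
        ring
      _ ≤ 4 ^ (k + 3) := Nat.pow_le_pow_right (by norm_num) (by omega)
  have h4 : (R : ℝ) * ((k + 5 : ℕ) : ℝ) ≤ 4 ^ (k + 3) := by exact_mod_cast h1
  rw [one_div_mul_eq_div, le_div_iff₀ (by positivity), show k + 5 - 2 = k + 3 by omega]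
  exact h4.trans (pow_le_pow_left₀ (by norm_num) h7 _)

end Output

/-! ### The preparation circuit -/

section Circuit

variable {ι : Type} [Fintype ι] [DecidableEq ι] {G : SimpleGraph ι} [DecidableRel G.Adj]

theorem edgeProd_toFinset {l : List (Sym2 ι)} (hl : l.Nodup) :
    edgeProd l.toFinset = (l.map edgeCZ).prod :=
  Finset.noncommProd_toFinset l edgeCZ (fun e _ e' _ _ => edgeCZ_commute e e') hl

theorem hadamards_toFinset {l : List ι} (hl : l.Nodup) :
    hadamards l.toFinset = (l.map opH).prod :=
  Finset.noncommProd_toFinset l opH (fun c _ c' _ _ => opH_commute c c') hl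

/-- The layer of Hadamard gates on all qubits. -/
def hadLayer (G : SimpleGraph ι) : List (Gate G) := (Finset.univ : Finset ι).toList.map Gate.had

theorem isLayer_hadLayer (G : SimpleGraph ι) : IsLayer (hadLayer G) := by
  rw [IsLayer, hadLayer, List.pairwise_map]
  refine (Finset.nodup_toList _).imp fun h => ?_
  simpa [Gate.support] using h

theorem prod_hadLayer (G : SimpleGraph ι) :
    ((hadLayer G).map Gate.op).prod = hadamards Finset.univ := by
  rw [← Finset.toList_toFinset (Finset.univ : Finset ι),
    hadamards_toFinset (Finset.nodup_toList _), hadLayer, List.map_map]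
  rfl

/-- `P` selects one of the two darts of each edge, so every `CZ` occurs once. Darts of equal colour
share no endpoint, so each colour class is a layer; commutation lets the four layers replace the
unordered product. -/
theorem hasCircuitOfDepth_six (P : G.Dart → Prop) [DecidablePred P] (color : G.Dart → Bool × Bool)
    (hP : ∀ e, P e.symm ↔ ¬ P e)
    (hcolor : ∀ e e', P e → P e' → color e = color e' → e ≠ e' →
      e.fst ≠ e'.fst ∧ e.fst ≠ e'.snd ∧ e.snd ≠ e'.fst ∧ e.snd ≠ e'.snd) :
    HasCircuitOfDepth G 6 (clusterUnitary G) := by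
  set D : Bool × Bool → List G.Dart := fun k =>
    (Finset.univ.filter fun e : G.Dart => P e ∧ color e = k).toList with hD
  set cz : G.Dart → Gate G := fun e => Gate.cz e.fst e.snd e.adj with hcz
  have hmem : ∀ k e, e ∈ D k ↔ P e ∧ color e = k := fun k e => by simp [hD]
  have hlayer : ∀ k, IsLayer ((D k).map cz) := by
    intro k
    rw [IsLayer, List.pairwise_map]
    refine (Finset.nodup_toList _).imp_of_mem fun {e e'} he he' hne => ?_
    have h1 := (hmem k e).mp he
    have h2 := (hmem k e').mp he'
    obtain ⟨h3, h4, h5, h6⟩ := hcolor e e' h1.1 h2.1 (h1.2.trans h2.2.symm) hne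
    simp [hcz, Gate.support, h3.symm, h4.symm, h5.symm, h6.symm]
  set l : List G.Dart := D (true, true) ++ (D (true, false) ++ (D (false, true) ++ D (false, false)))
    with hl
  have hlmem : ∀ e, e ∈ l ↔ P e := by
    intro e
    simp only [hl, List.mem_append, hmem]
    rcases color e with ⟨_ | _, _ | _⟩ <;> simp
  have hdisj : ∀ k k', k ≠ k' → List.Disjoint (D k) (D k') := by
    intro k k' hk e he he'
    exact hk (((hmem k e).mp he).2.symm.trans ((hmem k' e).mp he').2)
  have hlnd : l.Nodup := by
    have hnd : ∀ k, (D k).Nodup := fun k => Finset.nodup_toList _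
    rw [hl]
    refine (hnd _).append ((hnd _).append ((hnd _).append (hnd _) (hdisj _ _ (by decide))) ?_) ?_
    · simp only [List.disjoint_append_right]
      exact ⟨hdisj _ _ (by decide), hdisj _ _ (by decide)⟩
    · simp only [List.disjoint_append_right]
      exact ⟨hdisj _ _ (by decide), hdisj _ _ (by decide), hdisj _ _ (by decide)⟩
  have hend : (l.map SimpleGraph.Dart.edge).Nodup := by
    refine hlnd.map_on fun e he e' he' h => ?_
    rcases (SimpleGraph.dart_edge_eq_iff e e').mp h with h | h
    · exact h
    · rw [h, hlmem, hP] at he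
      exact absurd ((hlmem e').mp he') he
  have hfin : (l.map SimpleGraph.Dart.edge).toFinset = G.edgeFinset := by
    ext e
    rw [List.mem_toFinset, List.mem_map, SimpleGraph.mem_edgeFinset]
    constructor
    · rintro ⟨a, -, rfl⟩
      exact a.edge_mem
    · intro he
      induction e with | _ u v
      by_cases hPe : P ⟨(u, v), he⟩
      · exact ⟨⟨(u, v), he⟩, (hlmem _).mpr hPe, rfl⟩
      · exact ⟨SimpleGraph.Dart.symm ⟨(u, v), he⟩, (hlmem _).mpr ((hP _).mpr hPe),
          SimpleGraph.Dart.edge_symm _⟩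
  have hop : ∀ m : List G.Dart, ((m.map cz).map Gate.op).prod =
      ((m.map SimpleGraph.Dart.edge).map edgeCZ).prod := fun m => by
    rw [List.map_map, List.map_map]
    rfl
  refine ⟨[hadLayer G, (D (false, false)).map cz, (D (false, true)).map cz,
    (D (true, false)).map cz, (D (true, true)).map cz, hadLayer G], rfl, ?_, ?_⟩
  · simp only [List.mem_cons, List.not_mem_nil, or_false]
    rintro m (rfl | rfl | rfl | rfl | rfl | rfl)
    · exact isLayer_hadLayer G
    · exact hlayer _
    · exact hlayer _
    · exact hlayer _
    · exact hlayer _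
    · exact isLayer_hadLayer G
  · rw [clusterUnitary_eq, ← hfin, edgeProd_toFinset hend, ← hop, hl]
    simp only [circuitOp, List.map_cons, List.map_nil, List.reverse_cons, List.reverse_nil,
      List.nil_append, List.cons_append, List.prod_cons, List.prod_nil, mul_one, prod_hadLayer,
      List.map_append, List.prod_append, mul_assoc]

end Circuit

/-! ### A proper four-colouring of the lattice edges -/

section LatticeCircuit

variable {d R : ℕ}

/-- The neighbouring sites `u`, `v` differ by a positive unit vector. -/
def IsPositive (u v : Site) : Prop := v.1 + v.2.1 + v.2.2 = u.1 + u.2.1 + u.2.2 + 1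

/-- The direction from `u` to `v` follows the odd coordinate of `u` in the cyclic order. -/
def IsCyclic (u v : Site) : Prop :=
  (u.1 % 2 = 1 ∧ v.2.1 ≠ u.2.1) ∨ (u.2.1 % 2 = 1 ∧ v.2.2 ≠ u.2.2) ∨ (u.2.2 % 2 = 1 ∧ v.1 ≠ u.1)

/-- Moving along the odd coordinate would give an all-even site, so only two axes remain, with two
signs each. -/
theorem neighbour_cases {u v : Site} (hu : OneOdd u) (hv : v ∈ qubits d R)
    (h : siteDist u v = 1) :
    (u.1 % 2 = 1 ∧ u.2.1 % 2 = 0 ∧ u.2.2 % 2 = 0 ∧ v.1 = u.1 ∧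
      (((v.2.1 = u.2.1 + 1 ∨ v.2.1 = u.2.1 - 1) ∧ v.2.2 = u.2.2) ∨
        ((v.2.2 = u.2.2 + 1 ∨ v.2.2 = u.2.2 - 1) ∧ v.2.1 = u.2.1))) ∨
    (u.1 % 2 = 0 ∧ u.2.1 % 2 = 1 ∧ u.2.2 % 2 = 0 ∧ v.2.1 = u.2.1 ∧
      (((v.1 = u.1 + 1 ∨ v.1 = u.1 - 1) ∧ v.2.2 = u.2.2) ∨
        ((v.2.2 = u.2.2 + 1 ∨ v.2.2 = u.2.2 - 1) ∧ v.1 = u.1))) ∨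
    (u.1 % 2 = 0 ∧ u.2.1 % 2 = 0 ∧ u.2.2 % 2 = 1 ∧ v.2.2 = u.2.2 ∧
      (((v.2.1 = u.2.1 + 1 ∨ v.2.1 = u.2.1 - 1) ∧ v.1 = u.1) ∨
        ((v.1 = u.1 + 1 ∨ v.1 = u.1 - 1) ∧ v.2.1 = u.2.1))) := by
  have hpar := (mem_qubits.mp hv).2.2
  rw [siteDist_eq_one_iff_natAbs] at h
  rcases oneOdd_iff.mp hu with h1 | h1 | h1
  · left; omega
  · right; left; omega
  · right; right; omega

theorem oneOdd_neighbour {u v : Site} (hu : u ∈ qubits d R) (hv : v ∈ qubits d R)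
    (h : siteDist u v = 1) : OneOdd v ↔ ¬ OneOdd u := by
  have h1 := (mem_qubits.mp hu).2
  have h2 := (mem_qubits.mp hv).2
  rw [siteDist_eq_one_iff_natAbs] at h
  have e : ∀ w : Site, w ∈ qubits d R → (OneOdd w ↔ (w.1 + w.2.1 + w.2.2) % 2 = 1) := fun w hw => by
    have h1 := (mem_qubits.mp hw).2
    rw [oneOdd_iff]
    omega
  rw [e u hu, e v hv]
  clear h1 h2
  omega

/-- The four neighbours of a one-odd qubit correspond to the four values of the two bits: sign of
the step, and which of the two even axes is used. -/
theorem eq_of_color_left {u v v' : Site} (hu : OneOdd u) (hv : v ∈ qubits d R)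
    (hv' : v' ∈ qubits d R) (h : siteDist u v = 1) (h' : siteDist u v' = 1)
    (hpos : IsPositive u v ↔ IsPositive u v') (hcyc : IsCyclic u v ↔ IsCyclic u v') : v = v' := by
  have h1 := neighbour_cases hu hv h
  have h2 := neighbour_cases hu hv' h'
  rw [IsPositive, IsPositive] at hpos
  rw [IsCyclic, IsCyclic] at hcyc
  rw [Prod.ext_iff, Prod.ext_iff]
  rcases h1 with ⟨ha, hb, hc, h1, h3⟩ | ⟨ha, hb, hc, h1, h3⟩ | ⟨ha, hb, hc, h1, h3⟩ <;>
    simp only [ha, hb, hc, zero_ne_one, one_ne_zero, false_and, true_and, false_or, or_false]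
      at h2 hcyc <;> rcases h3 with h3 | h3 <;> omega

/-- The one-odd neighbours of `v` arise by moving along one of its two odd axes `i`, `j`. The two
choices give the ordered pairs `(i, j)` and `(j, i)` of odd axis and direction, of which exactly one
is cyclic. -/
theorem eq_of_color_right {u u' v : Site} (hu : OneOdd u) (hu' : OneOdd u') (hv : v ∈ qubits d R)
    (h : siteDist u v = 1) (h' : siteDist u' v = 1)
    (hpos : IsPositive u v ↔ IsPositive u' v) (hcyc : IsCyclic u v ↔ IsCyclic u' v) : u = u' := by
  have h1 := neighbour_cases hu hv h
  have h2 := neighbour_cases hu' hv h'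
  rw [IsPositive, IsPositive] at hpos
  rw [IsCyclic, IsCyclic] at hcyc
  rw [Prod.ext_iff, Prod.ext_iff]
  rcases h1 with ⟨ha, hb, hc, h1, h3⟩ | ⟨ha, hb, hc, h1, h3⟩ | ⟨ha, hb, hc, h1, h3⟩ <;>
    rcases h2 with ⟨ha', hb', hc', h2, h4⟩ | ⟨ha', hb', hc', h2, h4⟩ | ⟨ha', hb', hc', h2, h4⟩ <;>
    simp only [ha, hb, hc, ha', hb', hc', zero_ne_one, false_and, true_and, false_or,
      or_false] at hcyc <;> rcases h3 with h3 | h3 <;> rcases h4 with h4 | h4 <;> omega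

theorem cluster_circuit (d R : ℕ) :
    HasCircuitOfDepth (clusterGraph d R) 6 (clusterUnitary (clusterGraph d R)) := by
  classical
  refine hasCircuitOfDepth_six (fun e => OneOdd e.fst.1)
    (fun e => (decide (IsPositive e.fst.1 e.snd.1), decide (IsCyclic e.fst.1 e.snd.1)))
    (fun e => oneOdd_neighbour e.fst.2 e.snd.2 e.adj) fun e e' he he' hc hne => ?_
  simp only [Prod.mk.injEq, decide_eq_decide] at hc
  have hs := oneOdd_neighbour e.fst.2 e.snd.2 e.adj
  have hs' := oneOdd_neighbour e'.fst.2 e'.snd.2 e'.adj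
  have hadj : siteDist e.fst.1 e.snd.1 = 1 := e.adj
  have hadj' : siteDist e'.fst.1 e'.snd.1 = 1 := e'.adj
  -- Coincidences of a first with a second endpoint contradict bipartiteness; the other two are
  -- excluded by the colours.
  refine ⟨fun h => ?_, fun h => ?_, fun h => ?_, fun h => ?_⟩
  · rw [← h] at hc hadj'
    exact hne (SimpleGraph.Dart.ext _ _ (Prod.ext h (Subtype.ext (eq_of_color_left he e.snd.2 e'.snd.2
      hadj hadj' hc.1 hc.2))))
  · exact hs'.mp (h ▸ he) he'
  · exact hs.mp (h ▸ he') he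
  · rw [← h] at hc hadj'
    exact hne (SimpleGraph.Dart.ext _ _ (Prod.ext (Subtype.ext (eq_of_color_right he he' e.snd.2
      hadj hadj' hc.1 hc.2)) h))

end LatticeCircuit

end ClusterBus

end

theorem mainTheorem1 :
    -- the preparation circuit has depth six
    (∀ d R : ℕ, 2 ≤ d → 3 ≤ R → Odd R →
      ClusterBus.HasCircuitOfDepth (ClusterBus.clusterGraph d R) 6
        (ClusterBus.clusterUnitary (ClusterBus.clusterGraph d R))) ∧
    -- the output is a random Bell basis state, with the bound on the success probability
    (∀ d R : ℕ, 2 ≤ d → 3 ≤ R → Odd R →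
      ∀ f g : Finset ClusterBus.Site → Finset ClusterBus.Site,
      (ClusterBus.primalGraph d R).IsMinMatchFun f →
      (ClusterBus.dualGraph d R).IsMinMatchFun g →
      ∀ p : ℝ, 0 ≤ p → p ≤ 1 / 400 →
      ∀ μ : PMF (ClusterBus.Pauli (ClusterBus.Qubit d R)), ClusterBus.IsLocalStochastic p μ →
      ∃ ν : PMF (ZMod 2 × ZMod 2),
        (∀ α β, ClusterBus.outputProb f g μ α β = (ν (α, β)).toReal) ∧
        (ν (0, 0)).toReal ≥
          1 - (4806 + 200 * (d : ℝ) * (R : ℝ) * (10 * Real.sqrt p) ^ (d - 2)) * p) ∧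
    -- constant fidelity over distances exponential in `d`
    (∀ d R : ℕ, 3 ≤ d → 3 ≤ R → Odd R →
      ∀ f g : Finset ClusterBus.Site → Finset ClusterBus.Site,
      (ClusterBus.primalGraph d R).IsMinMatchFun f →
      (ClusterBus.dualGraph d R).IsMinMatchFun g →
      ∀ p : ℝ, 0 < p → p ≤ 1 / 5006 →
      (R : ℝ) ≤ 1 / (d : ℝ) * (1 / (10 * Real.sqrt p)) ^ (d - 2) →
      ∀ μ : PMF (ClusterBus.Pauli (ClusterBus.Qubit d R)), ClusterBus.IsLocalStochastic p μ →
        ClusterBus.outputProb f g μ 0 0 ≥ 1 - 5006 * p ∧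
        ClusterBus.prob μ (fun E s => ClusterBus.SameState (ClusterBus.postState E s)
          (ClusterBus.bell (ClusterBus.corrX f s) (ClusterBus.corrZ g s))) ≥ 1 - 5006 * p) ∧
    -- `d = Θ(log R)` suffices
    (∃ D : ℕ → ℕ,
      Asymptotics.IsTheta Filter.atTop (fun R : ℕ => (D R : ℝ)) (fun R : ℕ => Real.log R) ∧
      ∀ R : ℕ, 3 ≤ R → Odd R → 3 ≤ D R ∧
      ∀ f g : Finset ClusterBus.Site → Finset ClusterBus.Site,
      (ClusterBus.primalGraph (D R) R).IsMinMatchFun f →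
      (ClusterBus.dualGraph (D R) R).IsMinMatchFun g →
      ∀ p : ℝ, 0 < p → p ≤ 1 / 5006 →
      ∀ μ : PMF (ClusterBus.Pauli (ClusterBus.Qubit (D R) R)),
        ClusterBus.IsLocalStochastic p μ →
        ClusterBus.outputProb f g μ 0 0 ≥ 1 - 5006 * p) := by
  refine ⟨fun d R _ _ _ => ClusterBus.cluster_circuit d R, ?_, ?_, ?_⟩
  · intro d R hd hR hodd f g hf hg p hp0 _ μ hμ
    exact ClusterBus.exists_outputDistribution hd hR hodd hf hg hp0 hμ
  · intro d R hd hR hodd f g hf hg p hp0 hp hRd μ hμ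
    have hb := ClusterBus.error_bound_le hd hp0 hRd
    have hp' : p ≤ 1 / 4806 := hp.trans (by norm_num)
    have h2 : 2 ≤ d := by omega
    have ho := ClusterBus.outputProb_zero_zero_ge h2 hR hodd hp0.le hp' hμ hf hg
    have hs := ClusterBus.prob_postState_ge h2 hR hodd hp0.le hp' hμ hf hg
    exact ⟨le_trans hb ho, le_trans hb hs⟩
  · refine ⟨fun R => Nat.log 2 R + 5, ClusterBus.isTheta_natLog, fun R hR hodd =>
      ⟨Nat.le_add_left_of_le (by norm_num), fun f g hf hg p hp0 hp μ hμ => ?_⟩⟩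
    have h3 : 3 ≤ Nat.log 2 R + 5 := by omega
    have h2 : 2 ≤ Nat.log 2 R + 5 := by omega
    have hb := ClusterBus.error_bound_le h3 hp0 (ClusterBus.le_of_natLog hp0 hp)
    have hp' : p ≤ 1 / 4806 := hp.trans (by norm_num)
    have ho := ClusterBus.outputProb_zero_zero_ge h2 hR hodd hp0.le hp' hμ hf hg
    exact le_trans hb ho
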